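/- Throughout, $d\ge 2$ and $P_c(z)=z^d+c$. A *disk* is a simply connected open subset of $\mathbb C$. For a disk $U$ and a connected set $X\subset U$, $\operatorname{mod}(U\setminus X)$ is the supremum of $m>0$ such that $U\setminus X$ contains a domain that separates $X$ from $\partial U$ (i.e. $X$ lies in a bounded part of its complement) and is conformally equivalent to $\{1<|z|<e^{2\pi m}\}$; this is the usual modulus when $U\setminus X$ is an annulus. A unicritical polynomial-like map of degree $d$ is a proper holomorphic map $g:V\to U$ of degree $d$ between disks, $\overline V$ compact in $U$, whose only critical point is $0$, of local degree $d$; $K(g)$ is the set of points that never leave $V$. **Renormalizations.** Let $f$ be an infinitely renormalizable unicritical polynomial-like map of degree $d$ with $n$-th renormalizations $\mathcal R^nf=f^{t_n}:V_n\to U_n$ ($n\ge 0$, $t_0=1$), which are unicritical polynomial-like maps of degree $d$ with connected Julia sets; put $K_n=K(\mathcal R^nf)$ and $W_n=(\mathcal R^nf)^{-1}(V_n)$. Let $S_n:V_n\to\mathbb C$ be a $\kappa$-quasiconformal hybrid conjugacy (straightening), $S_n(0)=0$, from $\mathcal R^nf:W_n\to V_n$ to a restriction of $P_{c_n}$, and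 let $r>1$ be such that for every $n$ the domain $D_n(r)$ bounded by the equipotential of level $r$ of $P_{c_n}$ is contained in $S_n(W_n)$. Let $\alpha_n$ be the dividing fixed point of $P_{c_n}$ (the fixed point where at least two external rays land). Puzzle pieces of depth $0$ of $P_{c_n}$ are the closures of the components of $D_n(r)$ minus $\alpha_n$ and the rays landing there; those of depth $j$ are the closures of the components of the $j$-th preimages of their interiors; $Y^j_{0}$ denotes the piece of depth $j$ that contains $0$. $P_{c_n}$ is *satellite* renormalizable if $P_{c_n}^{lq}(0)\in Y_0^1$ for all $l\ge0$, where $q$ is the number of rays landing at $\alpha_n$; it is *primitively* renormalizable if its favorite nest of critical puzzle pieces $Q^1\supset P^1\supset Q^2\supset P^2\supset\cdots$ contains some $Q^i$ such that the critical orbit never leaves $P^i$ under the first return map to $Q^i$. Here $Q^1$ is the pullback along the critical orbit, under $P_{c_n}^{kq}$ with $k\geq 1$ minimal such that such a $Z$ exists, of the piece $Z\not\ni 0$ of depth $1$ that contains $P_{c_n}^{kq}(0)$ and has a point of $P_{c_n}^{-1}(\alpha_n)\setminus\{\alpha_n\}$ on its boundary; the first child $P^i$ of $Q^i$ is the pullback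 of $Q^i$ along the critical orbit under the first return of $0$ to $Q^i$; and the favorite child $Q^{i+1}$ is the pullback of $Q^i$ along the critical orbit under $P_{c_n}^b$, where $b$ is the first moment when the critical orbit is again in $P^i$ after its first visit to $Q^i\setminus P^i$. In these two cases the first renormalization of $P_{c_n}$ is the restriction of $P_{c_n}^{p}$, with $p=q$, resp. $p$ the first return time of $0$ to $Q^i$, and its filled Julia set is the set of points whose orbit under $P_{c_n}^p$ stays in $Y^1_0$, resp. in $P^i$. That $\mathcal R^{n+1}f$ is the first renormalization of $\mathcal R^nf$ means that $P_{c_n}$ is satellite or primitively renormalizable, that $t_{n+1}=p\,t_n$, and that $S_n(K_{n+1})$ is this filled Julia set. **Normalization.** For all $n\ge1$: $\ \varepsilon\le\operatorname{mod}(U_n\setminus V_n)\le\eta\ $ and $\ \operatorname{mod}(V_n\setminus K_n)\le 2\eta$. **The annuli.** Say that level $m$ belongs to case $\mathscr C$ if $P_{c_m}$ and $P_{c_{m+1}}$ are both satellite renormalizable. For $m\leq k$ let $\mathbf B_{m,k}$ be the component containing $0$ of $\bigcup_{0\le i<t_k/t_m}P_{c_m}^i(S_m(K_k))$ (a Julia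 bouquet). If level $n-1$ belongs to case $\mathscr C$, let $\mathbf L'_n\subset\mathbf L_n\subset \operatorname{int}Y^0_0$ be disks in the plane of $P_{c_{n-1}}$, with $\mathbf B_{n-1,n+1}\subset\mathbf L_n'$, such that the moduli of $Y_0^0\setminus\mathbf L_n$, $\mathbf L_n\setminus\mathbf L_n'$, $\mathbf L_n'\setminus\mathbf B_{n-1,n+1}$ are in $[1/C,C]$, and let $\mathbf E_n\supset\mathbf B_{n,n+1}$ be a disk in $D_n(r)\cap S_n\big(S_{n-1}^{-1}(\mathbf L_n')\cap V_n\big)$ with $\operatorname{mod}(\mathbf E_n\setminus\mathbf B_{n,n+1})\ge1/C$; put $$\mathbb V_{n,0}=S_{n-1}^{-1}(\mathbf L_n),\qquad \Delta_{n,0}=S_n^{-1}(\mathbf E_n).$$ If level $n-1$ does not belong to case $\mathscr C$, put $$\mathbb V_{n,0}=V_n,\qquad \Delta_{n,0}=S_n^{-1}(D_n(r)).$$ **Lemma.** Given $d\ge2$, $\varepsilon>0$, $\eta$, $\kappa$ and $C>0$ there is a constant $M'\geq 1$, depending only on these numbers, such that the following holds. Let $f$ and $\tilde f$ be two infinitely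 renormalizable unicritical polynomial-like maps of degree $d$ with choices of domains, straightenings, levels $r$, $\tilde r$ and disks as above (with the constants $\varepsilon,\eta,\kappa,C$), and mark the objects of $\tilde f$ with a tilde. Then, for every $n\ge1$, the moduli of $\mathbb V_{n,0}\setminus\Delta_{n,0}$ and $\widetilde{\mathbb V}_{n,0}\setminus\widetilde\Delta_{n,0}$ are positive and finite, and $$\frac1{M'}\le\frac{\operatorname{mod}(\widetilde{\mathbb V}_{n,0}\setminus\widetilde\Delta_{n,0})}{\operatorname{mod}(\mathbb V_{n,0}\setminus\Delta_{n,0})}\le M'.$$ (No relation between $f$ and $\tilde f$ is needed. In particular this applies when they are topologically conjugate, so that their cases coincide, and to the levels $n=n(k)$ that remain when those $l\ge1$ for which $P_{c_{l-1}}$ is satellite and $P_{c_l}$ primitively renormalizable are skipped. With $d,\eta,\kappa=\kappa(\varepsilon),C$ fixed beforehand, $M'$ depends only on $\varepsilon$.) -/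

import Mathlib

open Set Filter Topology

noncomputable section

namespace GlueSpace

/-! ### Ring domains, moduli of annuli, quasiconformal maps -/

/-- `A` is a ring domain of modulus `m`: it is conformally equivalent to the round annulus
`{1 < |z| < R}` with `m = (log R) / (2 π)`. -/
def IsRing (A : Set ℂ) (m : ℝ) : Prop :=
  0 < m ∧ ∃ φ : ℂ → ℂ,
    DifferentiableOn ℂ φ {z | 1 < ‖z‖ ∧ ‖z‖ < Real.exp (2 * Real.pi * m)} ∧
    InjOn φ {z | 1 < ‖z‖ ∧ ‖z‖ < Real.exp (2 * Real.pi * m)} ∧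
    φ '' {z | 1 < ‖z‖ ∧ ‖z‖ < Real.exp (2 * Real.pi * m)} = A

/-- The points surrounded by `A`: the union of the bounded components of the complement. -/
def surrounded (A : Set ℂ) : Set ℂ :=
  {x | x ∈ Aᶜ ∧ Bornology.IsBounded (connectedComponentIn Aᶜ x)}

/-- The modulus of the annulus `U \ X`, for a topological disk `U` and a connected set `X` inside:
the supremum of the moduli of the ring domains in `U \ X` that go around `X`.  If `U \ X` is itself
a ring domain, this is its modulus; adding or removing boundary points does not matter. -/
def annMod (U X : Set ℂ) : ENNReal :=
  ⨆ (A : Set ℂ) (m : ℝ) (_ : IsRing A m ∧ A ⊆ U \ X ∧ X ⊆ surrounded A), ENNReal.ofReal m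

/-- A (continuous injective) map preserves orientation on `D`: the image of every circle that bounds
a disk in `D` winds once, in the positive sense, around the image of the centre. -/
def OrientationPreservingOn (D : Set ℂ) (h : ℂ → ℂ) : Prop :=
  ∀ z : ℂ, ∀ r : ℝ, 0 < r → Metric.closedBall z r ⊆ D →
    ∃ θ : ℝ → ℝ, Continuous θ ∧ θ 1 - θ 0 = 2 * Real.pi ∧
      ∀ s : ℝ, h (circleMap z r (2 * Real.pi * s)) - h z =
        (‖h (circleMap z r (2 * Real.pi * s)) - h z‖ : ℂ) * Complex.exp (θ s * Complex.I)

/-- The (ring) definition of a `K`-quasiconformal embedding of the open set `D` in the plane: an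
orientation preserving homeomorphism onto its image that distorts the moduli of the ring domains
with closure in `D` by a factor at most `K`. -/
structure IsQC (K : ℝ) (D : Set ℂ) (h : ℂ → ℂ) : Prop where
  one_le : 1 ≤ K
  isOpen : IsOpen D
  continuousOn : ContinuousOn h D
  injOn : InjOn h D
  orientation : OrientationPreservingOn D h
  ring_iff : ∀ A : Set ℂ, IsCompact (closure A) → closure A ⊆ D →
    ((∃ m, IsRing A m) ↔ ∃ m, IsRing (h '' A) m)
  ring_le : ∀ A : Set ℂ, IsCompact (closure A) → closure A ⊆ D → ∀ m m' : ℝ,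
    IsRing A m → IsRing (h '' A) m' → m / K ≤ m' ∧ m' ≤ K * m

/-! ### Unicritical polynomials: Julia sets, rays, equipotentials -/

/-- The unicritical polynomial `z ^ d + c`. -/
def P (d : ℕ) (c : ℂ) : ℂ → ℂ := fun z => z ^ d + c

/-- The filled Julia set of `P d c`. -/
def filledJulia (d : ℕ) (c : ℂ) : Set ℂ :=
  {z | ¬ Tendsto (fun n : ℕ => (P d c)^[n] z) atTop (Bornology.cobounded ℂ)}

/-- `B` is the Böttcher coordinate of `P d c` on the complement of the (connected) filled Julia
set. -/
structure IsBottcher (d : ℕ) (c : ℂ) (B : ℂ → ℂ) : Prop where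
  holo : DifferentiableOn ℂ B (filledJulia d c)ᶜ
  bij : BijOn B (filledJulia d c)ᶜ {w | 1 < ‖w‖}
  conj : ∀ z ∈ (filledJulia d c)ᶜ, B (P d c z) = B z ^ d
  tangent : Tendsto (fun z => B z / z) (Bornology.cobounded ℂ) (𝓝 1)

/-- The external ray of angle `θ`. -/
def ray (d : ℕ) (c : ℂ) (θ : ℝ) : Set ℂ :=
  {z | z ∈ (filledJulia d c)ᶜ ∧
    ∃ B, IsBottcher d c B ∧ ∃ s : ℝ, 1 < s ∧ B z = s * Complex.exp (θ * Complex.I)}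

/-- The external ray of angle `θ` lands at `x`. -/
def Lands (d : ℕ) (c : ℂ) (θ : ℝ) (x : ℂ) : Prop :=
  ∃ (B : ℂ → ℂ) (γ : ℝ → ℂ), IsBottcher d c B ∧
    (∀ s : ℝ, 1 < s → γ s ∈ (filledJulia d c)ᶜ ∧ B (γ s) = s * Complex.exp (θ * Complex.I)) ∧
    Tendsto γ (𝓝[>] 1) (𝓝 x)

/-- The domain bounded by the equipotential of level `r > 1`. -/
def insideEquipotential (d : ℕ) (c : ℂ) (r : ℝ) : Set ℂ :=
  {z | z ∈ filledJulia d c ∨ ∃ B, IsBottcher d c B ∧ ‖B z‖ < r}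

/-- `α` is the dividing fixed point, the landing point of exactly `q ≥ 2` external rays. -/
def IsDividing (d : ℕ) (c α : ℂ) (q : ℕ) : Prop :=
  P d c α = α ∧ 2 ≤ q ∧ {θ : ℝ | θ ∈ Ico 0 (2 * Real.pi) ∧ Lands d c θ α}.ncard = q

/-! ### Puzzle pieces and renormalization of polynomials -/

/-- The union of the external rays landing at `α`. -/
def raysAt (d : ℕ) (c α : ℂ) : Set ℂ := ⋃ θ ∈ {θ : ℝ | Lands d c θ α}, ray d c θ

/-- The union of the interiors of the puzzle pieces of depth `n` made with the equipotential of
level `r` and the rays landing at `α`. -/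
def puzzle (d : ℕ) (c α : ℂ) (r : ℝ) (n : ℕ) : Set ℂ :=
  (P d c)^[n] ⁻¹' (insideEquipotential d c r \ closure (raysAt d c α))

/-- The interior of the puzzle piece of depth `n` that contains `z`.  The piece itself is the
closure. -/
def piece (d : ℕ) (c α : ℂ) (r : ℝ) (n : ℕ) (z : ℂ) : Set ℂ :=
  connectedComponentIn (puzzle d c α r n) z

/-- The pullback of `Q` by the `n`-th iterate along the critical orbit. -/
def critPullback (d : ℕ) (c : ℂ) (n : ℕ) (Q : Set ℂ) : Set ℂ :=
  connectedComponentIn ((P d c)^[n] ⁻¹' Q) 0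

/-- `p` is the first positive moment when the critical orbit enters `Q`.  The first child of `Q` is
then `critPullback d c p Q`. -/
def IsFirstReturn (d : ℕ) (c : ℂ) (Q : Set ℂ) (p : ℕ) : Prop :=
  IsLeast {n : ℕ | 0 < n ∧ (P d c)^[n] 0 ∈ Q} p

/-- `Q'` is the favorite child of `Q`: the critical orbit first returns to `Q` outside the first
child at the moment `a`, and is back in the first child at the moment `b` for the first time after
that; `Q'` is the pullback of `Q` by the `b`-th iterate along the critical orbit. -/
def IsFavoriteChild (d : ℕ) (c : ℂ) (Q Q' : Set ℂ) : Prop :=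
  ∃ p a b : ℕ, IsFirstReturn d c Q p ∧
    IsLeast {n : ℕ | 0 < n ∧ (P d c)^[n] 0 ∈ Q \ critPullback d c p Q} a ∧
    IsLeast {n : ℕ | a < n ∧ (P d c)^[n] 0 ∈ critPullback d c p Q} b ∧
    Q' = critPullback d c b Q

/-- `w` lies in a non-critical piece of depth one attached to a preimage of `α` other than `α`. -/
def InSymmetricPiece (d : ℕ) (c α : ℂ) (r : ℝ) (w : ℂ) : Prop :=
  w ∈ puzzle d c α r 1 ∧ (0 : ℂ) ∉ piece d c α r 1 w ∧
    ∃ x ∈ closure (piece d c α r 1 w), P d c x = α ∧ x ≠ α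

/-- The (interiors of the) puzzle pieces `Q¹, Q², …` of the favorite nest. -/
inductive InNest (d : ℕ) (c α : ℂ) (r : ℝ) (q : ℕ) : Set ℂ → Prop
  | base (k : ℕ)
      (hk : IsLeast {k : ℕ | 0 < k ∧ InSymmetricPiece d c α r ((P d c)^[k * q] 0)} k) :
      InNest d c α r q
        (critPullback d c (k * q) (piece d c α r 1 ((P d c)^[k * q] 0)))
  | step (Q Q' : Set ℂ) (hQ : InNest d c α r q Q) (hQ' : IsFavoriteChild d c Q Q') :
      InNest d c α r q Q'

/-- `P d c` is satellite renormalizable; its first renormalization is a restriction of the `p`-th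
iterate and has the filled Julia set `Kl`. -/
def IsSatellite (d : ℕ) (c α : ℂ) (r : ℝ) (p : ℕ) (Kl : Set ℂ) : Prop :=
  IsDividing d c α p ∧
    (∀ l : ℕ, (P d c)^[l * p] 0 ∈ closure (piece d c α r 1 0)) ∧
    Kl = {z | ∀ l : ℕ, (P d c)^[l * p] z ∈ closure (piece d c α r 1 0)}

/-- `P d c` is primitively renormalizable: the critical orbit never escapes from the first child of
some piece `Q` of the favorite nest under iterates of the return map, which is the `p`-th iterate
there.  The first renormalization is that iterate; it has the filled Julia set `Kl`. -/
def IsPrimitive (d : ℕ) (c α : ℂ) (r : ℝ) (p : ℕ) (Kl : Set ℂ) : Prop :=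
  ∃ (q : ℕ) (Q : Set ℂ), IsDividing d c α q ∧ InNest d c α r q Q ∧ IsFirstReturn d c Q p ∧
    (∀ l : ℕ, (P d c)^[l * p] 0 ∈ critPullback d c p Q) ∧
    Kl = {z | ∀ l : ℕ, (P d c)^[l * p] z ∈ critPullback d c p Q}

/-! ### Polynomial-like maps -/

/-- An open simply connected subset of the plane. -/
def IsDisk (U : Set ℂ) : Prop := IsOpen U ∧ IsSimplyConnected U

/-- `g : V → U` is a unicritical polynomial-like map of degree `d` with critical point `0`. -/
structure IsPolyLike (d : ℕ) (g : ℂ → ℂ) (V U : Set ℂ) : Prop where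
  disk_dom : IsDisk V
  disk_range : IsDisk U
  compact_closure : IsCompact (closure V)
  closure_subset : closure V ⊆ U
  holo : DifferentiableOn ℂ g V
  mapsTo : MapsTo g V U
  proper : ∀ T ⊆ U, IsCompact T → IsCompact (V ∩ g ⁻¹' T)
  zero_mem : (0 : ℂ) ∈ V
  fiber_crit : ∀ z ∈ V, g z = g 0 → z = 0
  fiber : ∀ w ∈ U, w ≠ g 0 → {z | z ∈ V ∧ g z = w}.ncard = d

/-- The filled Julia set of `g` restricted to `V`. -/
def filled (g : ℂ → ℂ) (V : Set ℂ) : Set ℂ := {z | ∀ j : ℕ, g^[j] z ∈ V}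

/-- `S` is a `K`-quasiconformal hybrid conjugacy, fixing `0`, from `g : W → V` to a restriction of
`P d c`, where `W` is the part of `V` mapped into `V` and the filled Julia set of `g` is `X`. -/
structure IsStraightening (d : ℕ) (K : ℝ) (g : ℂ → ℂ) (V X : Set ℂ) (c : ℂ) (S : ℂ → ℂ) :
    Prop where
  qc : IsQC K V S
  zero : S 0 = 0
  conj : ∀ z ∈ V, g z ∈ V → S (g z) = P d c (S z)
  hybrid : ∀ᵐ z ∂(MeasureTheory.volume : MeasureTheory.Measure ℂ),
    z ∈ X → DifferentiableAt ℂ S z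

/-! ### The construction -/

/-- The objects chosen for one infinitely renormalizable map `f`. -/
structure Choices where
  /-- the map -/
  f : ℂ → ℂ
  /-- ranges of the renormalizations -/
  U : ℕ → Set ℂ
  /-- domains of the renormalizations -/
  V : ℕ → Set ℂ
  /-- periods of the renormalizations -/
  t : ℕ → ℕ
  /-- parameters of the straightened renormalizations -/
  c : ℕ → ℂ
  /-- dividing fixed points of the straightened renormalizations -/
  α : ℕ → ℂ
  /-- straightenings -/
  S : ℕ → ℂ → ℂ
  /-- level of the equipotentials -/
  r : ℝ
  /-- `L (n + 1)` and `L' (n + 1)` are disks in the plane of `P d (c n)` -/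
  L : ℕ → Set ℂ
  L' : ℕ → Set ℂ
  /-- `E n` is a disk in the plane of `P d (c n)` -/
  E : ℕ → Set ℂ

namespace Choices

variable (F : Choices) (d : ℕ)

/-- The `n`-th renormalization, to be restricted to `V n`. -/
def R (n : ℕ) : ℂ → ℂ := F.f^[F.t n]

/-- The little filled Julia set of level `n` that contains the critical point. -/
def K (n : ℕ) : Set ℂ := filled (F.R n) (F.V n)

/-- The preimage of `V n` under the `n`-th renormalization. -/
def W (n : ℕ) : Set ℂ := {z | z ∈ F.V n ∧ F.R n z ∈ F.V n}

/-- The preimage under the straightening `S n` of a set in the plane of `P d (c n)`. -/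
def pull (n : ℕ) (X : Set ℂ) : Set ℂ := {z | z ∈ F.V n ∧ F.S n z ∈ X}

/-- The `n`-th renormalization is satellite renormalizable. -/
def Sat (n : ℕ) : Prop := ∃ p Kl, IsSatellite d (F.c n) (F.α n) F.r p Kl

/-- Level `n` belongs to the last of the three cases: the `n`-th and `(n + 1)`-st renormalizations
are both satellite renormalizable. -/
def CaseC (n : ℕ) : Prop := F.Sat d n ∧ F.Sat d (n + 1)

/-- The Julia bouquet of level `m` in the plane of `P d (c n)`, for `n ≤ m`: the connected component
containing the critical point of the union of the little Julia sets of level `m`. -/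
def bouquet (n m : ℕ) : Set ℂ :=
  connectedComponentIn
    (⋃ i ∈ Finset.range (F.t m / F.t n), (P d (F.c n))^[i] '' (F.S n '' F.K m)) 0

open Classical in
/-- The disk `𝕍 n`, the hole around the critical point of the multiply connected domain that precedes
level `n ≥ 1`: the preimage of `L n` if level `n` follows the last case, and `V n` otherwise.  (Levels
that the construction skips fall under `otherwise`; nothing is lost by keeping them.) -/
def hole : ℕ → Set ℂ
  | 0 => F.V 0
  | n + 1 => if F.CaseC d n then F.pull n (F.L (n + 1)) else F.V (n + 1)

open Classical in
/-- The disk `Δ n` cut out by the outer boundary of the multiply connected domain of level `n`: the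
preimage of `E n` if level `n` follows the last case, and the preimage of the domain bounded by the
equipotential otherwise. -/
def Del : ℕ → Set ℂ
  | 0 => F.pull 0 (insideEquipotential d (F.c 0) F.r)
  | n + 1 => if F.CaseC d n then F.pull (n + 1) (F.E (n + 1))
      else F.pull (n + 1) (insideEquipotential d (F.c (n + 1)) F.r)

end Choices

/-- The requirements on the choices.  Here `ε` is the a priori bound, `η` the upper bound in the
normalization of the domains, `κ` the bound on the dilatation of the straightenings, and `C` the
bound for the moduli of the annuli around Julia bouquets. -/
structure Admissible (d : ℕ) (ε η κ C : ℝ) (F : Choices) : Prop where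
  t_zero : F.t 0 = 1
  polyLike : ∀ n, IsPolyLike d (F.R n) (F.V n) (F.U n)
  orbit : ∀ n, ∀ z ∈ F.V n, ∀ j < F.t n, F.f^[j] z ∈ F.V 0
  connected : ∀ n, IsConnected (frontier (F.K n))
  straight : ∀ n, IsStraightening d κ (F.R n) (F.V n) (F.K n) (F.c n) (F.S n)
  one_lt : 1 < F.r
  equip : ∀ n, insideEquipotential d (F.c n) F.r ⊆ F.S n '' F.W n
  /-- The `(n + 1)`-st renormalization is the first renormalization of the `n`-th one. -/
  renorm : ∀ n, ∃ (p : ℕ) (Kl : Set ℂ), F.t (n + 1) = F.t n * p ∧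
    (IsSatellite d (F.c n) (F.α n) F.r p Kl ∨ IsPrimitive d (F.c n) (F.α n) F.r p Kl) ∧
    F.K (n + 1) = F.pull n Kl
  /-- A priori bounds and normalization of the domains. -/
  bounds : ∀ n, 1 ≤ n → ENNReal.ofReal ε ≤ annMod (F.U n) (F.V n) ∧
    annMod (F.U n) (F.V n) ≤ ENNReal.ofReal η ∧
    annMod (F.V n) (F.K n) ≤ ENNReal.ofReal (2 * η)
  /-- The disks `L` and `L'` around Julia bouquets. -/
  disks : ∀ n, F.CaseC d n →
    IsDisk (F.L (n + 1)) ∧ IsDisk (F.L' (n + 1)) ∧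
    F.L (n + 1) ⊆ piece d (F.c n) (F.α n) F.r 0 0 ∧
    F.L' (n + 1) ⊆ F.L (n + 1) ∧
    F.bouquet d n (n + 2) ⊆ F.L' (n + 1) ∧
    annMod (piece d (F.c n) (F.α n) F.r 0 0) (F.L (n + 1))
      ∈ Icc (ENNReal.ofReal (1 / C)) (ENNReal.ofReal C) ∧
    annMod (F.L (n + 1)) (F.L' (n + 1)) ∈ Icc (ENNReal.ofReal (1 / C)) (ENNReal.ofReal C) ∧
    annMod (F.L' (n + 1)) (F.bouquet d n (n + 2))
      ∈ Icc (ENNReal.ofReal (1 / C)) (ENNReal.ofReal C)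
  /-- The disks `E` that replace the equipotential disks at a level following the last case. -/
  disksE : ∀ n, F.CaseC d n →
    IsDisk (F.E (n + 1)) ∧
    F.E (n + 1) ⊆ F.S (n + 1) '' (F.pull n (F.L' (n + 1)) ∩ F.V (n + 1)) ∩
      insideEquipotential d (F.c (n + 1)) F.r ∧
    F.bouquet d (n + 1) (n + 2) ⊆ F.E (n + 1) ∧
    ENNReal.ofReal (1 / C) ≤ annMod (F.E (n + 1)) (F.bouquet d (n + 1) (n + 2))

end GlueSpace

end

noncomputable section

section

namespace GlueSpace

/-! ### Winding numbers -/

/-! Each annulus has its own two-sided bound `lo ≤ mod ≤ hi`, with `lo > 0` and `hi` depending only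
on d, ε, η, κ, C (`Admissible.annMod_mem_Icc`). The ratio is then at most hi / lo, and the two maps
never have to be compared with each other.

Outside case 𝒞 the bounds come from monotonicity. The disk cut out at level n lies in W_n, and a
ring in U_n \ V_n pulls back through the degree d branched covering to a ring in V_n \ W_n that
loses at most a factor d (`IsPolyLike.annMod_le`). Hence mod ≥ ε/d. The disk also contains K_n, so
mod ≤ mod(V_n \ K_n) ≤ 2η.

After case 𝒞 the lower bound comes from a ring in L \ L', pulled back by the κ-quasiconformal
straightening. The upper bound is the real content (`IsRing.le_or_le`, `Admissible.annMod_pull_le`).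
Let A be a ring between the hole and the cut out disk. The dividing fixed point of the preceding
level corresponds to a point b of K_n, since that level is satellite, and b is outside the hole,
since L avoids the rays landing there. The dividing fixed point of level n corresponds to a point a
of K_{n+1}, which lies in the cut out disk. So A separates {0, a} from {b, ∞}, and every core loop
of A meets the connected set K_n. - If the middle third of A lies in V_n, the straightening carries
it to a ring separating 0 and α_n from a point of norm at most 2. Since α_n is not attracting, |α_n|
≥ 1/d, and a length-area estimate bounds the modulus (`StripMap.le_of_separates`). - Otherwise the
unbounded complement of V_n reaches the middle third and crosses one of the outer thirds. All loops
there join K_n to the complement of V_n, hence cross a ring of V_n \ K_n of modulus at least ε/(2d).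
A second length-area estimate applies (`StripMap.le_of_crosses`).

Rings are handled through their universal covering by a vertical strip (`StripMap`), and statements
about what they surround are reduced to winding numbers of the loops Re = s. -/

/-- The loop `γ`, parametrized with period `2 π`, avoids `0` and winds `n` times around it. -/
def Winds (γ : ℝ → ℂ) (n : ℤ) : Prop :=
  ∃ L : ℝ → ℂ, Continuous L ∧ (∀ t, Complex.exp (L t) = γ t) ∧
    ∀ t, L (t + 2 * Real.pi) = L t + n * (2 * Real.pi * Complex.I)

/-- The values lie in the discrete set 2πiℤ, so they cannot vary on a connected set. Existence and
uniqueness of winding numbers both rest on this. -/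
theorem exists_int_const_of_exp_eq_one {X : Type*} [TopologicalSpace X] {S : Set X}
    (hS : IsPreconnected S) {f : X → ℂ} (hf : ContinuousOn f S)
    (h : ∀ x ∈ S, Complex.exp (f x) = 1) :
    ∃ n : ℤ, ∀ x ∈ S, f x = n * (2 * Real.pi * Complex.I) := by
  rcases S.eq_empty_or_nonempty with rfl | ⟨x₀, hx₀⟩
  · exact ⟨0, by simp⟩
  have h1 : ∀ x ∈ S, ∃ n : ℤ, f x = n * (2 * Real.pi * Complex.I) := fun x hx =>
    Complex.exp_eq_one_iff.1 (h x hx)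
  choose! N hN using h1
  refine ⟨N x₀, fun x hx => ?_⟩
  have hc : ContinuousOn (fun x => (f x).im / (2 * Real.pi)) S :=
    (Complex.continuous_im.comp_continuousOn hf).div_const _
  have hv : ∀ x ∈ S, (f x).im / (2 * Real.pi) = N x := by
    intro x hx
    rw [hN x hx]
    have := Real.pi_pos
    simp
  have hN' : ContinuousOn N S := by
    have : ContinuousOn (fun x => ((N x : ℤ) : ℝ)) S := hc.congr fun x hx => (hv x hx).symm
    exact Int.isClosedEmbedding_coe_real.isInducing.continuousOn_iff.2 this
  have := hS.constant hN' hx hx₀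
  rw [hN x hx, this]

theorem Winds.exists {γ : ℝ → ℂ} (hc : Continuous γ) (h0 : ∀ t, γ t ≠ 0)
    (hp : ∀ t, γ (t + 2 * Real.pi) = γ t) : ∃ n, Winds γ n := by
  obtain ⟨L, hL, hL'⟩ := Complex.exists_continuousOn_eqOn_exp_comp (X := ℝ) (U := univ)
    (by
      have : ContractibleSpace (univ : Set ℝ) := 
        (Homeomorph.Set.univ ℝ).contractibleSpace
      exact (inferInstance : SimplyConnectedSpace (univ : Set ℝ))) isOpen_univ hc.continuousOn
    (by rintro ⟨t, -, ht⟩; exact h0 t ht)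
  rw [← continuousOn_univ.symm.eq] at hL
  have hLe : ∀ t, Complex.exp (L t) = γ t := fun t => hL' (mem_univ t)
  obtain ⟨n, hn⟩ := exists_int_const_of_exp_eq_one (isPreconnected_univ (α := ℝ))
    (f := fun t => L (t + 2 * Real.pi) - L t)
    (by fun_prop) (by
      intro t _
      rw [Complex.exp_sub, hLe, hLe, hp, div_self (h0 t)])
  exact ⟨n, L, hL, hLe, fun t => by rw [← hn t (mem_univ t)]; ring⟩

theorem Winds.ne_zero {γ : ℝ → ℂ} {n : ℤ} (h : Winds γ n) (t : ℝ) : γ t ≠ 0 := by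
  obtain ⟨L, -, hL, -⟩ := h
  rw [← hL]; exact Complex.exp_ne_zero _

theorem Winds.continuous {γ : ℝ → ℂ} {n : ℤ} (h : Winds γ n) : Continuous γ := by
  obtain ⟨L, hc, hL, -⟩ := h
  rw [show γ = fun t => Complex.exp (L t) from funext fun t => (hL t).symm]
  fun_prop

theorem Winds.periodic {γ : ℝ → ℂ} {n : ℤ} (h : Winds γ n) (t : ℝ) :
    γ (t + 2 * Real.pi) = γ t := by
  obtain ⟨L, hc, hL, hp⟩ := h
  rw [← hL, ← hL, hp, Complex.exp_add, Complex.exp_int_mul_two_pi_mul_I, mul_one]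

theorem Winds.unique {γ : ℝ → ℂ} {n m : ℤ} (h : Winds γ n) (h' : Winds γ m) : n = m := by
  obtain ⟨L, hc, hL, hp⟩ := h
  obtain ⟨L', hc', hL', hp'⟩ := h'
  obtain ⟨k, hk⟩ := exists_int_const_of_exp_eq_one (isPreconnected_univ (α := ℝ))
    (f := fun t => L t - L' t) (by fun_prop) (by
      intro t _
      rw [Complex.exp_sub, hL, hL', div_self]
      rw [← hL]; exact Complex.exp_ne_zero _)
  have h1 := hk 0 (mem_univ _)
  have h2 := hk (0 + 2 * Real.pi) (mem_univ _)
  simp only [hp, hp'] at h2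
  have h3 : ((n : ℂ) - m) * (2 * Real.pi * Complex.I) = 0 := by linear_combination h2 - h1
  have h4 : (n : ℂ) - m = 0 := by
    rcases mul_eq_zero.1 h3 with h | h
    · exact h
    · exact absurd h Complex.two_pi_I_ne_zero
  exact_mod_cast sub_eq_zero.1 h4

theorem Winds.mul {γ δ : ℝ → ℂ} {n m : ℤ} (h : Winds γ n) (h' : Winds δ m) :
    Winds (fun t => γ t * δ t) (n + m) := by
  obtain ⟨L, hc, hL, hp⟩ := h
  obtain ⟨L', hc', hL', hp'⟩ := h'
  refine ⟨fun t => L t + L' t, by fun_prop, fun t => by rw [Complex.exp_add, hL, hL'],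
    fun t => ?_⟩
  simp only [hp, hp']; push_cast; ring

theorem Winds.pow {γ : ℝ → ℂ} {n : ℤ} (h : Winds γ n) (k : ℕ) :
    Winds (fun t => γ t ^ k) (k * n) := by
  obtain ⟨L, hc, hL, hp⟩ := h
  refine ⟨fun t => k * L t, by fun_prop, fun t => by rw [Complex.exp_nat_mul, hL],
    fun t => ?_⟩
  simp only [hp]; push_cast; ring

theorem Winds.comp_mul {γ : ℝ → ℂ} {n : ℤ} (h : Winds γ n) (k : ℕ) :
    Winds (fun t => γ (k * t)) (k * n) := by
  obtain ⟨L, hc, hL, hp⟩ := h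
  refine ⟨fun t => L (k * t), by fun_prop, fun t => hL _, fun t => ?_⟩
  have : ∀ (j : ℕ) (s : ℝ), L (s + j * (2 * Real.pi)) = L s + j * n * (2 * Real.pi * Complex.I) := by
    intro j
    induction j with
    | zero => intro s; simp
    | succ j ih =>
      intro s
      have : s + ((j + 1 : ℕ) : ℝ) * (2 * Real.pi) = (s + j * (2 * Real.pi)) + 2 * Real.pi := by
        push_cast; ring
      rw [this, hp, ih]; push_cast; ring
  have h2 := this k (k * t)
  simp only
  rw [show (k : ℝ) * (t + 2 * Real.pi) = k * t + k * (2 * Real.pi) by ring, h2]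
  push_cast; ring

theorem winds_exp_comp {l : ℝ → ℂ} (hl : Continuous l) (hp : ∀ t, l (t + 2 * Real.pi) = l t) :
    Winds (fun t => Complex.exp (l t)) 0 :=
  ⟨l, hl, fun _ => rfl, fun t => by simp [hp]⟩

theorem winds_const {c : ℂ} (hc : c ≠ 0) : Winds (fun _ => c) 0 :=
  ⟨fun _ => Complex.log c, continuous_const, fun _ => Complex.exp_log hc, by simp⟩

theorem winds_exp (s : ℝ) : Winds (fun t => Complex.exp (s + t * Complex.I)) 1 :=
  ⟨fun t => s + t * Complex.I, by fun_prop, fun _ => rfl, fun t => by push_cast; ring⟩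

/-- Rouché: δ/γ stays in the unit disk around 1, where the principal logarithm is continuous, so
this quotient contributes winding number 0. -/
theorem Winds.perturb {γ δ : ℝ → ℂ} {n : ℤ} (h : Winds γ n) (hc : Continuous δ)
    (hp : ∀ t, δ (t + 2 * Real.pi) = δ t) (hd : ∀ t, ‖δ t - γ t‖ < ‖γ t‖) : Winds δ n := by
  have h0 := h.ne_zero
  have hs : ∀ t, δ t / γ t ∈ Complex.slitPlane := by
    intro t
    have : δ t / γ t = 1 + (δ t - γ t) / γ t := by field_simp [h0 t]; ring
    rw [this]
    apply Complex.mem_slitPlane_of_norm_lt_one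
    rw [norm_div, div_lt_one (norm_pos_iff.2 (h0 t))]
    exact hd t
  have hγ := h.continuous
  have h2 : Winds (fun t => Complex.exp (Complex.log (δ t / γ t))) 0 := by
    refine winds_exp_comp ?_ fun t => by rw [hp, h.periodic]
    exact (hc.div hγ h0).clog hs
  have h3 := h.mul h2
  rw [add_zero] at h3
  convert h3 using 2 with t
  rw [Complex.exp_log (Complex.slitPlane_ne_zero (hs t))]
  field_simp [h0 t]

theorem exists_norm_ge_of_periodic {γ : ℝ → ℂ} (hc : Continuous γ) (h0 : ∀ t, γ t ≠ 0)
    (hp : ∀ t, γ (t + 2 * Real.pi) = γ t) : ∃ ε > 0, ∀ t, ε ≤ ‖γ t‖ := by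
  obtain ⟨t₀, -, ht₀⟩ := (isCompact_Icc (a := (0 : ℝ)) (b := 2 * Real.pi)).exists_isMinOn
    ⟨0, by simp [Real.pi_pos.le]⟩ (hc.norm.continuousOn)
  refine ⟨‖γ t₀‖, norm_pos_iff.2 (h0 _), fun t => ?_⟩
  obtain ⟨s, hs, hst⟩ := Function.Periodic.exists_mem_Ico₀ (f := γ) hp (by positivity) t
  rw [hst]
  exact ht₀ (Ico_subset_Icc_self hs)

/-- Homotopy invariance of winding numbers. -/
theorem winds_of_homotopy {X : Type*} [TopologicalSpace X] {S : Set X} (hS : IsPreconnected S)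
    {H : X → ℝ → ℂ} (hc : ContinuousOn (fun q : X × ℝ => H q.1 q.2) (S ×ˢ univ))
    (h0 : ∀ x ∈ S, ∀ t, H x t ≠ 0) (hp : ∀ x ∈ S, ∀ t, H x (t + 2 * Real.pi) = H x t)
    {x y : X} (hx : x ∈ S) (hy : y ∈ S) {n : ℤ} (h : Winds (H x) n) : Winds (H y) n := by
  have hcx : ∀ x ∈ S, Continuous (H x) := by
    intro x hx
    rw [← continuousOn_univ]
    exact hc.comp (f := fun t => (x, t)) (by fun_prop) fun t _ => ⟨hx, mem_univ _⟩
  have hex : ∀ x ∈ S, ∃ n, Winds (H x) n := fun x hx => Winds.exists (hcx x hx) (h0 x hx) (hp x hx)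
  choose! N hN using hex
  -- Compactness of one period makes nearby loops uniformly closer than the minimum of |H x|; by
  -- `Winds.perturb` the winding number is locally constant.
  have hloc : ∀ x ∈ S, ∀ᶠ y in 𝓝[S] x, Winds (H y) (N x) := by
    intro x hx
    obtain ⟨ε, hε, hεl⟩ := exists_norm_ge_of_periodic (hcx x hx) (h0 x hx) (hp x hx)
    have key : ∀ᶠ y in 𝓝[S] x, ∀ t ∈ Icc (0 : ℝ) (2 * Real.pi), ‖H y t - H x t‖ < ε := by
      rw [eventually_nhdsWithin_iff]
      suffices h : ∀ᶠ y in 𝓝 x, ∀ t ∈ Icc (0 : ℝ) (2 * Real.pi), y ∈ S → ‖H y t - H x t‖ < ε by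
        filter_upwards [h] with y hy hyS t ht using hy t ht hyS
      apply IsCompact.eventually_forall_of_forall_eventually isCompact_Icc
      intro t ht
      have h1 : ContinuousWithinAt (fun q : X × ℝ => ‖H q.1 q.2 - H x q.2‖) (S ×ˢ univ) (x, t) := by
        refine ContinuousWithinAt.norm (ContinuousWithinAt.sub (hc _ ⟨hx, mem_univ _⟩) ?_)
        exact ((hcx x hx).comp continuous_snd).continuousWithinAt
      have h2 := h1.eventually_lt_const (u := ε) (by simpa using hε)
      rw [eventually_nhdsWithin_iff] at h2
      filter_upwards [h2] with q hq hqS using hq ⟨hqS, mem_univ _⟩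
    filter_upwards [key, self_mem_nhdsWithin] with y hy hyS
    refine (hN x hx).perturb (hcx y hyS) (hp y hyS) fun t => lt_of_lt_of_le ?_ (hεl t)
    obtain ⟨s, hs, hst⟩ := Function.Periodic.exists_mem_Ico₀
      (f := fun t => H y t - H x t) (c := 2 * Real.pi)
      (fun t => by simp only [hp y hyS, hp x hx]) (by positivity) t
    rw [hst]
    exact hy s (Ico_subset_Icc_self hs)
  have hNc : ContinuousOn N S := by
    intro x hx
    refine ContinuousWithinAt.congr_of_eventuallyEq (f := fun _ => N x) continuousWithinAt_const ?_ rfl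
    filter_upwards [hloc x hx, self_mem_nhdsWithin] with y hy hyS using (hN y hyS).unique hy
  have := hS.constant hNc hx hy
  rw [h.unique (hN x hx), this]
  exact hN y hy

theorem exists_norm_le_of_periodic {γ : ℝ → ℂ} (hc : Continuous γ)
    (hp : ∀ t, γ (t + 2 * Real.pi) = γ t) : ∃ C, ∀ t, ‖γ t‖ ≤ C := by
  obtain ⟨t₀, -, ht₀⟩ := (isCompact_Icc (a := (0 : ℝ)) (b := 2 * Real.pi)).exists_isMaxOn
    ⟨0, by simp [Real.pi_pos.le]⟩ (hc.norm.continuousOn)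
  refine ⟨‖γ t₀‖, fun t => ?_⟩
  obtain ⟨s, hs, hst⟩ := Function.Periodic.exists_mem_Ico₀ (f := γ) hp (by positivity) t
  rw [hst]
  exact ht₀ (Ico_subset_Icc_self hs)

/-- The winding number is constant on connected sets that a loop avoids. -/
theorem Winds.of_preconnected {γ : ℝ → ℂ} (hc : Continuous γ)
    (hp : ∀ t, γ (t + 2 * Real.pi) = γ t) {Z : Set ℂ} (hZ : IsPreconnected Z)
    (hd : ∀ t, γ t ∉ Z) {x y : ℂ} (hx : x ∈ Z) (hy : y ∈ Z) {n : ℤ}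
    (h : Winds (fun t => γ t - x) n) : Winds (fun t => γ t - y) n :=
  winds_of_homotopy hZ (H := fun x t => γ t - x) (by fun_prop)
    (fun x hx t h => hd t (sub_eq_zero.1 h ▸ hx)) (fun x _ t => by rw [hp]) hx hy h

/-- The point can be moved within `Z` beyond the reach of the loop; seen from there, the loop is a
small perturbation of a nonzero constant. -/
theorem winds_zero_of_not_isBounded {γ : ℝ → ℂ} (hc : Continuous γ)
    (hp : ∀ t, γ (t + 2 * Real.pi) = γ t) {Z : Set ℂ} (hZ : IsPreconnected Z)
    (hd : ∀ t, γ t ∉ Z) {x : ℂ} (hx : x ∈ Z) (hb : ¬ Bornology.IsBounded Z) :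
    Winds (fun t => γ t - x) 0 := by
  obtain ⟨C, hC⟩ := exists_norm_le_of_periodic hc hp
  obtain ⟨y, hy, hyC⟩ : ∃ y ∈ Z, C < ‖y‖ := by
    by_contra! h
    exact hb (isBounded_iff_forall_norm_le.2 ⟨C, h⟩)
  have h0 : y ≠ 0 := by
    rintro rfl
    have := (norm_nonneg (γ 0)).trans (hC 0)
    simp at hyC; linarith
  refine Winds.of_preconnected hc hp hZ hd hy hx ?_
  refine (winds_const (neg_ne_zero.2 h0)).perturb (by fun_prop) (fun t => by rw [hp]) fun t => ?_
  simpa using (hC t).trans_lt hyC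

/-- A loop that extends to a nonvanishing function on a disk has winding number `0`. -/
theorem winds_zero_of_extends {G : ℂ → ℂ} {x : ℂ} {R : ℝ} (hR : 0 ≤ R)
    (hG : ContinuousOn G (Metric.closedBall x R)) (h0 : ∀ z ∈ Metric.closedBall x R, G z ≠ 0) :
    Winds (fun t => G (circleMap x R t)) 0 := by
  have hm : ∀ r ∈ Icc 0 R, ∀ t, circleMap x r t ∈ Metric.closedBall x R := fun r hr t => by
    simp [circleMap, abs_of_nonneg hr.1, hr.2]
  refine winds_of_homotopy (S := Icc 0 R) isPreconnected_Icc (H := fun r t => G (circleMap x r t))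
    ?_ (fun r hr t => h0 _ (hm r hr t)) (fun r hr t => by rw [periodic_circleMap x r t])
    (left_mem_Icc.2 hR) (right_mem_Icc.2 hR) ?_
  · refine hG.comp (f := fun q : ℝ × ℝ => circleMap x q.1 q.2) ?_ fun q hq => hm _ hq.1 _
    unfold circleMap; fun_prop
  · simpa using winds_const (h0 x (by simpa using hR))

end GlueSpace

end

section

namespace GlueSpace

/-! ### Separation in the plane -/

theorem subset_of_isPreconnected_of_isClosed {T X Q : Set ℂ} (hT : IsPreconnected T) (hTX : T ⊆ X)
    (hQ : IsClosed Q) (hXQ : IsClosed (X \ Q)) {x : ℂ} (hxT : x ∈ T) (hxQ : x ∈ Q) : T ⊆ Q := by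
  have h := isPreconnected_iff_subset_of_disjoint_closed.1 hT Q (X \ Q) hQ hXQ
    (fun y hy => by by_cases h : y ∈ Q <;> simp [h, hTX hy]) (by ext; simp)
  rcases h with h | h
  · exact h
  · exact absurd hxQ (h hxT).2

/-- A closed set splits off a compact part inside a bounded open set that its components do not
leave. -/
theorem exists_isCompact_isClosed_diff {X N : Set ℂ} (hX : IsClosed X) (hN : IsOpen N)
    (hb : Bornology.IsBounded N) {x : ℂ} (hxX : x ∈ X) (hxN : x ∈ N)
    (h : ∀ S, IsPreconnected S → S ⊆ X ∩ closure N → x ∈ S → S ⊆ N) :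
    ∃ Q, IsCompact Q ∧ x ∈ Q ∧ Q ⊆ X ∩ N ∧ IsClosed (X \ Q) := by
  have hZ : IsCompact (X ∩ closure N) := hb.isCompact_closure.inter_left hX
  have : CompactSpace (X ∩ closure N : Set ℂ) := isCompact_iff_compactSpace.1 hZ
  set x' : (X ∩ closure N : Set ℂ) := ⟨x, hxX, subset_closure hxN⟩
  have hcomp : connectedComponent x' ⊆ Subtype.val ⁻¹' N := by
    rw [← image_subset_iff]
    refine h _ (isPreconnected_connectedComponent.image _ continuous_subtype_val.continuousOn)
      (by rintro _ ⟨y, -, rfl⟩; exact y.2) ⟨x', mem_connectedComponent, rfl⟩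
  -- In a compact Hausdorff space a component is the intersection of the clopen sets around it, and
  -- compactness yields a single one inside `N`.
  rw [connectedComponent_eq_iInter_isClopen] at hcomp
  have hopen : IsOpen (Subtype.val ⁻¹' N : Set (X ∩ closure N : Set ℂ)) :=
    hN.preimage continuous_subtype_val
  have : Nonempty {s : Set (X ∩ closure N : Set ℂ) // IsClopen s ∧ x' ∈ s} :=
    ⟨⟨univ, isClopen_univ, mem_univ _⟩⟩
  obtain ⟨⟨s, hs, hxs⟩, hsN⟩ := exists_subset_nhds_of_compactSpace
    (V := fun s : {s : Set (X ∩ closure N : Set ℂ) // IsClopen s ∧ x' ∈ s} => s.1)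
    (by
      rintro ⟨s, hs⟩ ⟨t, ht⟩
      exact ⟨⟨s ∩ t, hs.1.inter ht.1, hs.2, ht.2⟩, inter_subset_left, inter_subset_right⟩)
    (fun s => s.2.1.isClosed) (fun y hy => hopen.mem_nhds (hcomp hy))
  have hsN' : Subtype.val '' s ⊆ N := image_subset_iff.2 hsN
  refine ⟨Subtype.val '' s, hs.isClosed.isCompact.image continuous_subtype_val, ⟨x', hxs, rfl⟩,
    fun y hy => ⟨?_, hsN' hy⟩, ?_⟩
  · obtain ⟨y, -, rfl⟩ := hy; exact y.2.1
  · have : X \ Subtype.val '' s = Subtype.val '' sᶜ ∪ (X \ N) := by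
      ext y
      constructor
      · rintro ⟨hyX, hy⟩
        by_cases hyN : y ∈ N
        · left
          exact ⟨⟨y, hyX, subset_closure hyN⟩, fun h => hy ⟨_, h, rfl⟩, rfl⟩
        · exact Or.inr ⟨hyX, hyN⟩
      · rintro (⟨y, hy, rfl⟩ | ⟨hyX, hyN⟩)
        · refine ⟨y.2.1, ?_⟩
          rintro ⟨z, hz, hzy⟩
          rw [Subtype.ext hzy] at hz
          exact hy hz
        · exact ⟨hyX, fun h => hyN (hsN' h)⟩
    rw [this]
    exact (hs.compl.isClosed.isCompact.image continuous_subtype_val).isClosed.union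
      (hX.sdiff hN)

/-- If the component of `x` in the complement of the open set `O` is bounded, then `z - x` has no
continuous logarithm on `O`. -/
theorem not_isBounded_of_continuous_log {O : Set ℂ} (hO : IsOpen O) {x : ℂ} (hx : x ∉ O) {F : ℂ → ℂ}
    (hF : ContinuousOn F O) (hFe : ∀ z ∈ O, Complex.exp (F z) = z - x) :
    ¬ Bornology.IsBounded (connectedComponentIn Oᶜ x) := by
  classical
  intro hb
  obtain ⟨R, hR⟩ := hb.subset_ball x
  have hx0 : x ∈ connectedComponentIn Oᶜ x := mem_connectedComponentIn hx
  obtain ⟨Q, hQ, hxQ, hQN, hQc⟩ := exists_isCompact_isClosed_diff hO.isClosed_compl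
    (Metric.isOpen_ball (x := x) (ε := R)) Metric.isBounded_ball hx (hR hx0)
    (fun S hS hSX hxS => (hS.subset_connectedComponentIn hxS
      (hSX.trans inter_subset_left)).trans hR)
  -- The compact piece `Q` is isolated in the complement of `O`, so the boundary of Ω can be placed
  -- inside `O`, where the logarithm is available.
  obtain ⟨Ω, hΩ, hQΩ, hΩc, hΩk⟩ := exists_open_between_and_isCompact_closure hQ hQc.isOpen_compl
    (fun y hy h => h.2 hy)
  have hfr : frontier Ω ⊆ O := by
    intro y hy
    rw [hΩ.frontier_eq] at hy
    by_contra hyO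
    exact hΩc hy.1 ⟨hyO, fun h => hy.2 (hQΩ h)⟩
  -- Tietze extends the logarithm from the boundary of Ω. Gluing exp g inside to z - x outside gives
  -- a nowhere zero function on the plane which equals z - x near infinity; a large circle would
  -- then have winding number both 0 and 1.
  obtain ⟨g, hg⟩ := ContinuousMap.exists_restrict_eq (isClosed_frontier (s := Ω))
    ⟨(frontier Ω).domRestrict F, continuousOn_iff_continuous_domRestrict.1 (hF.mono hfr)⟩
  have hg' : ∀ z ∈ frontier Ω, g z = F z := fun z hz => by
    exact congrArg (fun f => f ⟨z, hz⟩) hg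
  set H : ℂ → ℂ := Ω.piecewise (fun z => Complex.exp (g z)) (fun z => z - x)
  have hH : Continuous H := by
    refine continuous_piecewise (fun z hz => ?_) ?_ ?_
    · simp only [hg' z hz, hFe z (hfr hz)]
    · fun_prop
    · fun_prop
  have hH0 : ∀ z, H z ≠ 0 := by
    intro z
    by_cases hz : z ∈ Ω
    · simp [H, hz]
    · simp only [H, piecewise_eq_of_notMem _ _ _ hz]
      rw [sub_ne_zero]
      rintro rfl
      exact hz (hQΩ hxQ)
  obtain ⟨r, hr⟩ := (hΩk.isBounded.subset subset_closure).subset_ball x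
  set r' := max r 1
  have hr1 : 1 ≤ r' := le_max_right _ _
  have h1 := winds_zero_of_extends (x := x) (R := r') (by linarith) hH.continuousOn
    (fun z _ => hH0 z)
  have h2 : Winds (fun t => H (circleMap x r' t)) 1 := by
    convert winds_exp (Real.log r') using 2 with t
    have : circleMap x r' t ∉ Ω := by
      intro h
      have := hr h
      simp [circleMap, abs_of_pos (show 0 < r' by linarith)] at this
      exact absurd this (not_lt.2 (le_max_left _ _))
    simp only [H, piecewise_eq_of_notMem _ _ _ this]
    rw [Complex.exp_add, ← Complex.ofReal_exp, Real.exp_log (by linarith)]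
    simp [circleMap]
  exact absurd (h1.unique h2) (by norm_num)

/-- No component of the complement is bounded. -/
def IsFull (V : Set ℂ) : Prop := ∀ x ∉ V, ¬ Bornology.IsBounded (connectedComponentIn Vᶜ x)

/-- If x is missing from a simply connected open set, z - x has a continuous logarithm there, which
`not_isBounded_of_continuous_log` forbids when x lies in a bounded component. -/
theorem IsDisk.isFull {V : Set ℂ} (hV : IsDisk V) : IsFull V := by
  intro x hx
  obtain ⟨F, hF, hFe⟩ := Complex.exists_continuousOn_eqOn_exp_comp hV.2 hV.1
    (g := fun z => z - x) (by fun_prop) (by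
      rintro ⟨z, hz, h⟩
      rw [sub_eq_zero] at h
      exact hx (h ▸ hz))
  exact not_isBounded_of_continuous_log hV.1 hx hF fun z hz => hFe hz

theorem subset_of_mem_surrounded {V A : Set ℂ} (hV : IsFull V) (hAV : A ⊆ V) {x : ℂ}
    (hx : x ∈ surrounded A) : connectedComponentIn Aᶜ x ⊆ V := by
  intro y hy
  by_contra hyV
  refine hV y hyV (hx.2.subset ?_)
  rw [connectedComponentIn_eq hy]
  exact connectedComponentIn_mono _ (compl_subset_compl.2 hAV)

theorem surrounded_subset {V A : Set ℂ} (hV : IsFull V) (hAV : A ⊆ V) : surrounded A ⊆ V :=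
  fun _ hx => subset_of_mem_surrounded hV hAV hx (mem_connectedComponentIn hx.1)

theorem isClosed_connectedComponentIn' {X : Set ℂ} (hX : IsClosed X) {x : ℂ} (hx : x ∈ X) :
    IsClosed (connectedComponentIn X x) := by
  refine isClosed_of_closure_subset ?_
  exact isPreconnected_connectedComponentIn.closure.subset_connectedComponentIn
    (subset_closure (mem_connectedComponentIn hx))
    (closure_minimal (connectedComponentIn_subset _ _) hX)

/-- The right-hand condition refers only to the topology of V and A, not to the ambient plane; this
is what lets homeomorphisms of V transport `surrounded`. -/
theorem mem_surrounded_iff_isCompact {V A : Set ℂ} (hV : IsOpen V) (hf : IsFull V) (hA : IsOpen A)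
    (hAV : A ⊆ V) {x : ℂ} (hx : x ∈ V \ A) :
    x ∈ surrounded A ↔ IsCompact (connectedComponentIn (V \ A) x) := by
  constructor
  · intro h
    have hsub := subset_of_mem_surrounded hf hAV h
    have heq : connectedComponentIn (V \ A) x = connectedComponentIn Aᶜ x := by
      refine (connectedComponentIn_mono _ fun y hy => hy.2).antisymm ?_
      exact isPreconnected_connectedComponentIn.subset_connectedComponentIn
        (mem_connectedComponentIn hx.2)
        fun y hy => ⟨hsub hy, connectedComponentIn_subset _ _ hy⟩
    rw [heq]
    exact Metric.isCompact_of_isClosed_isBounded (isClosed_connectedComponentIn' hA.isClosed_compl hx.2) h.2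
  · intro hC
    refine ⟨hx.2, ?_⟩
    have hxC : x ∈ connectedComponentIn (V \ A) x := mem_connectedComponentIn hx
    -- A compact piece of the whole complement of A splits off inside a neighbourhood of the compact
    -- component, and it traps the component in the plane.
    obtain ⟨N, hN, hCN, hNV, hNc⟩ := exists_open_between_and_isCompact_closure hC hV
      ((connectedComponentIn_subset _ _).trans sdiff_subset)
    obtain ⟨Q, hQ, hxQ, hQN, hQc⟩ := exists_isCompact_isClosed_diff hA.isClosed_compl hN
      (hNc.isBounded.subset subset_closure) hx.2 (hCN hxC) (fun S hS hSX hxS => by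
        have hSV : S ⊆ V \ A := fun y hy => ⟨hNV (hSX hy).2, (hSX hy).1⟩
        exact (hS.subset_connectedComponentIn hxS hSV).trans hCN)
    exact hQ.isBounded.subset (subset_of_isPreconnected_of_isClosed
      isPreconnected_connectedComponentIn (connectedComponentIn_subset _ _) hQ.isClosed hQc
      (mem_connectedComponentIn hx.2) hxQ)

/-! ### Open embeddings -/

/-- `h` restricts to an open embedding of the open set `V`. -/
structure OpenEmb (h : ℂ → ℂ) (V : Set ℂ) : Prop where
  continuousOn : ContinuousOn h V
  injOn : InjOn h V
  isOpen_image : ∀ O ⊆ V, IsOpen O → IsOpen (h '' O)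

theorem OpenEmb.mono {h : ℂ → ℂ} {V O : Set ℂ} (H : OpenEmb h V) (hO : O ⊆ V) : OpenEmb h O :=
  ⟨H.continuousOn.mono hO, H.injOn.mono hO, fun O' h' => H.isOpen_image O' (h'.trans hO)⟩

theorem OpenEmb.continuousOn_inv {h : ℂ → ℂ} {V : Set ℂ} (hV : IsOpen V) (H : OpenEmb h V) :
    ContinuousOn (Function.invFunOn h V) (h '' V) := by
  rintro _ ⟨z, hz, rfl⟩
  have hl := H.injOn.leftInvOn_invFunOn
  apply ContinuousAt.continuousWithinAt
  intro N hN
  rw [hl hz] at hN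
  obtain ⟨O, hON, hO, hzO⟩ := mem_nhds_iff.1 (Filter.inter_mem hN (hV.mem_nhds hz))
  rw [Filter.mem_map]
  refine Filter.mem_of_superset
    ((H.isOpen_image O (hON.trans inter_subset_right) hO).mem_nhds ⟨z, hzO, rfl⟩) ?_
  rintro _ ⟨y, hy, rfl⟩
  rw [mem_preimage, hl (hON hy).2]
  exact (hON hy).1

theorem OpenEmb.isSimplyConnected_image {h : ℂ → ℂ} {V : Set ℂ} (hV : IsOpen V) (H : OpenEmb h V) :
    IsSimplyConnected (h '' V) ↔ IsSimplyConnected V := by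
  have he : Topology.IsOpenEmbedding (V.domRestrict h) := by
    refine .of_continuous_injective_isOpenMap
      (continuousOn_iff_continuous_domRestrict.1 H.continuousOn) H.injOn.injective fun O hO => ?_
    have : V.domRestrict h '' O = h '' (Subtype.val '' O) := by
      rw [image_image]; rfl
    rw [this]
    refine H.isOpen_image _ ?_ (hV.isOpenMap_subtype_val O hO)
    rintro _ ⟨y, -, rfl⟩; exact y.2
  have h1 := he.isEmbedding.isSimplyConnected_image (s := univ)
  rw [image_univ, range_domRestrict] at h1
  rw [h1]
  exact (Homeomorph.Set.univ V).toHomotopyEquiv.simplyConnectedSpace_iff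

theorem OpenEmb.isDisk_image {h : ℂ → ℂ} {V : Set ℂ} (hV : IsDisk V) (H : OpenEmb h V) :
    IsDisk (h '' V) :=
  ⟨H.isOpen_image V Subset.rfl hV.1, (H.isSimplyConnected_image hV.1).2 hV.2⟩

/-- By the intrinsic criterion both sides speak of compactness of a component of V \ A or of its
image, and h and its continuous inverse exchange these components. -/
theorem OpenEmb.mem_surrounded_iff {h : ℂ → ℂ} {V A : Set ℂ} (hV : IsDisk V) (H : OpenEmb h V)
    (hA : IsOpen A) (hAV : A ⊆ V) {x : ℂ} (hx : x ∈ V) :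
    h x ∈ surrounded (h '' A) ↔ x ∈ surrounded A := by
  by_cases hxA : x ∈ A
  · exact iff_of_false (fun h' => h'.1 ⟨x, hxA, rfl⟩) fun h' => h'.1 hxA
  have hV' := H.isDisk_image hV
  have hl := H.injOn.leftInvOn_invFunOn
  set k := Function.invFunOn h V
  have hk : ContinuousOn k (h '' V) := H.continuousOn_inv hV.1
  have himg : h '' (V \ A) = h '' V \ h '' A := H.injOn.image_sdiff_subset hAV
  have hxm : h x ∈ h '' V \ h '' A := himg ▸ ⟨x, ⟨hx, hxA⟩, rfl⟩
  rw [mem_surrounded_iff_isCompact hV.1 hV.isFull hA hAV ⟨hx, hxA⟩,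
    mem_surrounded_iff_isCompact hV'.1 hV'.isFull (H.isOpen_image A hAV hA) (image_mono hAV) hxm]
  set C := connectedComponentIn (V \ A) x
  set C' := connectedComponentIn (h '' V \ h '' A) (h x)
  have hCV : C ⊆ V := (connectedComponentIn_subset _ _).trans sdiff_subset
  have hCV' : C' ⊆ h '' V := (connectedComponentIn_subset _ _).trans sdiff_subset
  have h1 : h '' C ⊆ C' := by
    refine (isPreconnected_connectedComponentIn.image _
      (H.continuousOn.mono hCV)).subset_connectedComponentIn
      ⟨x, mem_connectedComponentIn ⟨hx, hxA⟩, rfl⟩ ?_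
    rw [← himg]
    exact image_mono (connectedComponentIn_subset _ _)
  have h2 : k '' C' ⊆ C := by
    refine (isPreconnected_connectedComponentIn.image _ (hk.mono hCV')).subset_connectedComponentIn
      ⟨h x, mem_connectedComponentIn hxm, hl hx⟩ ?_
    rintro _ ⟨y, hy, rfl⟩
    have := connectedComponentIn_subset _ _ hy
    rw [← himg] at this
    obtain ⟨z, hz, rfl⟩ := this
    rw [hl hz.1]; exact hz
  have h3 : h '' C = C' := by
    refine h1.antisymm fun y hy => ?_
    obtain ⟨z, hz, rfl⟩ := hCV' hy
    exact ⟨z, by simpa [hl hz] using h2 ⟨h z, hy, rfl⟩, rfl⟩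
  have h4 : k '' C' = C := by
    refine h2.antisymm fun y hy => ⟨h y, h1 ⟨y, hy, rfl⟩, hl (hCV hy)⟩
  constructor
  · intro hc; rw [← h4]; exact hc.image_of_continuousOn (hk.mono hCV')
  · intro hc; rw [← h3]; exact hc.image_of_continuousOn (H.continuousOn.mono hCV)

/-- A continuous injective map that winds circles is open. -/
theorem OrientationPreservingOn.exists_winds {D : Set ℂ} {h : ℂ → ℂ} (ho : OrientationPreservingOn D h)
    (hc : ContinuousOn h D) (hi : InjOn h D) {z : ℂ} {r : ℝ} (hr : 0 < r)
    (hD : Metric.closedBall z r ⊆ D) : ∃ n ≠ 0, Winds (fun t => h (circleMap z r t) - h z) n := by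
  obtain ⟨θ, hθ, hθ1, he⟩ := ho z r hr hD
  have hm : ∀ t, circleMap z r t ∈ D := fun t => hD (by simp [circleMap, abs_of_pos hr])
  have h0 : ∀ t, h (circleMap z r t) - h z ≠ 0 := by
    intro t
    rw [sub_ne_zero]
    intro heq
    have := hi (hm t) (hD (by simp [hr.le])) heq
    simp [hr.ne'] at this
  have hcc : Continuous (fun t => h (circleMap z r t)) :=
    hc.comp_continuous (continuous_circleMap z r) hm
  obtain ⟨n, hn⟩ := Winds.exists (γ := fun t => h (circleMap z r t) - h z)
    (hcc.sub continuous_const) h0 (fun t => by rw [periodic_circleMap z r t])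
  refine ⟨n, ?_, hn⟩
  -- With winding number 0 the logarithm `L` returns to its value after one turn. But L - log|·|
  -- differs from iθ by a constant, and θ gains 2π.
  rintro rfl
  obtain ⟨L, hL, hLe, hLp⟩ := hn
  obtain ⟨m, hm'⟩ := exists_int_const_of_exp_eq_one (isPreconnected_univ (α := ℝ))
    (f := fun s : ℝ => L (2 * Real.pi * s) - Real.log ‖h (circleMap z r (2 * Real.pi * s)) - h z‖
      - θ s * Complex.I) (by
        apply Continuous.continuousOn
        have : Continuous fun s : ℝ => Real.log ‖h (circleMap z r (2 * Real.pi * s)) - h z‖ :=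
          ((hcc.comp (continuous_const.mul continuous_id)).sub continuous_const).norm.log
            fun s => norm_ne_zero_iff.2 (h0 _)
        fun_prop) (by
        intro s _
        have hne : (‖h (circleMap z r (2 * Real.pi * s)) - h z‖ : ℂ) ≠ 0 := by
          exact_mod_cast norm_ne_zero_iff.2 (h0 _)
        rw [Complex.exp_sub, Complex.exp_sub, hLe, ← Complex.ofReal_exp,
          Real.exp_log (norm_pos_iff.2 (h0 _))]
        rw [he s]
        rw [norm_mul, Complex.norm_exp_ofReal_mul_I]
        have := Complex.exp_ne_zero (θ s * Complex.I)
        simp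
        field_simp
        exact he s)
  have e0 := hm' 0 (mem_univ _)
  have e1 := hm' 1 (mem_univ _)
  have hLp0 := hLp 0
  have hcm : circleMap z r (2 * Real.pi) = circleMap z r 0 := by
    simpa using periodic_circleMap z r 0
  simp only [mul_zero, mul_one, zero_add, Int.cast_zero, zero_mul, add_zero] at e0 e1 hLp0
  rw [hLp0, hcm] at e1
  have : ((θ 1 - θ 0 : ℝ) : ℂ) * Complex.I = 0 := by push_cast; linear_combination e0 - e1
  rw [hθ1] at this
  have := mul_eq_zero.1 this
  simp [Real.pi_ne_zero] at this

/-- Invariance of domain by degree: the image of a small circle winds a nonzero number of times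
around every point near h z. If such a point were not a value on the disk, the loop around it would
extend to a nonvanishing function and have winding number 0. -/
theorem OrientationPreservingOn.openEmb {D : Set ℂ} {h : ℂ → ℂ} (ho : OrientationPreservingOn D h)
    (hc : ContinuousOn h D) (hi : InjOn h D) : OpenEmb h D := by
  refine ⟨hc, hi, fun O hOD hO => isOpen_iff_mem_nhds.2 ?_⟩
  rintro _ ⟨z, hz, rfl⟩
  obtain ⟨r, hr, hrO⟩ := Metric.nhds_basis_closedBall.mem_iff.1 (hO.mem_nhds hz)
  obtain ⟨n, hn, hw⟩ := ho.exists_winds hc hi hr (hrO.trans hOD)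
  obtain ⟨ε, hε, hεl⟩ := exists_norm_ge_of_periodic hw.continuous hw.ne_zero hw.periodic
  refine Filter.mem_of_superset (Metric.ball_mem_nhds _ hε) fun w hw' => ?_
  by_contra hwO
  have h1 : Winds (fun t => h (circleMap z r t) - w) n := by
    refine hw.perturb ?_ (fun t => by rw [periodic_circleMap z r t]) fun t =>
      lt_of_lt_of_le ?_ (hεl t)
    · refine (hw.continuous.add (continuous_const (y := h z - w))).congr fun t => ?_
      simp only [Pi.add_apply]; ring
    · rw [Metric.mem_ball, dist_eq_norm] at hw'
      rwa [sub_sub_sub_cancel_left, ← norm_neg, neg_sub]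
  have h2 := winds_zero_of_extends (G := fun y => h y - w) hr.le
    ((hc.mono (hrO.trans hOD)).sub continuousOn_const)
    (fun y hy h0 => hwO ⟨y, hrO hy, sub_eq_zero.1 h0⟩)
  exact hn (h1.unique h2)

theorem IsQC.openEmb {K : ℝ} {D : Set ℂ} {h : ℂ → ℂ} (hh : IsQC K D h) : OpenEmb h D :=
  hh.orientation.openEmb hh.continuousOn hh.injOn

end GlueSpace

end

section

namespace GlueSpace

/-! ### Injective holomorphic maps -/

/-- If the derivative vanished, f - f z would be a constant times h ^ n for a local coordinate h and
some n ≥ 2. The points where h is ε/2 and ωε/2, with ω a primitive n-th root of unity, would then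
have the same image. -/
theorem deriv_ne_zero_of_injOn {f : ℂ → ℂ} {U : Set ℂ} (hU : IsOpen U) (hf : DifferentiableOn ℂ f U)
    (hi : InjOn f U) {z : ℂ} (hz : z ∈ U) : deriv f z ≠ 0 := by
  intro hd
  have hfa : AnalyticAt ℂ f z := hf.analyticAt (hU.mem_nhds hz)
  have hg : AnalyticAt ℂ (fun w => f w - f z) z := hfa.sub analyticAt_const
  have hnz : ¬ ∀ᶠ w in 𝓝 z, f w - f z = 0 := by
    intro h
    have h1 : ∀ᶠ w in 𝓝[≠] z, False := by
      filter_upwards [h.filter_mono nhdsWithin_le_nhds, self_mem_nhdsWithin,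
        nhdsWithin_le_nhds (hU.mem_nhds hz)] with w hw hwz hwU
      exact hwz (hi hwU hz (sub_eq_zero.1 hw))
    exact h1.exists.elim fun _ h => h
  obtain ⟨n, u, hu, hu0, he⟩ := hg.exists_eventuallyEq_pow_smul_nonzero_iff.2 hnz
  have hn0 : n ≠ 0 := by
    rintro rfl
    have := he.self_of_nhds
    simp at this
    exact hu0 this.symm
  have hn1 : n ≠ 1 := by
    rintro rfl
    have h1 : HasDerivAt (fun w => f w - f z) (u z) z := by
      have h2 : HasDerivAt (fun w => (w - z) ^ 1 • u w) (u z) z := by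
        have := ((hasDerivAt_id z).sub_const z).mul hu.differentiableAt.hasDerivAt
        refine (this.congr_deriv (by simp)).congr_of_eventuallyEq (.of_forall fun w => ?_)
        simp
      exact h2.congr_of_eventuallyEq he
    have h3 := (hfa.differentiableAt.hasDerivAt.sub_const (f z)).unique h1
    exact hu0 (h3 ▸ hd)
  set h : ℂ → ℂ := fun w => (w - z) * Complex.exp (Complex.log (u w / u z) / n)
  have hslit : u z / u z ∈ Complex.slitPlane := by rw [div_self hu0]; exact Complex.one_mem_slitPlane
  have hha : AnalyticAt ℂ h z := by
    refine (analyticAt_id.sub analyticAt_const).mul (AnalyticAt.cexp ?_)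
    exact ((hu.div analyticAt_const hu0).clog hslit).div_const
  have hhd : HasDerivAt h 1 z := by
    have h1 : AnalyticAt ℂ (fun w => Complex.exp (Complex.log (u w / u z) / n)) z :=
      (((hu.div analyticAt_const hu0).clog hslit).div_const).cexp
    have := ((hasDerivAt_id z).sub_const z).mul h1.differentiableAt.hasDerivAt
    exact this.congr_deriv (by simp [div_self hu0])
  have hopen : 𝓝 (h z) ≤ map h (𝓝 z) := by
    refine hha.eventually_constant_or_nhds_le_map_nhds.resolve_left fun hc => ?_
    have : HasDerivAt h 0 z := (hasDerivAt_const z (h z)).congr_of_eventuallyEq hc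
    exact one_ne_zero (hhd.unique this)
  have hzn : ∀ᶠ w in 𝓝 z, w ∈ U ∧ u w ≠ 0 ∧ f w - f z = (w - z) ^ n • u w := by
    filter_upwards [he, hU.mem_nhds hz, hu.continuousAt.eventually_ne hu0] with w h1 h2 h3
      using ⟨h2, h3, h1⟩
  have hpow : ∀ w, u w ≠ 0 → f w - f z = (w - z) ^ n • u w → f w - f z = h w ^ n * u z := by
    intro w hw he
    rw [he]
    simp only [h, mul_pow, ← Complex.exp_nat_mul]
    rw [mul_div_cancel₀ _ (by exact_mod_cast hn0), Complex.exp_log (div_ne_zero hw hu0)]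
    simp only [smul_eq_mul]; field_simp
  have himg := hopen (image_mem_map hzn)
  have hz0 : h z = 0 := by simp [h]
  rw [hz0] at himg
  obtain ⟨ε, hε, hb⟩ := Metric.mem_nhds_iff.1 himg
  set ω : ℂ := Complex.exp (2 * Real.pi * Complex.I / n)
  have hω : IsPrimitiveRoot ω n := Complex.isPrimitiveRoot_exp n hn0
  have hωn : ‖ω‖ = 1 := hω.norm'_eq_one hn0
  obtain ⟨w₁, ⟨h1U, h1u, h1e⟩, h1⟩ := hb (show ((ε / 2 : ℝ) : ℂ) ∈ Metric.ball 0 ε by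
    simp [abs_of_pos hε]; linarith)
  obtain ⟨w₂, ⟨h2U, h2u, h2e⟩, h2⟩ := hb (show ((ε / 2 : ℝ) : ℂ) * ω ∈ Metric.ball 0 ε by
    simp [abs_of_pos hε, hωn]; linarith)
  have heq : w₁ = w₂ := by
    apply hi h1U h2U
    have e1 := hpow w₁ h1u h1e
    have e2 := hpow w₂ h2u h2e
    rw [h1] at e1
    rw [h2, mul_pow, hω.pow_eq_one, mul_one, ← e1] at e2
    linear_combination -e2
  rw [← heq, h1] at h2
  have hεc : ((ε / 2 : ℝ) : ℂ) ≠ 0 := by exact_mod_cast (by positivity : ε / 2 ≠ 0)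
  have : ω = 1 := by
    have := mul_left_cancel₀ hεc (h2.symm.trans (mul_one _).symm)
    exact this
  exact hω.ne_one (by omega) this

theorem nhds_le_map_of_injOn {f : ℂ → ℂ} {U : Set ℂ} (hU : IsOpen U) (hf : DifferentiableOn ℂ f U)
    (hi : InjOn f U) {z : ℂ} (hz : z ∈ U) : 𝓝 (f z) ≤ map f (𝓝 z) := by
  refine (hf.analyticAt (hU.mem_nhds hz)).eventually_constant_or_nhds_le_map_nhds.resolve_left
    fun hc => ?_
  have : HasDerivAt f 0 z := (hasDerivAt_const z (f z)).congr_of_eventuallyEq hc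
  exact deriv_ne_zero_of_injOn hU hf hi hz this.deriv

/-- A continuous lift of a holomorphic map through a locally injective holomorphic map is
holomorphic. -/
theorem differentiableAt_of_lift {χ T G : ℂ → ℂ} {w : ℂ} (hT : ContinuousAt T w)
    (hχ : AnalyticAt ℂ χ (T w)) (hd : deriv χ (T w) ≠ 0) (hG : DifferentiableAt ℂ G w)
    (he : ∀ᶠ z in 𝓝 w, χ (T z) = G z) : DifferentiableAt ℂ T w := by
  have hs := hχ.hasStrictDerivAt
  have h1 := hs.to_localInverse hd
  have h2 : ∀ᶠ y in 𝓝 (T w), hs.localInverse χ _ _ hd (χ y) = y :=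
    HasStrictFDerivAt.eventually_left_inverse (hs.hasStrictFDerivAt_equiv hd)
  have h3 : DifferentiableAt ℂ (fun z => hs.localInverse χ _ _ hd (G z)) w := by
    refine DifferentiableAt.fun_comp' w ?_ hG
    rw [← he.self_of_nhds]
    exact h1.hasDerivAt.differentiableAt
  refine h3.congr_of_eventuallyEq ?_
  filter_upwards [he, hT.eventually h2] with z h4 h5
  rw [← h4, h5]

/-! ### Ring domains as images of strips -/

/-- The vertical strip of width `ℓ`. -/
def strip (ℓ : ℝ) : Set ℂ := {w | 0 < w.re ∧ w.re < ℓ}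

/-- The round annulus covered by `strip ℓ`. -/
def roundAnnulus (ℓ : ℝ) : Set ℂ := {z | 1 < ‖z‖ ∧ ‖z‖ < Real.exp ℓ}

theorem isOpen_strip (ℓ : ℝ) : IsOpen (strip ℓ) :=
  (isOpen_lt continuous_const Complex.continuous_re).inter
    (isOpen_lt Complex.continuous_re continuous_const)

theorem isOpen_roundAnnulus (ℓ : ℝ) : IsOpen (roundAnnulus ℓ) :=
  (isOpen_lt continuous_const continuous_norm).inter (isOpen_lt continuous_norm continuous_const)

theorem convex_strip (ℓ : ℝ) : Convex ℝ (strip ℓ) :=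
  (convex_halfSpace_re_gt 0).inter (convex_halfSpace_re_lt ℓ)

theorem exp_mem_roundAnnulus {ℓ : ℝ} {w : ℂ} : Complex.exp w ∈ roundAnnulus ℓ ↔ w ∈ strip ℓ := by
  simp [roundAnnulus, strip, Complex.norm_exp]

theorem log_mem_strip {ℓ : ℝ} {z : ℂ} (hz : z ∈ roundAnnulus ℓ) : Complex.log z ∈ strip ℓ := by
  have h0 : z ≠ 0 := by rintro rfl; simp [roundAnnulus] at hz; linarith [hz.1]
  rwa [← exp_mem_roundAnnulus, Complex.exp_log h0]

theorem add_mem_strip {ℓ : ℝ} {w : ℂ} (hw : w ∈ strip ℓ) (k : ℤ) :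
    w + k * (2 * Real.pi * Complex.I) ∈ strip ℓ := by
  simpa [strip] using hw

theorem isSimplyConnected_strip {ℓ : ℝ} (hℓ : 0 < ℓ) : IsSimplyConnected (strip ℓ) := by
  have := (convex_strip ℓ).contractibleSpace ⟨((ℓ / 2 : ℝ) : ℂ), by simp [strip, hℓ]⟩
  exact (inferInstance : SimplyConnectedSpace (strip ℓ))

/-- `Φ` is the universal covering of the ring domain `A`, defined on a strip of width `ℓ`. -/
structure StripMap (Φ : ℂ → ℂ) (ℓ : ℝ) (A : Set ℂ) : Prop where
  pos : 0 < ℓ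
  holo : DifferentiableOn ℂ Φ (strip ℓ)
  per : ∀ w ∈ strip ℓ, Φ (w + 2 * Real.pi * Complex.I) = Φ w
  inj : ∀ w ∈ strip ℓ, ∀ w' ∈ strip ℓ, Φ w = Φ w' → ∃ k : ℤ, w = w' + k * (2 * Real.pi * Complex.I)
  img : Φ '' strip ℓ = A

theorem IsRing.exists_stripMap {A : Set ℂ} {m : ℝ} (h : IsRing A m) :
    ∃ Φ, StripMap Φ (2 * Real.pi * m) A := by
  obtain ⟨hm, φ, hd, hi, himg⟩ := h
  change DifferentiableOn ℂ φ (roundAnnulus _) at hd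
  change InjOn φ (roundAnnulus _) at hi
  change φ '' (roundAnnulus _) = A at himg
  refine ⟨fun w => φ (Complex.exp w), by positivity, ?_, ?_, ?_, ?_⟩
  · exact hd.comp Complex.differentiable_exp.differentiableOn fun w hw => exp_mem_roundAnnulus.2 hw
  · intro w _
    simp only [Complex.exp_add, Complex.exp_two_pi_mul_I, mul_one]
  · intro w hw w' hw' he
    exact Complex.exp_eq_exp_iff_exists_int.1
      (hi (exp_mem_roundAnnulus.2 hw) (exp_mem_roundAnnulus.2 hw') he)
  · rw [← himg]
    ext z
    constructor
    · rintro ⟨w, hw, rfl⟩; exact ⟨_, exp_mem_roundAnnulus.2 hw, rfl⟩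
    · rintro ⟨z, hz, rfl⟩
      have h0 : z ≠ 0 := by rintro rfl; simp [roundAnnulus] at hz; linarith [hz.1]
      exact ⟨Complex.log z, log_mem_strip hz, by simp only [Complex.exp_log h0]⟩

namespace StripMap

variable {Φ : ℂ → ℂ} {ℓ : ℝ} {A : Set ℂ}

theorem apply_add_int (H : StripMap Φ ℓ A) {w : ℂ} (hw : w ∈ strip ℓ) (k : ℤ) :
    Φ (w + k * (2 * Real.pi * Complex.I)) = Φ w := by
  induction k with
  | zero => simp
  | succ k ih =>
    rw [← ih, ← H.per _ (add_mem_strip hw k)]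
    congr 1; push_cast; ring
  | pred k ih =>
    rw [← ih, ← H.per _ (add_mem_strip hw _)]
    congr 1; push_cast; ring

theorem apply_eq (H : StripMap Φ ℓ A) {w w' : ℂ} (hw : w ∈ strip ℓ)
    (h : Complex.exp w' = Complex.exp w) : Φ w' = Φ w := by
  obtain ⟨k, rfl⟩ := Complex.exp_eq_exp_iff_exists_int.1 h
  exact H.apply_add_int hw k

/-- Φ ∘ log does not depend on the branch, because Φ is periodic. Near the cut of the principal
logarithm, log(-y) + πi serves instead. -/
theorem exists_annulus (H : StripMap Φ ℓ A) : ∃ φ : ℂ → ℂ, DifferentiableOn ℂ φ (roundAnnulus ℓ) ∧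
    InjOn φ (roundAnnulus ℓ) ∧ φ '' roundAnnulus ℓ = A ∧ ∀ w ∈ strip ℓ, φ (Complex.exp w) = Φ w := by
  have hne : ∀ z ∈ roundAnnulus ℓ, z ≠ 0 := by
    rintro z hz rfl; simp [roundAnnulus] at hz; linarith [hz.1]
  have hexp : ∀ w ∈ strip ℓ, Φ (Complex.log (Complex.exp w)) = Φ w := fun w hw =>
    H.apply_eq hw (Complex.exp_log (Complex.exp_ne_zero w))
  have hdiff : ∀ w ∈ strip ℓ, DifferentiableAt ℂ Φ w := fun w hw =>
    H.holo.differentiableAt ((isOpen_strip ℓ).mem_nhds hw)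
  refine ⟨fun z => Φ (Complex.log z), ?_, ?_, ?_, hexp⟩
  · intro z hz
    apply DifferentiableAt.differentiableWithinAt
    by_cases hs : z ∈ Complex.slitPlane
    · exact DifferentiableAt.fun_comp' z (hdiff _ (log_mem_strip hz)) (Complex.differentiableAt_log hs)
    · have hs' : -z ∈ Complex.slitPlane := by
        rcases Complex.mem_slitPlane_or_neg_mem_slitPlane (hne z hz) with h | h
        · exact absurd h hs
        · exact h
      have he : ∀ y ≠ 0, Complex.exp (Complex.log (-y) + Real.pi * Complex.I) = y := by
        intro y hy
        rw [Complex.exp_add, Complex.exp_log (neg_ne_zero.2 hy), Complex.exp_pi_mul_I]; ring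
      have hm : Complex.log (-z) + Real.pi * Complex.I ∈ strip ℓ := by
        rw [← exp_mem_roundAnnulus, he z (hne z hz)]; exact hz
      have h1 : DifferentiableAt ℂ (fun y => Φ (Complex.log (-y) + Real.pi * Complex.I)) z := by
        refine DifferentiableAt.fun_comp' z (hdiff _ hm) (DifferentiableAt.add_const _ ?_)
        exact DifferentiableAt.clog differentiableAt_id.neg hs'
      refine h1.congr_of_eventuallyEq ?_
      filter_upwards [(isOpen_roundAnnulus ℓ).mem_nhds hz] with y hy
      refine (H.apply_eq (log_mem_strip hy) ?_).symm
      rw [he y (hne y hy), Complex.exp_log (hne y hy)]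
  · intro z hz z' hz' he
    have := H.inj _ (log_mem_strip hz) _ (log_mem_strip hz') he
    rw [← Complex.exp_log (hne z hz), ← Complex.exp_log (hne z' hz')]
    exact Complex.exp_eq_exp_iff_exists_int.2 this
  · rw [← H.img]
    ext y
    constructor
    · rintro ⟨z, hz, rfl⟩; exact ⟨_, log_mem_strip hz, rfl⟩
    · rintro ⟨w, hw, rfl⟩; exact ⟨_, exp_mem_roundAnnulus.2 hw, hexp w hw⟩

theorem isRing (H : StripMap Φ ℓ A) : IsRing A (ℓ / (2 * Real.pi)) := by
  obtain ⟨φ, h1, h2, h3, -⟩ := H.exists_annulus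
  have hpos := H.pos
  refine ⟨by have := Real.pi_pos; positivity, φ, ?_⟩
  rw [mul_div_cancel₀ _ (by positivity)]
  exact ⟨h1, h2, h3⟩

/-- A piece of the strip on which `Φ` is injective. -/
theorem injOn_box (H : StripMap Φ ℓ A) (a : ℝ) :
    InjOn Φ (strip ℓ ∩ {w | a ≤ w.im ∧ w.im < a + 2 * Real.pi}) := by
  rintro w ⟨hw, h1, h2⟩ w' ⟨hw', h1', h2'⟩ he
  obtain ⟨k, rfl⟩ := H.inj _ hw _ hw' he
  have hpi := Real.pi_pos
  have him : (w' + k * (2 * Real.pi * Complex.I)).im = w'.im + k * (2 * Real.pi) := by simp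
  rw [him] at h1 h2
  have hk : k = 0 := by
    have h3 : (k : ℝ) * (2 * Real.pi) < 1 * (2 * Real.pi) := by linarith
    have h4 : (-1 : ℝ) * (2 * Real.pi) < k * (2 * Real.pi) := by linarith
    have h5 := lt_of_mul_lt_mul_right h3 (by positivity)
    have h6 := lt_of_mul_lt_mul_right h4 (by positivity)
    have h7 : k < 1 := by exact_mod_cast h5
    have h8 : -1 < k := by exact_mod_cast h6
    omega
  simp [hk]

theorem exists_isOpen_injOn (H : StripMap Φ ℓ A) {w : ℂ} (hw : w ∈ strip ℓ) :
    ∃ O, IsOpen O ∧ w ∈ O ∧ O ⊆ strip ℓ ∧ InjOn Φ O := by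
  have := Real.pi_pos
  have hsub : {v : ℂ | w.im - Real.pi < v.im ∧ v.im < w.im - Real.pi + 2 * Real.pi} ⊆
      {v | w.im - Real.pi ≤ v.im ∧ v.im < w.im - Real.pi + 2 * Real.pi} := fun v hv => by
    exact ⟨hv.1.le, hv.2⟩
  refine ⟨strip ℓ ∩ {v | w.im - Real.pi < v.im ∧ v.im < w.im - Real.pi + 2 * Real.pi}, ?_,
    ⟨hw, ?_⟩, inter_subset_left, (H.injOn_box (w.im - Real.pi)).mono
      (inter_subset_inter_right _ hsub)⟩
  · exact (isOpen_strip ℓ).inter ((isOpen_lt continuous_const Complex.continuous_im).inter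
      (isOpen_lt Complex.continuous_im continuous_const))
  · constructor <;> linarith

theorem nhds_le_map (H : StripMap Φ ℓ A) {w : ℂ} (hw : w ∈ strip ℓ) : 𝓝 (Φ w) ≤ map Φ (𝓝 w) := by
  obtain ⟨O, hO, hwO, hOs, hi⟩ := H.exists_isOpen_injOn hw
  exact nhds_le_map_of_injOn hO (H.holo.mono hOs) hi hwO

theorem analyticAt (H : StripMap Φ ℓ A) {w : ℂ} (hw : w ∈ strip ℓ) : AnalyticAt ℂ Φ w :=
  H.holo.analyticAt ((isOpen_strip ℓ).mem_nhds hw)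

theorem isOpen_image (H : StripMap Φ ℓ A) {O : Set ℂ} (hO : IsOpen O) (hOs : O ⊆ strip ℓ) :
    IsOpen (Φ '' O) := by
  rw [isOpen_iff_mem_nhds]
  rintro _ ⟨w, hw, rfl⟩
  exact H.nhds_le_map (hOs hw) (image_mem_map (hO.mem_nhds hw))

theorem isOpen (H : StripMap Φ ℓ A) : IsOpen A :=
  H.img ▸ H.isOpen_image (isOpen_strip ℓ) Subset.rfl

theorem mem (H : StripMap Φ ℓ A) {w : ℂ} (hw : w ∈ strip ℓ) : Φ w ∈ A := H.img ▸ ⟨w, hw, rfl⟩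

theorem restrict (H : StripMap Φ ℓ A) {a b : ℝ} (ha : 0 ≤ a) (hab : a < b) (hb : b ≤ ℓ) :
    StripMap (fun w => Φ (a + w)) (b - a) (Φ '' {w | a < w.re ∧ w.re < b}) := by
  have hm : ∀ w ∈ strip (b - a), (a : ℂ) + w ∈ strip ℓ := by
    rintro w ⟨h1, h2⟩
    simp only [strip, mem_ofPred_eq, Complex.add_re, Complex.ofReal_re]
    constructor <;> linarith
  refine ⟨by linarith, ?_, ?_, ?_, ?_⟩
  · exact H.holo.comp (by fun_prop) hm
  · intro w hw
    rw [← add_assoc]; exact H.per _ (hm w hw)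
  · intro w hw w' hw' he
    obtain ⟨k, hk⟩ := H.inj _ (hm w hw) _ (hm w' hw') he
    exact ⟨k, by linear_combination hk⟩
  · ext y
    constructor
    · rintro ⟨w, ⟨h1, h2⟩, rfl⟩
      exact ⟨a + w, by simp; constructor <;> linarith, rfl⟩
    · rintro ⟨w, ⟨h1, h2⟩, rfl⟩
      exact ⟨w - a, by simp [strip]; constructor <;> linarith, by simp⟩

theorem mk_mem_strip {s : ℝ} (hs : s ∈ Ioo 0 ℓ) (t : ℝ) : (s + t * Complex.I : ℂ) ∈ strip ℓ := by
  simpa [strip] using hs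

theorem continuous_loop (H : StripMap Φ ℓ A) {s : ℝ} (hs : s ∈ Ioo 0 ℓ) :
    Continuous fun t : ℝ => Φ (s + t * Complex.I) :=
  H.holo.continuousOn.comp_continuous (by fun_prop) (mk_mem_strip hs)

theorem loop_periodic (H : StripMap Φ ℓ A) {s : ℝ} (hs : s ∈ Ioo 0 ℓ) (t : ℝ) :
    Φ (s + (t + 2 * Real.pi : ℝ) * Complex.I) = Φ (s + t * Complex.I) := by
  rw [← H.per _ (mk_mem_strip hs t)]; congr 1; push_cast; ring

theorem loop_mem (H : StripMap Φ ℓ A) {s : ℝ} (hs : s ∈ Ioo 0 ℓ) (t : ℝ) :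
    Φ (s + t * Complex.I) ∈ A := H.mem (mk_mem_strip hs t)

theorem exists_winds (H : StripMap Φ ℓ A) {s : ℝ} (hs : s ∈ Ioo 0 ℓ) {x : ℂ}
    (hx : ∀ t : ℝ, Φ (s + t * Complex.I) ≠ x) : ∃ n, Winds (fun t => Φ (s + t * Complex.I) - x) n :=
  Winds.exists ((H.continuous_loop hs).sub continuous_const) (fun t => sub_ne_zero.2 (hx t))
    fun t => by rw [H.loop_periodic hs]

/-- A loop of a ring domain does not wind around a point that the ring does not surround. -/
theorem winds_zero (H : StripMap Φ ℓ A) {x : ℂ} (hxA : x ∉ A) (hx : x ∉ surrounded A) {s : ℝ}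
    (hs : s ∈ Ioo 0 ℓ) : Winds (fun t => Φ (s + t * Complex.I) - x) 0 :=
  winds_zero_of_not_isBounded (H.continuous_loop hs) (H.loop_periodic hs)
    isPreconnected_connectedComponentIn
    (fun t h => (connectedComponentIn_subset Aᶜ x h : _ ∈ Aᶜ) (H.loop_mem hs t))
    (mem_connectedComponentIn hxA) fun hb => hx ⟨hxA, hb⟩

/-- On the simply connected strip, Φ - x has a logarithm. If one loop has winding number 0, this
logarithm is periodic and descends to a logarithm of z - x on the ring, impossible when the
component of x in the complement is bounded. -/
theorem not_winds_zero (H : StripMap Φ ℓ A) {x : ℂ} (hx : x ∈ surrounded A) {s : ℝ}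
    (hs : s ∈ Ioo 0 ℓ) : ¬ Winds (fun t => Φ (s + t * Complex.I) - x) 0 := by
  intro hw
  obtain ⟨L, hL, hLe⟩ := Complex.exists_continuousOn_eqOn_exp_comp (isSimplyConnected_strip H.pos)
    (isOpen_strip ℓ) (g := fun w => Φ w - x) (H.holo.continuousOn.sub continuousOn_const) (by
      rintro ⟨w, hw, h⟩
      exact hx.1 (sub_eq_zero.1 h ▸ H.mem hw))
  have hLe' : ∀ w ∈ strip ℓ, Complex.exp (L w) = Φ w - x := fun w hw => hLe hw
  have hadd : ∀ w ∈ strip ℓ, w + 2 * Real.pi * Complex.I ∈ strip ℓ := fun w hw => by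
    simpa using add_mem_strip hw 1
  have hne : ∀ w ∈ strip ℓ, Φ w - x ≠ 0 := fun w hw => by
    rw [← hLe' w hw]; exact Complex.exp_ne_zero _
  obtain ⟨n, hn⟩ := exists_int_const_of_exp_eq_one (convex_strip ℓ).isPreconnected
    (f := fun w => L (w + 2 * Real.pi * Complex.I) - L w)
    ((hL.comp (by fun_prop) hadd).sub hL) (by
      intro w hw
      rw [Complex.exp_sub, hLe' _ (hadd w hw), hLe' w hw, H.per w hw, div_self (hne w hw)])
  have hn0 : n = 0 := by
    refine Winds.unique (γ := fun t : ℝ => Φ (s + t * Complex.I) - x) ?_ hw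
    refine ⟨fun t => L (s + t * Complex.I), hL.comp_continuous (by fun_prop) (mk_mem_strip hs),
      fun t => hLe' _ (mk_mem_strip hs t), fun t => ?_⟩
    rw [← hn _ (mk_mem_strip hs t)]
    have : (s + (t + 2 * Real.pi : ℝ) * Complex.I : ℂ) = s + t * Complex.I + 2 * Real.pi * Complex.I := by
      push_cast; ring
    simp only [this]; ring
  subst hn0
  have hper : ∀ w ∈ strip ℓ, L (w + 2 * Real.pi * Complex.I) = L w := fun w hw => by
    have := hn w hw
    simpa [sub_eq_zero] using this
  have hperk : ∀ (k : ℤ), ∀ w ∈ strip ℓ, L (w + k * (2 * Real.pi * Complex.I)) = L w := by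
    intro k
    induction k with
    | zero => simp
    | succ k ih =>
      intro w hw
      rw [← ih w hw, ← hper _ (add_mem_strip hw k)]
      congr 1; push_cast; ring
    | pred k ih =>
      intro w hw
      rw [← ih w hw, ← hper _ (add_mem_strip hw _)]
      congr 1; push_cast; ring
  -- The logarithm is constant on fibres of Φ, so an arbitrary choice of preimage gives a well
  -- defined function on A.
  have hF : ∀ w ∈ strip ℓ, L (Function.invFunOn Φ (strip ℓ) (Φ w)) = L w := by
    intro w hw
    have hm := Function.invFunOn_mem (f := Φ) (s := strip ℓ) ⟨w, hw, rfl⟩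
    have he := Function.invFunOn_eq (f := Φ) (s := strip ℓ) ⟨w, hw, rfl⟩
    obtain ⟨k, hk⟩ := H.inj _ hm _ hw he
    rw [hk, hperk k w hw]
  refine not_isBounded_of_continuous_log H.isOpen hx.1 (F := fun z => L (Function.invFunOn Φ (strip ℓ) z))
    ?_ ?_ hx.2
  · intro z hz
    rw [← H.img] at hz
    obtain ⟨w, hw, rfl⟩ := hz
    apply ContinuousAt.continuousWithinAt
    refine Tendsto.mono_left ?_ (H.nhds_le_map hw)
    rw [tendsto_map'_iff]
    simp only [hF w hw]
    refine Tendsto.congr' ?_ (hL.continuousAt ((isOpen_strip ℓ).mem_nhds hw))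
    filter_upwards [(isOpen_strip ℓ).mem_nhds hw] with y hy using (hF y hy).symm
  · intro z hz
    rw [← H.img] at hz
    obtain ⟨w, hw, rfl⟩ := hz
    rw [hF w hw, hLe' w hw]

/-- A connected set with a surrounded point and a point that is not surrounded meets the loops. -/
theorem exists_loop_mem (H : StripMap Φ ℓ A) {Z : Set ℂ} (hZ : IsPreconnected Z) {x y : ℂ}
    (hx : x ∈ Z) (hy : y ∈ Z) (hxA : x ∈ surrounded A) (hyA : y ∉ A) (hyA' : y ∉ surrounded A)
    {s : ℝ} (hs : s ∈ Ioo 0 ℓ) : ∃ t : ℝ, Φ (s + t * Complex.I) ∈ Z := by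
  by_contra! h
  exact H.not_winds_zero hxA hs (Winds.of_preconnected (H.continuous_loop hs) (H.loop_periodic hs)
    hZ h hy hx (H.winds_zero hyA hyA' hs))

theorem exists_loop_mem_of_unbounded (H : StripMap Φ ℓ A) {Z : Set ℂ} (hZ : IsPreconnected Z)
    {x : ℂ} (hx : x ∈ Z) (hxA : x ∈ surrounded A) (hb : ¬ Bornology.IsBounded Z)
    {s : ℝ} (hs : s ∈ Ioo 0 ℓ) : ∃ t : ℝ, Φ (s + t * Complex.I) ∈ Z := by
  by_contra! h
  exact H.not_winds_zero hxA hs (winds_zero_of_not_isBounded (H.continuous_loop hs)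
    (H.loop_periodic hs) hZ h hx hb)

theorem mem_surrounded (H : StripMap Φ ℓ A) {x : ℂ} (hx : x ∉ A) {s : ℝ} (hs : s ∈ Ioo 0 ℓ)
    (h : ¬ Winds (fun t => Φ (s + t * Complex.I) - x) 0) : x ∈ surrounded A := by
  by_contra hx'
  exact h (H.winds_zero hx hx' hs)

/-- Points surrounded by a ring are surrounded by its subrings. -/
theorem surrounded_subset_restrict (H : StripMap Φ ℓ A) {a b : ℝ} (ha : 0 ≤ a) (hab : a < b)
    (hb : b ≤ ℓ) : surrounded A ⊆ surrounded (Φ '' {w | a < w.re ∧ w.re < b}) := by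
  intro x hx
  have H' := H.restrict ha hab hb
  have hsub : Φ '' {w | a < w.re ∧ w.re < b} ⊆ A := by
    rintro _ ⟨w, ⟨h1, h2⟩, rfl⟩
    exact H.mem ⟨by linarith, by linarith⟩
  refine H'.mem_surrounded (fun h => hx.1 (hsub h)) (s := (b - a) / 2)
    ⟨by linarith, by linarith⟩ fun h => ?_
  refine H.not_winds_zero hx (s := (a + b) / 2) ⟨by linarith, by linarith⟩ ?_
  convert h using 3
  push_cast; ring_nf

theorem not_mem_surrounded_restrict (H : StripMap Φ ℓ A) {a b : ℝ} (ha : 0 ≤ a) (hab : a < b)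
    (hb : b ≤ ℓ) {x : ℂ} (hxA : x ∉ A) (hx : x ∉ surrounded A) :
    x ∉ surrounded (Φ '' {w | a < w.re ∧ w.re < b}) := by
  intro h
  have H' := H.restrict ha hab hb
  refine H'.not_winds_zero h (s := (b - a) / 2) ⟨by linarith, by linarith⟩ ?_
  convert H.winds_zero hxA hx (s := (a + b) / 2) ⟨by linarith, by linarith⟩ using 3
  push_cast; ring_nf

/-- The winding number around a point of a ring jumps by one when the loop crosses the point. -/
theorem winds_jump (H : StripMap Φ ℓ A) {w₀ : ℂ} (hw₀ : w₀ ∈ strip ℓ) {s s' : ℝ} (hs : s ∈ Ioo 0 w₀.re)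
    (hs' : s' ∈ Ioo w₀.re ℓ) (h : Winds (fun t => Φ (s + t * Complex.I) - Φ w₀) 0) :
    Winds (fun t => Φ (s' + t * Complex.I) - Φ w₀) 1 := by
  obtain ⟨φ, hd, hi, -, he⟩ := H.exists_annulus
  have hz₀ := exp_mem_roundAnnulus.2 hw₀
  set z₀ := Complex.exp w₀
  have hsm : s ∈ Ioo 0 ℓ := ⟨hs.1, hs.2.trans hw₀.2⟩
  have hsm' : s' ∈ Ioo 0 ℓ := ⟨hw₀.1.trans hs'.1, hs'.2⟩
  have hφd := hd.differentiableAt ((isOpen_roundAnnulus ℓ).mem_nhds hz₀)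
  -- Φ w - Φ w₀ factors as (exp w - z₀) times the difference quotient of φ. The quotient never
  -- vanishes, so its winding number is the same on all loops; the jump comes entirely from the
  -- circle passing z₀.
  have hu : ContinuousOn (dslope φ z₀) (roundAnnulus ℓ) :=
    (continuousOn_dslope ((isOpen_roundAnnulus ℓ).mem_nhds hz₀)).2 ⟨hd.continuousOn, hφd⟩
  have hu0 : ∀ z ∈ roundAnnulus ℓ, dslope φ z₀ z ≠ 0 := by
    intro z hz
    by_cases hzz : z = z₀
    · rw [hzz, dslope_same]; exact deriv_ne_zero_of_injOn (isOpen_roundAnnulus ℓ) hd hi hz₀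
    · rw [dslope_of_ne _ hzz, slope_def_field]
      exact div_ne_zero (sub_ne_zero.2 fun h => hzz (hi hz hz₀ h)) (sub_ne_zero.2 hzz)
  have hfac : ∀ w ∈ strip ℓ, Φ w - Φ w₀ = (Complex.exp w - z₀) * dslope φ z₀ (Complex.exp w) := by
    intro w hw
    rw [← he w hw, ← he w₀ hw₀, ← smul_eq_mul, sub_smul_dslope]
  have hexm : ∀ s ∈ Ioo 0 ℓ, ∀ t : ℝ, Complex.exp (s + t * Complex.I) ∈ roundAnnulus ℓ :=
    fun s hs t => exp_mem_roundAnnulus.2 (mk_mem_strip hs t)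
  have hcont : ContinuousOn (fun q : ℝ × ℝ => dslope φ z₀ (Complex.exp (q.1 + q.2 * Complex.I)))
      (Ioo 0 ℓ ×ˢ univ) :=
    hu.comp (f := fun q : ℝ × ℝ => Complex.exp (q.1 + q.2 * Complex.I)) (by fun_prop)
      fun q hq => hexm _ hq.1 _
  have hperu : ∀ s t : ℝ, Complex.exp (s + (t + 2 * Real.pi : ℝ) * Complex.I)
      = Complex.exp (s + t * Complex.I) := by
    intro s t
    rw [show (s + (t + 2 * Real.pi : ℝ) * Complex.I : ℂ) = s + t * Complex.I + 2 * Real.pi * Complex.I by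
      push_cast; ring, Complex.exp_add, Complex.exp_two_pi_mul_I, mul_one]
  have hus : Continuous fun t : ℝ => dslope φ z₀ (Complex.exp (s + t * Complex.I)) :=
    hu.comp_continuous (by fun_prop) (hexm s hsm)
  obtain ⟨n, hn⟩ := Winds.exists hus (fun t => hu0 _ (hexm s hsm t)) (fun t => by rw [hperu])
  have hn' : Winds (fun t : ℝ => dslope φ z₀ (Complex.exp (s' + t * Complex.I))) n :=
    winds_of_homotopy isPreconnected_Ioo
      (H := fun (s : ℝ) t => dslope φ z₀ (Complex.exp (s + t * Complex.I))) hcont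
      (fun s hs t => hu0 _ (hexm s hs t)) (fun s _ t => by rw [hperu]) hsm hsm' hn
  have hin : Winds (fun t : ℝ => Complex.exp (s + t * Complex.I) - z₀) 0 := by
    refine (winds_const (neg_ne_zero.2 (Complex.exp_ne_zero w₀))).perturb (by fun_prop)
      (fun t => by rw [hperu]) fun t => ?_
    simp [z₀, Complex.norm_exp, hs.2]
  have hout : Winds (fun t : ℝ => Complex.exp (s' + t * Complex.I) - z₀) 1 := by
    refine (winds_exp s').perturb (by fun_prop) (fun t => by rw [hperu]) fun t => ?_
    simp [z₀, Complex.norm_exp, hs'.1]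
  have h1 := hin.mul hn
  have h2 := hout.mul hn'
  simp only [← hfac _ (mk_mem_strip hsm _)] at h1
  simp only [← hfac _ (mk_mem_strip hsm' _)] at h2
  have hn0 : n = 0 := by simpa using h1.unique h
  simpa [hn0] using h2

/-- A connected unbounded set through a point of a ring crosses one of its two sides. -/
theorem crosses_of_unbounded (H : StripMap Φ ℓ A) {w₀ : ℂ} (hw₀ : w₀ ∈ strip ℓ) {Z : Set ℂ}
    (hZ : IsPreconnected Z) (hw₀Z : Φ w₀ ∈ Z) (hb : ¬ Bornology.IsBounded Z) :
    (∀ s ∈ Ioo 0 w₀.re, ∃ t : ℝ, Φ (s + t * Complex.I) ∈ Z) ∨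
      ∀ s ∈ Ioo w₀.re ℓ, ∃ t : ℝ, Φ (s + t * Complex.I) ∈ Z := by
  by_contra! hcon
  obtain ⟨⟨s, hs, h1⟩, s', hs', h2⟩ := hcon
  have hsm : s ∈ Ioo 0 ℓ := ⟨hs.1, hs.2.trans hw₀.2⟩
  have hsm' : s' ∈ Ioo 0 ℓ := ⟨hw₀.1.trans hs'.1, hs'.2⟩
  have e1 := winds_zero_of_not_isBounded (H.continuous_loop hsm) (H.loop_periodic hsm) hZ h1 hw₀Z hb
  have e2 := winds_zero_of_not_isBounded (H.continuous_loop hsm') (H.loop_periodic hsm') hZ h2 hw₀Z hb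
  exact absurd ((H.winds_jump hw₀ hs hs' e1).unique e2) one_ne_zero

end StripMap

end GlueSpace

end

section

namespace GlueSpace

open MeasureTheory

/-! ### Length and area -/

/-- A rectangle of height `2 π`. -/
def box (a b : ℝ) : Set ℂ := {w | w.re ∈ Ioo a b ∧ w.im ∈ Ico 0 (2 * Real.pi)}

theorem measurableSet_box (a b : ℝ) : MeasurableSet (box a b) :=
  (Complex.measurable_re measurableSet_Ioo).inter (Complex.measurable_im measurableSet_Ico)

theorem lintegral_box {f : ℂ → ENNReal} (hf : Measurable f) (a b : ℝ) :
    ∫⁻ w in box a b, f w = ∫⁻ s in Ioo a b, ∫⁻ t in Ico 0 (2 * Real.pi), f (s + t * Complex.I) := by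
  have hp := Complex.volume_preserving_equiv_real_prod
  have hm : ∀ p : ℝ × ℝ, Complex.measurableEquivRealProd.symm p = p.1 + p.2 * Complex.I := by
    intro p; apply Complex.ext <;> simp
  have h1 := (hp.symm).setLIntegral_comp_preimage_emb
    Complex.measurableEquivRealProd.symm.measurableEmbedding f (box a b)
  rw [← h1]
  have h2 : Complex.measurableEquivRealProd.symm ⁻¹' box a b = Ioo a b ×ˢ Ico 0 (2 * Real.pi) := by
    ext p; simp [box, mem_prod]
  rw [h2, Measure.volume_eq_prod, setLIntegral_prod]
  · simp only [hm]
  · exact (hf.comp Complex.measurableEquivRealProd.symm.measurable).aemeasurable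

/-- Cauchy–Schwarz on each vertical segment, whose length is 2π, followed by integration over the
real part. -/
theorem length_area {f : ℂ → ENNReal} (hf : Measurable f) {a b : ℝ} {l : ENNReal}
    (h : ∀ s ∈ Ioo a b, l ≤ ∫⁻ t in Ico 0 (2 * Real.pi), f (s + t * Complex.I)) :
    l ^ 2 * ENNReal.ofReal (b - a) ≤ ENNReal.ofReal (2 * Real.pi) * ∫⁻ w in box a b, f w ^ 2 := by
  rw [lintegral_box (hf.pow_const 2), ← lintegral_const_mul']
  · calc l ^ 2 * ENNReal.ofReal (b - a) = ∫⁻ s in Ioo a b, l ^ 2 := by simp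
      _ ≤ _ := by
        refine setLIntegral_mono' measurableSet_Ioo fun s hs => ?_
        set g : ℝ → ENNReal := fun t => f (s + t * Complex.I)
        have hg : Measurable g := hf.comp (by fun_prop)
        have hcs := ENNReal.lintegral_mul_le_Lp_mul_Lq (volume.restrict (Ico 0 (2 * Real.pi)))
          Real.HolderConjugate.two_two hg.aemeasurable (aemeasurable_const (b := (1 : ENNReal)))
        have h1 : l ≤ (∫⁻ t in Ico 0 (2 * Real.pi), g t ^ (2 : ℝ)) ^ (1 / 2 : ℝ) *
            (ENNReal.ofReal (2 * Real.pi)) ^ (1 / 2 : ℝ) := by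
          refine (h s hs).trans ?_
          simpa using hcs
        calc l ^ 2 ≤ ((∫⁻ t in Ico 0 (2 * Real.pi), g t ^ (2 : ℝ)) ^ (1 / 2 : ℝ) *
              (ENNReal.ofReal (2 * Real.pi)) ^ (1 / 2 : ℝ)) ^ 2 := by gcongr
          _ = _ := by
            rw [mul_pow, ← ENNReal.rpow_natCast, ← ENNReal.rpow_mul, ← ENNReal.rpow_natCast,
              ← ENNReal.rpow_mul]
            norm_num
            rw [mul_comm]
  · exact ENNReal.ofReal_ne_top

/-- Change of variables: the real Jacobian determinant of a holomorphic map is the squared norm of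
its derivative. -/
theorem lintegral_image_holomorphic {F F' : ℂ → ℂ} {S : Set ℂ} (hS : MeasurableSet S)
    (hF : ∀ w ∈ S, HasDerivAt F (F' w) w) (hi : InjOn F S) (g : ℂ → ENNReal) :
    ∫⁻ z in F '' S, g z = ∫⁻ w in S, ‖F' w‖ₑ ^ 2 * g (F w) := by
  have hd : ∀ c : ℂ, ENNReal.ofReal |((ContinuousLinearMap.toSpanSingleton ℂ c).restrictScalars
      ℝ).det| = ‖c‖ₑ ^ 2 := by
    intro c
    have : ((ContinuousLinearMap.toSpanSingleton ℂ c).restrictScalars ℝ).det = ‖c‖ ^ 2 := by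
      change LinearMap.det (LinearMap.restrictScalars ℝ
        (ContinuousLinearMap.toSpanSingleton ℂ c : ℂ →ₗ[ℂ] ℂ)) = _
      rw [LinearMap.det_restrictScalars, Algebra.norm_complex_apply, LinearMap.det_ring,
        Complex.normSq_eq_norm_sq]
      simp
    rw [this, abs_of_nonneg (by positivity), ENNReal.ofReal_pow (norm_nonneg _), ofReal_norm]
  rw [lintegral_image_eq_lintegral_abs_det_fderiv_mul volume hS
    (fun w hw => ((hF w hw).hasFDerivAt.restrictScalars ℝ).hasFDerivWithinAt) hi]
  simp only [hd]

theorem volume_image_le {v v' : ℝ → ℝ} {S : Set ℝ} (hS : MeasurableSet S)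
    (hv : ∀ t ∈ S, HasDerivAt v (v' t) t) : volume (v '' S) ≤ ∫⁻ t in S, ‖v' t‖ₑ := by
  have := addHaar_image_le_lintegral_abs_det_fderiv volume hS
    (fun t ht => (hv t ht).hasFDerivAt.hasFDerivWithinAt)
  simpa [ContinuousLinearMap.det_toSpanSingleton, ← Real.enorm_eq_ofReal_abs] using this

/-- A lower bound for a length integral from the values of a real function along the curve. -/
theorem le_length {v v' : ℝ → ℝ} {k : ℝ} {f : ℝ → ENNReal} {S : Set ℝ} (hS : MeasurableSet S)
    (hSI : S ⊆ Ico 0 (2 * Real.pi)) (hv : ∀ t ∈ S, HasDerivAt v (v' t) t)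
    (hf : ∀ t ∈ S, ‖v' t‖ₑ ≤ ENNReal.ofReal k * f t) {x y : ℝ} (hxy : Ioo x y ⊆ v '' S) :
    ENNReal.ofReal (y - x) ≤ ENNReal.ofReal k * ∫⁻ t in Ico 0 (2 * Real.pi), f t := by
  rw [← lintegral_const_mul' _ _ ENNReal.ofReal_ne_top, ← Real.volume_Ioo]
  calc volume (Ioo x y) ≤ volume (v '' S) := measure_mono hxy
    _ ≤ _ := volume_image_le hS hv
    _ ≤ ∫⁻ t in S, ENNReal.ofReal k * f t := setLIntegral_mono' hS hf
    _ ≤ _ := lintegral_mono_set hSI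

theorem measurable_indicator_enorm {g : ℂ → ℂ} {O : Set ℂ} (hO : IsOpen O) (hg : ContinuousOn g O) :
    Measurable (O.indicator fun w => ‖g w‖ₑ) := by
  classical
  rw [← piecewise_eq_indicator]
  exact ContinuousOn.measurable_piecewise (continuous_enorm.comp_continuousOn hg)
    continuousOn_const hO.measurableSet

theorem exists_mem_Ico_of_periodic {α : Type*} {g : ℝ → α} (hp : ∀ t, g (t + 2 * Real.pi) = g t)
    (t : ℝ) : ∃ s ∈ Ico 0 (2 * Real.pi), g t = g s :=
  Function.Periodic.exists_mem_Ico₀ (f := g) hp (by have := Real.pi_pos; positivity) t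

/-! ### Moduli bounds by the length-area method -/

namespace StripMap

variable {Φ : ℂ → ℂ} {ℓ : ℝ} {A : Set ℂ}

theorem hasDerivAt_loop {g : ℂ → ℂ} {s t : ℝ} {g' : ℂ} (h : HasDerivAt g g' (s + t * Complex.I)) :
    HasDerivAt (fun t : ℝ => g (s + t * Complex.I)) (g' * Complex.I) t := by
  have h1 : HasDerivAt (fun t : ℝ => (s + t * Complex.I : ℂ)) Complex.I t := by
    simpa using ((hasDerivAt_id t).ofReal_comp.mul_const Complex.I).const_add (s : ℂ)
  exact HasDerivAt.comp t h h1

theorem injOn_box' (H : StripMap Φ ℓ A) {a b : ℝ} (ha : 0 ≤ a) (hb : b ≤ ℓ) :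
    InjOn Φ (box a b) := by
  refine (H.injOn_box 0).mono ?_
  intro w hw
  have h1 : w.im < 0 + 2 * Real.pi := by simpa using hw.2.2
  exact ⟨⟨ha.trans_lt hw.1.1, hw.1.2.trans_le hb⟩, hw.2.1, h1⟩

theorem continuousOn_deriv (H : StripMap Φ ℓ A) : ContinuousOn (deriv Φ) (strip ℓ) :=
  (H.holo.deriv (isOpen_strip ℓ)).continuousOn

theorem hasDerivAt (H : StripMap Φ ℓ A) {w : ℂ} (hw : w ∈ strip ℓ) : HasDerivAt Φ (deriv Φ w) w :=
  (H.analyticAt hw).differentiableAt.hasDerivAt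

/-- The length of the loops of a ring that separates `{0, a}` from `{b, ∞}`, measured in a disk. -/
theorem length_of_separates (H : StripMap Φ ℓ A) {a b : ℂ} (h0 : 0 ∈ surrounded A)
    (ha : a ∈ surrounded A) (hbA : b ∉ A) (hb : b ∉ surrounded A) (hb2 : ‖b‖ ≤ 2) {δ : ℝ}
    (hδ : 0 < δ) (hδa : δ ≤ ‖a‖) (hδ1 : δ ≤ 1) {s : ℝ} (hs : s ∈ Ioo 0 ℓ) :
    ENNReal.ofReal δ ≤ ∫⁻ t in Ico 0 (2 * Real.pi),
      {w | w ∈ strip ℓ ∧ ‖Φ w‖ < 4}.indicator (fun w => ‖deriv Φ w‖ₑ) (s + t * Complex.I) := by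
  set γ : ℝ → ℂ := fun t => Φ (s + t * Complex.I) with hγ
  have hγc : Continuous γ := H.continuous_loop hs
  have hγp : ∀ t, γ (t + 2 * Real.pi) = γ t := H.loop_periodic hs
  have hγd : ∀ t : ℝ, HasDerivAt γ (deriv Φ (s + t * Complex.I) * Complex.I) t := fun t =>
    hasDerivAt_loop (H.hasDerivAt (mk_mem_strip hs t))
  have ha0 : a ≠ 0 := by rintro rfl; simp at hδa; linarith
  have hna : 0 < ‖a‖ := norm_pos_iff.2 ha0
  -- The metric is Euclidean, cut off at radius 4. A loop inside the disk has length at least |a|,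
  -- because it goes around 0 and a. A loop that leaves it also meets the segment from 0 to b, hence
  -- joins radius 2 to radius 4.
  by_cases hall : ∀ t, ‖γ t‖ < 4
  · have hvd : ∀ t : ℝ, HasDerivAt (fun t => inner ℝ (‖a‖⁻¹ • a) (γ t))
        (inner ℝ (‖a‖⁻¹ • a) (deriv Φ (s + t * Complex.I) * Complex.I)) t := by
      intro t
      simpa using (hasDerivAt_const t (‖a‖⁻¹ • a)).inner ℝ (hγd t)
    have hna1 : ‖‖a‖⁻¹ • a‖ = 1 := by
      rw [norm_smul, norm_inv, norm_norm, inv_mul_cancel₀ hna.ne']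
    have hin : ∀ τ : ℝ, inner ℝ (‖a‖⁻¹ • a) (τ • a) = τ * ‖a‖ := by
      intro τ
      rw [real_inner_smul_left, real_inner_smul_right, real_inner_self_eq_norm_sq]
      field_simp
    -- A half-line is connected and unbounded, so when it starts at a surrounded point it meets the
    -- loop. It is applied from 0 away from a, and from a away from 0, so that the projection onto
    -- the direction of a covers an interval of length |a|.
    have hray : ∀ (σ : ℝ) (x : ℝ), |σ| = 1 → (x • a) ∈ surrounded A →
        ∃ t τ : ℝ, 0 ≤ τ ∧ γ t = (x + σ * τ) • a := by
      intro σ x hσ hx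
      have hZ : IsPreconnected ((fun τ : ℝ => (x + σ * τ) • a) '' Ici 0) :=
        isPreconnected_Ici.image _ (by fun_prop)
      obtain ⟨t, τ, hτ, ht⟩ := H.exists_loop_mem_of_unbounded hZ ⟨0, by simp, by simp⟩ hx (by
        intro hbd
        obtain ⟨C, hC⟩ := isBounded_iff_forall_norm_le.1 hbd
        have hτ0 : 0 ≤ (|C| + |x| + 1) / ‖a‖ + |x| := by positivity
        have := hC _ ⟨_, hτ0, rfl⟩
        rw [norm_smul, Real.norm_eq_abs] at this
        have h1 : (|C| + |x| + 1) / ‖a‖ ≤ |x + σ * ((|C| + |x| + 1) / ‖a‖ + |x|)| := by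
          have h2 := abs_sub_abs_le_abs_sub (σ * ((|C| + |x| + 1) / ‖a‖ + |x|)) (-x)
          rw [abs_mul, hσ, one_mul, abs_of_nonneg hτ0, abs_neg] at h2
          rw [show x + σ * ((|C| + |x| + 1) / ‖a‖ + |x|) = σ * ((|C| + |x| + 1) / ‖a‖ + |x|) - -x by
            ring]
          linarith
        have h3 := mul_le_mul_of_nonneg_right h1 hna.le
        rw [div_mul_cancel₀ _ hna.ne'] at h3
        have := le_abs_self C
        have := abs_nonneg x
        linarith) hs
      exact ⟨t, τ, hτ, ht.symm⟩
    obtain ⟨t₀, τ₀, hτ₀, e₀⟩ := hray (-1) 0 (by simp) (by simpa using h0)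
    obtain ⟨t₁, τ₁, hτ₁, e₁⟩ := hray 1 1 (by simp) (by simpa using ha)
    have key := le_length (k := 1) (S := Ico 0 (2 * Real.pi)) (x := 0) (y := ‖a‖)
      (f := fun t : ℝ => {w | w ∈ strip ℓ ∧ ‖Φ w‖ < 4}.indicator (fun w => ‖deriv Φ w‖ₑ)
        (s + t * Complex.I)) measurableSet_Ico Subset.rfl (fun t _ => hvd t) (by
        intro t _
        have hmem : (s + t * Complex.I : ℂ) ∈ {w | w ∈ strip ℓ ∧ ‖Φ w‖ < 4} :=
          ⟨mk_mem_strip hs t, hall t⟩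
        simp only [indicator_of_mem hmem, ENNReal.ofReal_one, one_mul]
        rw [enorm_le_iff_norm_le]
        refine (norm_inner_le_norm _ _).trans ?_
        rw [hna1, norm_mul, Complex.norm_I]; simp) (by
        intro y hy
        have hc : Continuous fun t => (inner ℝ (‖a‖⁻¹ • a) (γ t) : ℝ) := by fun_prop
        have hle : inner ℝ (‖a‖⁻¹ • a) (γ t₀) ≤ y := by
          rw [e₀, hin]; nlinarith [hy.1]
        have hge : y ≤ inner ℝ (‖a‖⁻¹ • a) (γ t₁) := by
          rw [e₁, hin]; nlinarith [hy.2]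
        obtain ⟨t, ht⟩ := mem_range_of_exists_le_of_exists_ge hc ⟨t₀, hle⟩ ⟨t₁, hge⟩
        obtain ⟨t', ht', he⟩ := exists_mem_Ico_of_periodic hγp t
        exact ⟨t', ht', by simp only [← ht, he]⟩)
    rw [ENNReal.ofReal_one, one_mul, sub_zero] at key
    exact (ENNReal.ofReal_le_ofReal hδa).trans key
  · push Not at hall
    obtain ⟨t₁, ht₁⟩ := hall
    obtain ⟨t₀, ht₀⟩ := H.exists_loop_mem (convex_segment (𝕜 := ℝ) (0 : ℂ) b).isPreconnected
      (left_mem_segment ℝ _ _) (right_mem_segment ℝ _ _) h0 hbA hb hs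
    have ht₀' : ‖γ t₀‖ ≤ 2 := by
      have := (convex_closedBall (0 : ℂ) 2).segment_subset (by simp) (by simpa using hb2) ht₀
      simpa using this
    -- The squared norm is smooth everywhere. Its derivative is at most 2 · 4 = 8 times the speed
    -- inside radius 4, and it runs from 4 to 16, so the length is at least 12/8 ≥ δ.
    have hvd : ∀ t : ℝ, HasDerivAt (fun t => ‖γ t‖ ^ 2)
        (2 * inner ℝ (γ t) (deriv Φ (s + t * Complex.I) * Complex.I)) t := fun t => (hγd t).norm_sq
    have hSm : MeasurableSet (Ico 0 (2 * Real.pi) ∩ {t | ‖γ t‖ < 4}) :=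
      measurableSet_Ico.inter (isOpen_lt hγc.norm continuous_const).measurableSet
    have key := le_length (k := 8) (S := Ico 0 (2 * Real.pi) ∩ {t | ‖γ t‖ < 4}) (x := 4) (y := 16)
      (f := fun t : ℝ => {w | w ∈ strip ℓ ∧ ‖Φ w‖ < 4}.indicator (fun w => ‖deriv Φ w‖ₑ)
        (s + t * Complex.I)) hSm inter_subset_left (fun t _ => hvd t) (by
        rintro t ⟨-, ht⟩
        have hmem : (s + t * Complex.I : ℂ) ∈ {w | w ∈ strip ℓ ∧ ‖Φ w‖ < 4} :=
          ⟨mk_mem_strip hs t, ht⟩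
        simp only [indicator_of_mem hmem]
        rw [← ofReal_norm, ← ofReal_norm, ← ENNReal.ofReal_mul (by norm_num)]
        apply ENNReal.ofReal_le_ofReal
        rw [norm_mul]
        have h1 := norm_inner_le_norm (𝕜 := ℝ) (γ t) (deriv Φ (s + t * Complex.I) * Complex.I)
        rw [norm_mul, Complex.norm_I, mul_one] at h1
        have h2 : ‖γ t‖ < 4 := ht
        have h3 := norm_nonneg (deriv Φ (s + t * Complex.I))
        rw [Real.norm_ofNat]
        nlinarith) (by
        intro y hy
        have hc : Continuous fun t => ‖γ t‖ ^ 2 := by fun_prop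
        have hle : ‖γ t₀‖ ^ 2 ≤ y := by nlinarith [hy.1, norm_nonneg (γ t₀)]
        have hge : y ≤ ‖γ t₁‖ ^ 2 := by nlinarith [hy.2, norm_nonneg (γ t₁)]
        obtain ⟨t, ht⟩ := mem_range_of_exists_le_of_exists_ge hc ⟨t₀, hle⟩ ⟨t₁, hge⟩
        obtain ⟨t', ht', he⟩ := exists_mem_Ico_of_periodic hγp t
        refine ⟨t', ⟨ht', ?_⟩, by simp only [← ht, he]⟩
        have : ‖γ t'‖ ^ 2 < 16 := by rw [← he]; simp only [ht]; exact hy.2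
        change ‖γ t'‖ < 4
        nlinarith [norm_nonneg (γ t')])
    have h12 : ENNReal.ofReal (8 * δ) ≤ ENNReal.ofReal (16 - 4) :=
      ENNReal.ofReal_le_ofReal (by linarith)
    rw [ENNReal.ofReal_mul (by norm_num)] at h12
    exact (ENNReal.mul_le_mul_iff_right (by simp) (by simp)).1 (h12.trans key)

/-- The modulus of a ring that separates `{0, a}` from `{b, ∞}` is bounded. -/
theorem le_of_separates (H : StripMap Φ ℓ A) {a b : ℂ} (h0 : 0 ∈ surrounded A)
    (ha : a ∈ surrounded A) (hbA : b ∉ A) (hb : b ∉ surrounded A) (hb2 : ‖b‖ ≤ 2) {δ : ℝ}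
    (hδ : 0 < δ) (hδa : δ ≤ ‖a‖) (hδ1 : δ ≤ 1) : δ ^ 2 * ℓ ≤ 32 * Real.pi ^ 2 := by
  set O : Set ℂ := {w | w ∈ strip ℓ ∧ ‖Φ w‖ < 4} with hOdef
  have hO : IsOpen O := H.holo.continuousOn.norm.isOpen_inter_preimage (isOpen_strip ℓ) isOpen_Iio
  have hm := measurable_indicator_enorm hO (H.continuousOn_deriv.mono fun w hw => hw.1)
  have h1 := length_area hm (a := 0) (b := ℓ) (l := ENNReal.ofReal δ) fun s hs =>
    H.length_of_separates h0 ha hbA hb hb2 hδ hδa hδ1 hs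
  -- Φ is injective on one period, so the integral is an area inside the disk of radius 4, at most
  -- 16π.
  have h2 : ∫⁻ w in box 0 ℓ, O.indicator (fun w => ‖deriv Φ w‖ₑ) w ^ 2 ≤ ENNReal.ofReal (16 * Real.pi) := by
    have e1 : ∀ w, O.indicator (fun w => ‖deriv Φ w‖ₑ) w ^ 2 = O.indicator (fun w => ‖deriv Φ w‖ₑ ^ 2) w := by
      intro w
      by_cases hw : w ∈ O <;> simp [hw]
    simp only [e1]
    rw [lintegral_indicator hO.measurableSet, Measure.restrict_restrict hO.measurableSet]
    have hS : MeasurableSet (O ∩ box 0 ℓ) := hO.measurableSet.inter (measurableSet_box _ _)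
    have h3 := lintegral_image_holomorphic hS (fun w hw => H.hasDerivAt hw.1.1)
      ((H.injOn_box' le_rfl le_rfl).mono inter_subset_right) (fun _ => 1)
    simp only [mul_one] at h3
    rw [← h3]
    simp only [lintegral_const, one_mul, Measure.restrict_apply MeasurableSet.univ, univ_inter]
    calc volume (Φ '' (O ∩ box 0 ℓ)) ≤ volume (Metric.ball (0 : ℂ) 4) := by
          apply measure_mono
          rintro _ ⟨w, hw, rfl⟩
          simpa using hw.1.2
      _ = _ := by
        rw [Complex.volume_ball, ← ENNReal.ofReal_pow (by norm_num), ENNReal.ofReal_mul (by norm_num),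
          ← ENNReal.ofReal_coe_nnreal]
        norm_num
  have h3 := h1.trans (mul_le_mul_right h2 _)
  rw [← ENNReal.ofReal_pow hδ.le, ← ENNReal.ofReal_mul (by positivity),
    ← ENNReal.ofReal_mul (by positivity), ENNReal.ofReal_le_ofReal_iff (by positivity)] at h3
  nlinarith

theorem exp_stripMap {ℓ : ℝ} (hℓ : 0 < ℓ) : StripMap Complex.exp ℓ (roundAnnulus ℓ) := by
  refine ⟨hℓ, Complex.differentiable_exp.differentiableOn, fun w _ => ?_, fun w _ w' _ h =>
    Complex.exp_eq_exp_iff_exists_int.1 h, ?_⟩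
  · rw [Complex.exp_add, Complex.exp_two_pi_mul_I, mul_one]
  · ext z
    constructor
    · rintro ⟨w, hw, rfl⟩; exact exp_mem_roundAnnulus.2 hw
    · intro hz
      have h0 : z ≠ 0 := by rintro rfl; simp [roundAnnulus] at hz; linarith [hz.1]
      exact ⟨_, log_mem_strip hz, Complex.exp_log h0⟩

/-- Under exp the metric |dz|/|z| becomes the Euclidean one on a rectangle of width ℓ and height 2π.
Only the upper bound is needed. -/
theorem lintegral_roundAnnulus {ℓ : ℝ} (hℓ : 0 < ℓ) :
    ∫⁻ z in roundAnnulus ℓ, (‖z‖ₑ⁻¹) ^ 2 ≤ ENNReal.ofReal (2 * Real.pi * ℓ) := by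
  have himg : roundAnnulus ℓ ⊆ Complex.exp '' box 0 ℓ := by
    intro z hz
    have h0 : z ≠ 0 := by rintro rfl; simp [roundAnnulus] at hz; linarith [hz.1]
    have hlog := log_mem_strip hz
    have hpi := Real.pi_pos
    by_cases him : 0 ≤ (Complex.log z).im
    · refine ⟨Complex.log z, ⟨hlog, him, ?_⟩, Complex.exp_log h0⟩
      linarith [Complex.log_im_le_pi z]
    · refine ⟨Complex.log z + 2 * Real.pi * Complex.I, ⟨by simpa [strip] using hlog, ?_, ?_⟩, ?_⟩
      · simp; linarith [Complex.neg_pi_lt_log_im z]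
      · push Not at him; simp; simpa using him
      · rw [Complex.exp_add, Complex.exp_two_pi_mul_I, mul_one, Complex.exp_log h0]
  have H := exp_stripMap hℓ
  calc _ ≤ ∫⁻ z in Complex.exp '' box 0 ℓ, (‖z‖ₑ⁻¹) ^ 2 := lintegral_mono_set himg
    _ = ∫⁻ w in box 0 ℓ, 1 := by
      rw [lintegral_image_holomorphic (measurableSet_box _ _)
        (fun w _ => Complex.hasDerivAt_exp w) (H.injOn_box' le_rfl le_rfl)]
      congr 1; ext w
      rw [← mul_pow, ENNReal.mul_inv_cancel (by simp) (by simp), one_pow]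
    _ = ENNReal.ofReal (2 * Real.pi * ℓ) := by
      rw [lintegral_box measurable_const]
      simp only [lintegral_const, one_mul, Measure.restrict_apply MeasurableSet.univ, univ_inter,
        Real.volume_Ico, Real.volume_Ioo, sub_zero]
      rw [← ENNReal.ofReal_mul (by positivity)]

/-- Two rings that cross each other: the product of the moduli is bounded. -/
theorem le_of_crosses (H : StripMap Φ ℓ A) {X : ℂ → ℂ} {ℓ' : ℝ} {A' : Set ℂ} (H' : StripMap X ℓ' A')
    {a b : ℝ} (ha : 0 ≤ a) (hb : b ≤ ℓ)
    (hin : ∀ s ∈ Ioo a b, ∃ t : ℝ, Φ (s + t * Complex.I) ∈ surrounded A')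
    (hout : ∀ s ∈ Ioo a b, ∃ t : ℝ, Φ (s + t * Complex.I) ∉ A' ∧ Φ (s + t * Complex.I) ∉ surrounded A') :
    ℓ' * (b - a) ≤ 4 * Real.pi ^ 2 := by
  obtain ⟨χ, hχd, hχi, hχimg, hχe⟩ := H'.exists_annulus
  have hann := isOpen_roundAnnulus ℓ'
  have hχo : OpenEmb χ (roundAnnulus ℓ') := by
    refine ⟨hχd.continuousOn, hχi, fun O hOs hO => isOpen_iff_mem_nhds.2 ?_⟩
    rintro _ ⟨z, hz, rfl⟩
    exact nhds_le_map_of_injOn hann hχd hχi (hOs hz) (image_mem_map (hO.mem_nhds hz))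
  have hk := hχo.continuousOn_inv hann
  set k := Function.invFunOn χ (roundAnnulus ℓ') with hkdef
  rw [hχimg] at hk
  have hkm : ∀ z ∈ A', k z ∈ roundAnnulus ℓ' := fun z hz =>
    Function.invFunOn_mem (by rw [← hχimg] at hz; exact hz)
  have hke : ∀ z ∈ A', χ (k z) = z := fun z hz =>
    Function.invFunOn_eq (by rw [← hχimg] at hz; exact hz)
  have hkl : ∀ z ∈ roundAnnulus ℓ', k (χ z) = z := fun z hz => hχi.leftInvOn_invFunOn hz
  set O : Set ℂ := strip ℓ ∩ Φ ⁻¹' A' with hOdef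
  have hO : IsOpen O := H.holo.continuousOn.isOpen_inter_preimage (isOpen_strip ℓ) H'.isOpen
  set T : ℂ → ℂ := fun w => k (Φ w) with hT
  have hTc : ContinuousOn T O :=
    hk.comp (H.holo.continuousOn.mono inter_subset_left) fun w hw => hw.2
  have hTd : DifferentiableOn ℂ T O := by
    intro w hw
    have hTm := hkm _ hw.2
    refine (differentiableAt_of_lift (hTc.continuousAt (hO.mem_nhds hw))
      (hχd.analyticAt (hann.mem_nhds hTm)) (deriv_ne_zero_of_injOn hann hχd hχi hTm)
      (H.analyticAt hw.1).differentiableAt ?_).differentiableWithinAt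
    filter_upwards [hO.mem_nhds hw] with y hy using hke _ hy.2
  have hT0 : ∀ w ∈ O, T w ≠ 0 := by
    intro w hw h0
    have := hkm _ hw.2
    rw [show k (Φ w) = 0 from h0] at this
    simp [roundAnnulus] at this; linarith [this.1]
  have hTda : ∀ w ∈ O, HasDerivAt T (deriv T w) w := fun w hw =>
    (hTd.differentiableAt (hO.mem_nhds hw)).hasDerivAt
  have hgc : ContinuousOn (fun w => deriv T w / T w) O :=
    (hTd.deriv hO).continuousOn.div hTc hT0
  have hm := measurable_indicator_enorm hO hgc
  have hlen : ∀ s ∈ Ioo a b, ENNReal.ofReal ℓ' ≤ ∫⁻ t in Ico 0 (2 * Real.pi),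
      O.indicator (fun w => ‖deriv T w / T w‖ₑ) (s + t * Complex.I) := by
    intro s hs
    have hsI : s ∈ Ioo 0 ℓ := ⟨ha.trans_lt hs.1, hs.2.trans_le hb⟩
    have hpl : Continuous fun t : ℝ => (s + t * Complex.I : ℂ) := by fun_prop
    have hS : MeasurableSet (Ico 0 (2 * Real.pi) ∩ (fun t : ℝ => (s + t * Complex.I : ℂ)) ⁻¹' O) :=
      measurableSet_Ico.inter (hO.preimage hpl).measurableSet
    -- The function is log|T|, written with the squared norm to be differentiated as an inner
    -- product. It takes all values in (0, ℓ') because the loop has a point surrounded by A' and a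
    -- point outside, hence meets every core loop of A'.
    have key := le_length (k := 1) (v := fun t : ℝ => Real.log (‖T (s + t * Complex.I)‖ ^ 2) / 2)
      (v' := fun t : ℝ => 2 * inner ℝ (T (s + t * Complex.I)) (deriv T (s + t * Complex.I) * Complex.I)
        / ‖T (s + t * Complex.I)‖ ^ 2 / 2)
      (f := fun t : ℝ => O.indicator (fun w => ‖deriv T w / T w‖ₑ) (s + t * Complex.I))
      (x := 0) (y := ℓ') hS inter_subset_left (by
        rintro t ⟨-, ht⟩
        refine HasDerivAt.div_const ?_ 2
        exact (hasDerivAt_loop (hTda _ ht)).norm_sq.log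
          (pow_ne_zero 2 (norm_ne_zero_iff.2 (hT0 _ ht)))) (by
        rintro t ⟨-, ht⟩
        have ht' : (s + t * Complex.I : ℂ) ∈ O := ht
        simp only [indicator_of_mem ht', ENNReal.ofReal_one, one_mul]
        rw [enorm_le_iff_norm_le, norm_div, norm_div, norm_mul, norm_div]
        have hp : 0 < ‖T (s + t * Complex.I)‖ := norm_pos_iff.2 (hT0 _ ht)
        have h1 := norm_inner_le_norm (𝕜 := ℝ) (T (s + t * Complex.I))
          (deriv T (s + t * Complex.I) * Complex.I)
        rw [norm_mul, Complex.norm_I, mul_one] at h1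
        simp only [norm_pow, norm_norm, Real.norm_ofNat]
        rw [div_div, div_le_div_iff₀ (by positivity) hp]
        nlinarith) (by
        intro y hy
        obtain ⟨t₀, h0⟩ := hin s hs
        obtain ⟨t₁, h1, h1'⟩ := hout s hs
        have hZ : IsPreconnected (range fun t : ℝ => Φ (s + t * Complex.I)) :=
          isPreconnected_range (H.continuous_loop hsI)
        obtain ⟨t', t, ht⟩ := H'.exists_loop_mem hZ ⟨t₀, rfl⟩ ⟨t₁, rfl⟩ h0 h1 h1' hy
        obtain ⟨τ, hτ, hτe⟩ := exists_mem_Ico_of_periodic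
          (g := fun t : ℝ => Φ (s + t * Complex.I)) (H.loop_periodic hsI) t
        simp only at ht
        rw [hτe] at ht
        have hym := mk_mem_strip hy t'
        refine ⟨τ, ⟨hτ, mk_mem_strip hsI τ, ?_⟩, ?_⟩
        · change Φ _ ∈ A'
          rw [ht]; exact H'.mem hym
        · have : T (s + τ * Complex.I) = Complex.exp (y + t' * Complex.I) := by
            simp only [hT]
            rw [ht, ← hχe _ hym, hkl _ (exp_mem_roundAnnulus.2 hym)]
          simp only [this, Complex.norm_exp, Real.log_pow, Real.log_exp]
          simp)
    simpa using key
  have h1 := length_area hm hlen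
  have h2 : ∫⁻ w in box a b, O.indicator (fun w => ‖deriv T w / T w‖ₑ) w ^ 2 ≤
      ENNReal.ofReal (2 * Real.pi * ℓ') := by
    have e1 : ∀ w, O.indicator (fun w => ‖deriv T w / T w‖ₑ) w ^ 2 =
        O.indicator (fun w => ‖deriv T w‖ₑ ^ 2 * (‖T w‖ₑ⁻¹) ^ 2) w := by
      intro w
      by_cases hw : w ∈ O
      · simp only [indicator_of_mem hw]
        rw [div_eq_mul_inv, enorm_mul, enorm_inv (hT0 w hw), mul_pow]
      · simp [hw]
    simp only [e1]
    rw [lintegral_indicator hO.measurableSet, Measure.restrict_restrict hO.measurableSet]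
    have hS : MeasurableSet (O ∩ box a b) := hO.measurableSet.inter (measurableSet_box _ _)
    have hTi : InjOn T (O ∩ box a b) := by
      intro w hw w' hw' he
      refine H.injOn_box' ha hb hw.2 hw'.2 ?_
      rw [← hke _ hw.1.2, ← hke _ hw'.1.2]
      exact congrArg χ he
    have h3 := lintegral_image_holomorphic hS (fun w hw => hTda w hw.1) hTi (fun z => (‖z‖ₑ⁻¹) ^ 2)
    rw [← h3]
    refine (lintegral_mono_set ?_).trans (lintegral_roundAnnulus H'.pos)
    rintro _ ⟨w, hw, rfl⟩
    exact hkm _ hw.1.2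
  have h3 := h1.trans (mul_le_mul_right h2 _)
  have hp := H'.pos
  rw [← ENNReal.ofReal_pow hp.le, ← ENNReal.ofReal_mul (by positivity),
    ← ENNReal.ofReal_mul (by positivity), ENNReal.ofReal_le_ofReal_iff (by positivity)] at h3
  have h4 : ℓ' * (ℓ' * (b - a)) ≤ ℓ' * (4 * Real.pi ^ 2) := by nlinarith
  exact le_of_mul_le_mul_left h4 hp

end StripMap

end GlueSpace

end

section

namespace GlueSpace

/-! ### Polynomial-like maps as branched coverings -/

theorem mem_component_of_mem_closure {F : Set ℂ} {x y : ℂ} (hx : x ∈ F)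
    (hy : y ∈ closure (connectedComponentIn F x)) (hyF : y ∈ F) : y ∈ connectedComponentIn F x := by
  have hpre : IsPreconnected (insert y (connectedComponentIn F x)) :=
    isPreconnected_connectedComponentIn.subset_closure (subset_insert _ _)
      (insert_subset hy subset_closure)
  exact hpre.subset_connectedComponentIn (mem_insert_of_mem _ (mem_connectedComponentIn hx))
    (insert_subset hyF (connectedComponentIn_subset _ _)) (mem_insert _ _)

namespace IsPolyLike

variable {d : ℕ} {g : ℂ → ℂ} {V U : Set ℂ}

theorem dom_subset_range (h : IsPolyLike d g V U) : V ⊆ U := subset_closure.trans h.closure_subset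

theorem isPreconnected_dom (h : IsPolyLike d g V U) : IsPreconnected V :=
  h.disk_dom.2.isPathConnected.isConnected.isPreconnected

theorem mapsTo_filled : MapsTo g (filled g V) (filled g V) := fun z hz j => by
  have := hz (j + 1)
  rwa [Function.iterate_succ_apply] at this

theorem isCompact_inter_preimage_closure (h : IsPolyLike d g V U) :
    IsCompact (V ∩ g ⁻¹' closure V) := h.proper _ h.closure_subset h.compact_closure

/-- The set lies in the compact preimage of the closure of V. Its closure is therefore still in V,
and by continuity g maps this closure to itself, so no orbit in the closure escapes. -/
theorem isCompact_filled (h : IsPolyLike d g V U) : IsCompact (filled g V) := by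
  have hK := h.isCompact_inter_preimage_closure
  have hsub : filled g V ⊆ V ∩ g ⁻¹' closure V := fun z hz =>
    ⟨hz 0, subset_closure (mapsTo_filled hz 0)⟩
  have hcl : closure (filled g V) ⊆ V := fun z hz =>
    (closure_minimal hsub hK.isClosed hz).1
  have hmap : MapsTo g (closure (filled g V)) (closure (filled g V)) := by
    intro z hz
    have hc : ContinuousAt g z := h.holo.continuousOn.continuousAt (h.disk_dom.1.mem_nhds (hcl hz))
    exact hc.continuousWithinAt.mem_closure hz mapsTo_filled
  refine hK.of_isClosed_subset (isClosed_of_closure_subset fun z hz j => ?_) hsub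
  exact hcl (hmap.iterate j hz)

theorem analyticAt (h : IsPolyLike d g V U) {z : ℂ} (hz : z ∈ V) : AnalyticAt ℂ g z :=
  h.holo.analyticAt (h.disk_dom.1.mem_nhds hz)

/-- If g were locally constant it would be constant on V; but the fibre of the critical value is
{0}, which is no neighbourhood. -/
theorem nhds_le_map (h : IsPolyLike d g V U) {z : ℂ} (hz : z ∈ V) : 𝓝 (g z) ≤ map g (𝓝 z) := by
  refine (h.analyticAt hz).eventually_constant_or_nhds_le_map_nhds.resolve_left fun hc => ?_
  have h1 : EqOn g (fun _ => g z) V := AnalyticOnNhd.eqOn_of_preconnected_of_eventuallyEq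
    (fun _ hy => h.analyticAt hy) (fun _ _ => analyticAt_const) h.isPreconnected_dom hz hc
  have h2 : V ⊆ {0} := fun y hy => h.fiber_crit y hy ((h1 hy).trans (h1 h.zero_mem).symm)
  have h3 := h.disk_dom.1.mem_nhds h.zero_mem
  have h4 : ∀ᶠ y in 𝓝[≠] (0 : ℂ), False := by
    filter_upwards [self_mem_nhdsWithin, nhdsWithin_le_nhds h3] with y hy hyV using hy (h2 hyV)
  exact h4.exists.elim fun _ h => h

theorem isOpen_image (h : IsPolyLike d g V U) {O : Set ℂ} (hO : IsOpen O) (hOV : O ⊆ V) :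
    IsOpen (g '' O) := by
  rw [isOpen_iff_mem_nhds]
  rintro _ ⟨w, hw, rfl⟩
  exact h.nhds_le_map (hOV hw) (image_mem_map (hO.mem_nhds hw))

theorem finite_fiber (hd : d ≠ 0) (h : IsPolyLike d g V U) {w : ℂ} (hw : w ∈ U) (hw0 : w ≠ g 0) :
    {z | z ∈ V ∧ g z = w}.Finite :=
  finite_of_ncard_ne_zero (by rw [h.fiber w hw hw0]; exact hd)

/-- A count of fibres: each of the other d - 1 preimages of g z persists in its own neighbourhood,
so two colliding points near z would give a fibre of at least d + 1 points. -/
theorem exists_injOn (hd : d ≠ 0) (h : IsPolyLike d g V U) {z : ℂ} (hz : z ∈ V) (hz0 : z ≠ 0) :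
    ∃ O, IsOpen O ∧ z ∈ O ∧ O ⊆ V ∧ InjOn g O := by
  by_contra! hcon
  have hw0 : g z ≠ g 0 := fun he => hz0 (h.fiber_crit z hz he)
  set S := {y | y ∈ V ∧ g y = g z}
  have hS : S.Finite := h.finite_fiber hd (h.mapsTo hz) hw0
  obtain ⟨N, hN, hdisj⟩ := hS.t2_separation
  set M : Set ℂ := (⋂ y ∈ S, g '' (N y ∩ V)) ∩ (U \ {g 0})
  have hM : M ∈ 𝓝 (g z) := by
    refine inter_mem ((biInter_mem hS).2 fun y hy => ?_)
      ((h.disk_range.1.sdiff isClosed_singleton).mem_nhds ⟨h.mapsTo hz, hw0⟩)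
    rw [← hy.2]
    exact h.nhds_le_map hy.1
      (image_mem_map (((hN y).2.inter h.disk_dom.1).mem_nhds ⟨(hN y).1, hy.1⟩))
  have hgc : ContinuousAt g z := (h.analyticAt hz).continuousAt
  obtain ⟨O, hOs, hO, hzO⟩ := mem_nhds_iff.1 (inter_mem (hgc.preimage_mem_nhds hM)
    (((hN z).2.inter h.disk_dom.1).mem_nhds ⟨(hN z).1, hz⟩))
  have hni := hcon O hO hzO fun y hy => (hOs hy).2.2
  simp only [InjOn, not_forall] at hni
  obtain ⟨y₁, h₁, y₂, h₂, he, hne⟩ := hni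
  have hwM : g y₁ ∈ M := (hOs h₁).1
  have hp : ∀ y ∈ S, ∃ x ∈ N y ∩ V, g x = g y₁ := fun y hy => mem_iInter₂.1 hwM.1 y hy
  choose! p hp1 hp2 using hp
  have hfin := h.finite_fiber hd hwM.2.1 (fun he => hwM.2.2 he)
  have hsub : insert y₁ (insert y₂ (p '' (S \ {z}))) ⊆ {y | y ∈ V ∧ g y = g y₁} := by
    rintro y (rfl | rfl | ⟨x, hx, rfl⟩)
    · exact ⟨(hOs h₁).2.2, rfl⟩
    · exact ⟨(hOs h₂).2.2, he.symm⟩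
    · exact ⟨(hp1 x hx.1).2, hp2 x hx.1⟩
  have hdj : ∀ x ∈ S \ {z}, ∀ y ∈ N z, p x ≠ y := by
    intro x hx y hy hxy
    have := hdisj hx.1 (show z ∈ S from ⟨hz, rfl⟩) (fun h => hx.2 h)
    exact disjoint_left.1 this (hp1 x hx.1).1 (hxy ▸ hy)
  have hpi : InjOn p (S \ {z}) := by
    intro x hx y hy hxy
    by_contra hne
    exact disjoint_left.1 (hdisj hx.1 hy.1 hne) (hp1 x hx.1).1 (hxy ▸ (hp1 y hy.1).1)
  have hfin' : (p '' (S \ {z})).Finite := (hS.subset sdiff_subset).image p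
  have hcard := ncard_le_ncard hsub hfin
  rw [h.fiber _ hwM.2.1 (fun he => hwM.2.2 he), ncard_insert_of_notMem _ (hfin'.insert _),
    ncard_insert_of_notMem _ hfin', hpi.ncard_image, ncard_sdiff_singleton_of_mem (show z ∈ S from ⟨hz, rfl⟩),
    h.fiber _ (h.mapsTo hz) hw0] at hcard
  · omega
  · rintro ⟨x, hx, hxe⟩; exact hdj x hx y₂ (hOs h₂).2.1 hxe
  · rintro (h' | ⟨x, hx, hxe⟩)
    · exact hne h'
    · exact hdj x hx y₁ (hOs h₁).2.1 hxe

theorem deriv_ne_zero (hd : d ≠ 0) (h : IsPolyLike d g V U) {z : ℂ} (hz : z ∈ V) (hz0 : z ≠ 0) :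
    deriv g z ≠ 0 := by
  obtain ⟨O, hO, hzO, hOV, hi⟩ := h.exists_injOn hd hz hz0
  exact deriv_ne_zero_of_injOn hO (h.holo.mono hOV) hi hzO

/-- Properness makes g closed, and a closed local homeomorphism with finite fibres is a covering;
local injectivity fails only at the critical point. -/
theorem isCoveringMapOn (hd : d ≠ 0) (h : IsPolyLike d g V U) :
    IsCoveringMapOn (h.mapsTo.restrict g V U) {w | (w : ℂ) ≠ g 0} := by
  have hc : Continuous (h.mapsTo.restrict g V U) := h.holo.continuousOn.mapsToRestrict h.mapsTo
  have : LocallyCompactSpace U := h.disk_range.1.locallyCompactSpace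
  have hprop : IsProperMap (h.mapsTo.restrict g V U) := by
    rw [isProperMap_iff_isCompact_preimage]
    refine ⟨hc, fun K hK => ?_⟩
    have h1 := h.proper (Subtype.val '' K) (by rintro _ ⟨y, -, rfl⟩; exact y.2)
      (hK.image continuous_subtype_val)
    rw [Subtype.isCompact_iff]
    convert h1 using 1
    ext z
    constructor
    · rintro ⟨y, hy, rfl⟩; exact ⟨y.2, _, hy, rfl⟩
    · rintro ⟨hz, y, hy, he⟩
      refine ⟨⟨z, hz⟩, ?_, rfl⟩
      have : h.mapsTo.restrict g V U ⟨z, hz⟩ = y := Subtype.ext he.symm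
      rw [mem_preimage, this]; exact hy
  refine hprop.isClosedMap.isCoveringMapOn_of_isLocalHomeomorphOn (fun w hw => ?_) ?_
  · refine Finite.of_finite_image (f := Subtype.val) ((h.finite_fiber hd w.2 hw).subset ?_)
      Subtype.val_injective.injOn
    rintro _ ⟨y, hy, rfl⟩
    exact ⟨y.2, congrArg Subtype.val hy⟩
  · rw [isLocalHomeomorphOn_iff_isOpenEmbedding_restrict]
    intro z hz
    obtain ⟨O, hO, hzO, hOV, hi⟩ := h.exists_injOn hd z.2 (fun h0 => hz (by
      change g z = g 0; rw [h0]))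
    refine ⟨Subtype.val ⁻¹' O, (hO.preimage continuous_subtype_val).mem_nhds hzO, ?_⟩
    refine .of_continuous_injective_isOpenMap (hc.comp continuous_subtype_val) ?_ ?_
    · intro x y hxy
      exact Subtype.ext (Subtype.ext (hi x.2 y.2 (congrArg Subtype.val hxy)))
    · intro B hB
      rw [h.disk_range.1.isOpenEmbedding_subtypeVal.isOpen_iff_image_isOpen]
      have h1 : IsOpen (Subtype.val '' (Subtype.val '' B : Set V)) :=
        h.disk_dom.1.isOpenMap_subtype_val _
          ((hO.preimage continuous_subtype_val).isOpenMap_subtype_val _ hB)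
      have h2 := h.isOpen_image h1 (by rintro _ ⟨y, -, rfl⟩; exact y.2)
      convert h2 using 1
      simp only [image_image]
      rfl

/-- Lifting maps of strips through the branched covering `g`. -/
theorem exists_lift (hd : d ≠ 0) (h : IsPolyLike d g V U) {ℓ : ℝ} (hℓ : 0 < ℓ) {Φ : ℂ → ℂ}
    (hΦ : ContinuousOn Φ (strip ℓ)) (hΦU : MapsTo Φ (strip ℓ) (U \ {g 0})) {w₀ e₀ : ℂ}
    (hw₀ : w₀ ∈ strip ℓ) (he₀ : e₀ ∈ V) (he : g e₀ = Φ w₀) :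
    ∃ ψ : ℂ → ℂ, ContinuousOn ψ (strip ℓ) ∧ MapsTo ψ (strip ℓ) V ∧
      ∀ w ∈ strip ℓ, g (ψ w) = Φ w := by
  classical
  have := (isSimplyConnected_strip hℓ).simplyConnectedSpace
  have := (isOpen_strip ℓ).locallyPathConnectedSpace
  obtain ⟨F, ⟨-, hF⟩, -⟩ := (h.isCoveringMapOn hd).existsUnique_continuousMap_lifts
    (A := strip ℓ) ⟨fun w => (⟨Φ w, (hΦU w.2).1⟩ : U),
      (continuousOn_iff_continuous_domRestrict.1 hΦ).subtype_mk _⟩ (a₀ := ⟨w₀, hw₀⟩)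
    (e₀ := ⟨e₀, he₀⟩) (Subtype.ext he) (fun w => (hΦU w.2).2)
  obtain ⟨ψ, hψ⟩ : ∃ ψ : ℂ → ℂ, ∀ w : strip ℓ, ψ w = F w :=
    ⟨fun w => if hw : w ∈ strip ℓ then F ⟨w, hw⟩ else 0, by simp⟩
  refine ⟨ψ, ?_, fun w hw => ?_, fun w hw => ?_⟩
  · rw [continuousOn_iff_continuous_domRestrict]
    exact (continuous_subtype_val.comp F.continuous).congr fun w => (hψ w).symm
  · rw [hψ ⟨w, hw⟩]; exact (F _).2
  · rw [hψ ⟨w, hw⟩]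
    exact congrArg Subtype.val (congrFun hF ⟨w, hw⟩)

/-- The set of agreement is closed by continuity and open because g is locally injective at
noncritical points, which is why `ψ₁` must avoid 0. -/
theorem eqOn_of_lift (hd : d ≠ 0) (h : IsPolyLike d g V U) {S : Set ℂ} (hS : IsOpen S)
    (hSp : IsPreconnected S) {ψ₁ ψ₂ : ℂ → ℂ} (h₁ : ContinuousOn ψ₁ S) (h₂ : ContinuousOn ψ₂ S)
    (hm₁ : MapsTo ψ₁ S (V \ {0})) (he : ∀ w ∈ S, g (ψ₁ w) = g (ψ₂ w))
    {w₀ : ℂ} (hw₀ : w₀ ∈ S) (h0 : ψ₁ w₀ = ψ₂ w₀) : EqOn ψ₁ ψ₂ S := by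
  have hopen : IsOpen {w | w ∈ S ∧ ψ₁ w = ψ₂ w} := by
    rw [isOpen_iff_mem_nhds]
    rintro w ⟨hw, hew⟩
    obtain ⟨O, hO, hzO, hOV, hi⟩ := h.exists_injOn hd (hm₁ hw).1 (hm₁ hw).2
    have c₁ := h₁.continuousAt (hS.mem_nhds hw)
    have c₂ := h₂.continuousAt (hS.mem_nhds hw)
    filter_upwards [hS.mem_nhds hw, c₁.preimage_mem_nhds (hO.mem_nhds hzO),
      c₂.preimage_mem_nhds (hO.mem_nhds (hew ▸ hzO))] with y hy hy1 hy2
    exact ⟨hy, hi hy1 hy2 (he y hy)⟩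
  have := hSp.subset_of_closure_inter_subset hopen ⟨w₀, hw₀, hw₀, h0⟩ (by
    rintro y ⟨hy, hyS⟩
    refine ⟨hyS, ?_⟩
    rw [mem_closure_iff_clusterPt] at hy
    have c₁ := h₁.continuousAt (hS.mem_nhds hyS)
    have c₂ := h₂.continuousAt (hS.mem_nhds hyS)
    have : (𝓝 y ⊓ 𝓟 ({w | w ∈ S ∧ ψ₁ w = ψ₂ w} : Set ℂ)).NeBot := hy
    refine tendsto_nhds_unique (l := 𝓝 y ⊓ 𝓟 ({w | w ∈ S ∧ ψ₁ w = ψ₂ w} : Set ℂ)) (c₁.tendsto.mono_left inf_le_left)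
      ((c₂.tendsto.mono_left inf_le_left).congr' ?_)
    exact mem_inf_of_right fun w hw => hw.2.symm)
  exact fun w hw => (this hw).2

/-- `g - g 0` is a power of `z` times a function with a logarithm. -/
theorem exists_eq_pow_mul_exp (h : IsPolyLike d g V U) : ∃ (n : ℕ) (l : ℂ → ℂ), ContinuousOn l V ∧
    ∀ z ∈ V, g z - g 0 = z ^ n * Complex.exp (l z) := by
  classical
  have hnz : ¬ ∀ᶠ z in 𝓝 (0 : ℂ), g z - g 0 = 0 := by
    intro hc
    have h4 : ∀ᶠ y in 𝓝[≠] (0 : ℂ), False := by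
      filter_upwards [self_mem_nhdsWithin, nhdsWithin_le_nhds (h.disk_dom.1.mem_nhds h.zero_mem),
        nhdsWithin_le_nhds hc] with y hy hyV h0 using hy (h.fiber_crit y hyV (sub_eq_zero.1 h0))
    exact h4.exists.elim fun _ h => h
  obtain ⟨n, u, hu, hu0, he⟩ :=
    ((h.analyticAt h.zero_mem).sub analyticAt_const).exists_eventuallyEq_pow_smul_nonzero_iff.2 hnz
  -- Dividing out the zero at 0 leaves a nowhere vanishing continuous function, as 0 is the only
  -- point over g 0; it has a logarithm on the simply connected V.
  set v : ℂ → ℂ := fun z => if z = 0 then u 0 else (g z - g 0) / z ^ n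
  have hveq : v =ᶠ[𝓝 0] u := by
    filter_upwards [he] with z hz
    by_cases hz0 : z = 0
    · simp [v, hz0]
    · simp only [v, if_neg hz0]
      have hz' : g z - g 0 = z ^ n * u z := by simpa using hz
      rw [hz']; field_simp
  have hvc : ContinuousOn v V := by
    intro z hz
    apply ContinuousAt.continuousWithinAt
    by_cases hz0 : z = 0
    · subst hz0
      exact hu.continuousAt.congr hveq.symm
    · have : ContinuousAt (fun z => (g z - g 0) / z ^ n) z :=
        ((h.analyticAt hz).continuousAt.sub continuousAt_const).div (by fun_prop) (pow_ne_zero _ hz0)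
      refine this.congr ?_
      filter_upwards [isOpen_ne.mem_nhds hz0] with y hy
      simp only [v, if_neg hy]
  have hv0 : ∀ z ∈ V, v z ≠ 0 := by
    intro z hz
    by_cases hz0 : z = 0
    · simpa [v, hz0] using hu0
    · simp only [v, if_neg hz0]
      exact div_ne_zero (sub_ne_zero.2 fun he => hz0 (h.fiber_crit z hz he)) (pow_ne_zero _ hz0)
  obtain ⟨l, hl, hle⟩ := Complex.exists_continuousOn_eqOn_exp_comp h.disk_dom.2 h.disk_dom.1 hvc
    (by rintro ⟨z, hz, h0⟩; exact hv0 z hz h0)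
  refine ⟨n, l, hl, fun z hz => ?_⟩
  have : Complex.exp (l z) = v z := hle hz
  rw [this]
  by_cases hz0 : z = 0
  · subst hz0
    have := he.self_of_nhds
    simpa [v] using this
  · simp only [v, if_neg hz0]; field_simp

/-- The preimage of the domain under `g` is connected when it contains the critical point. -/
theorem isPreconnected_preimage (h : IsPolyLike d g V U) (h0 : g 0 ∈ V) :
    IsPreconnected {z | z ∈ V ∧ g z ∈ V} := by
  set W := {z | z ∈ V ∧ g z ∈ V}
  have hW : IsOpen W := h.holo.continuousOn.isOpen_inter_preimage h.disk_dom.1 h.disk_dom.1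
  have key : ∀ z ∈ W, (0 : ℂ) ∈ connectedComponentIn W z := by
    intro z hz
    set C := connectedComponentIn W z
    have hCW : C ⊆ W := connectedComponentIn_subset _ _
    -- The image of a component is open and, by properness, relatively closed in V, hence all of V.
    -- So every component contains a preimage of the critical value, and this can only be 0.
    have hsub := h.isPreconnected_dom.subset_of_closure_inter_subset
      (h.isOpen_image hW.connectedComponentIn fun y hy => (hCW hy).1)
      ⟨g z, hz.2, z, mem_connectedComponentIn hz, rfl⟩ (by
        rintro y ⟨hy, hyV⟩
        obtain ⟨T, hT, hTV, hTc⟩ := local_compact_nhds (h.disk_dom.1.mem_nhds hyV)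
        have hc := h.proper T (hTV.trans h.dom_subset_range) hTc
        have hc2 : IsCompact (g '' (closure C ∩ (V ∩ g ⁻¹' T))) :=
          (hc.inter_left isClosed_closure).image_of_continuousOn
            (h.holo.continuousOn.mono fun x hx => hx.2.1)
        have hy2 : y ∈ closure (g '' C ∩ T) := by
          rw [mem_closure_iff_nhds] at hy ⊢
          intro N hN
          obtain ⟨x, hx, hx'⟩ := hy (N ∩ T) (inter_mem hN hT)
          exact ⟨x, hx.1, hx', hx.2⟩
        have hy3 : y ∈ g '' (closure C ∩ (V ∩ g ⁻¹' T)) := by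
          refine closure_minimal ?_ hc2.isClosed hy2
          rintro _ ⟨⟨x, hx, rfl⟩, hxT⟩
          exact ⟨x, ⟨subset_closure hx, (hCW hx).1, hxT⟩, rfl⟩
        obtain ⟨x, ⟨hxC, hxV, -⟩, rfl⟩ := hy3
        exact ⟨x, mem_component_of_mem_closure hz hxC ⟨hxV, hyV⟩, rfl⟩)
    obtain ⟨y, hy, hye⟩ := hsub h0
    rwa [h.fiber_crit y (hCW hy).1 hye] at hy
  have h0W : (0 : ℂ) ∈ W := ⟨h.zero_mem, h0⟩
  have : W = connectedComponentIn W 0 := by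
    refine Subset.antisymm (fun z hz => ?_) (connectedComponentIn_subset _ _)
    rw [← connectedComponentIn_eq (key z hz)]
    exact mem_connectedComponentIn hz
  rw [this]
  exact isPreconnected_connectedComponentIn

/-- Pulling back a ring domain around `V` by the branched covering `g`. -/
theorem exists_ring_pullback (hd : d ≠ 0) (h : IsPolyLike d g V U) (h0 : g 0 ∈ V) {A : Set ℂ} {m : ℝ}
    (hA : IsRing A m) (hAU : A ⊆ U \ V) (hVA : V ⊆ surrounded A) :
    ∃ A' m', IsRing A' m' ∧ m ≤ d * m' ∧ A' ⊆ V \ {z | z ∈ V ∧ g z ∈ V} ∧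
      {z | z ∈ V ∧ g z ∈ V} ⊆ surrounded A' := by
  obtain ⟨Φ, H⟩ := hA.exists_stripMap
  set ℓ := 2 * Real.pi * m with hℓ
  have hpi := Real.pi_pos
  have hΦU : MapsTo Φ (strip ℓ) (U \ {g 0}) := fun w hw =>
    ⟨(hAU (H.mem hw)).1, fun he => (hAU (H.mem hw)).2 (by rw [he]; exact h0)⟩
  have hw₀ : ((ℓ / 2 : ℝ) : ℂ) ∈ strip ℓ := by
    have := H.pos
    simp [strip, this]
  set w₀ : ℂ := ((ℓ / 2 : ℝ) : ℂ)
  have hfib := h.fiber _ (hΦU hw₀).1 (hΦU hw₀).2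
  obtain ⟨e₀, he₀, hee⟩ : {z | z ∈ V ∧ g z = Φ w₀}.Nonempty := by
    rw [← ncard_pos (h.finite_fiber hd (hΦU hw₀).1 (hΦU hw₀).2), hfib]; omega
  obtain ⟨ψ, hψc, hψV, hψe⟩ := h.exists_lift hd H.pos H.holo.continuousOn hΦU hw₀ he₀ hee
  have hψ0 : MapsTo ψ (strip ℓ) (V \ {0}) := fun w hw => ⟨hψV hw, fun hz => (hΦU hw).2 (by
    rw [← hψe w hw, show ψ w = 0 from hz]; rfl)⟩
  have hshift : ∀ (i j : ℤ) (w : ℂ), w ∈ strip ℓ →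
      ψ (w + i * (2 * Real.pi * Complex.I)) = ψ (w + j * (2 * Real.pi * Complex.I)) →
      ∀ w ∈ strip ℓ, ψ (w + i * (2 * Real.pi * Complex.I)) = ψ (w + j * (2 * Real.pi * Complex.I)) := by
    intro i j w hw he
    exact h.eqOn_of_lift hd (isOpen_strip ℓ) (convex_strip ℓ).isPreconnected
      (ψ₁ := fun w => ψ (w + i * (2 * Real.pi * Complex.I)))
      (ψ₂ := fun w => ψ (w + j * (2 * Real.pi * Complex.I)))
      (hψc.comp (by fun_prop) fun w hw => add_mem_strip hw i)
      (hψc.comp (by fun_prop) fun w hw => add_mem_strip hw j)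
      (fun w hw => hψ0 (add_mem_strip hw i)) (fun w hw => by
        simp only [hψe _ (add_mem_strip hw _), H.apply_add_int hw]) hw he
  -- Pigeonhole: the d + 1 values of ψ at w₀ + 2πi·j, 0 ≤ j ≤ d, lie in one fibre of d points. Two
  -- of them coincide, and translates of ψ that agree at a point agree everywhere.
  have hex : ∃ k : ℕ, 0 < k ∧ k ≤ d ∧ ∀ w ∈ strip ℓ, ψ (w + k * (2 * Real.pi * Complex.I)) = ψ w := by
    obtain ⟨i, hi, j, hj, hij, he⟩ := Finset.exists_ne_map_eq_of_card_lt_of_maps_to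
      (s := Finset.range (d + 1)) (t := (h.finite_fiber hd (hΦU hw₀).1 (hΦU hw₀).2).toFinset)
      (by rw [← ncard_eq_toFinset_card _ (h.finite_fiber hd (hΦU hw₀).1 (hΦU hw₀).2), hfib,
            Finset.card_range]; omega)
      (f := fun i : ℕ => ψ (w₀ + (i : ℤ) * (2 * Real.pi * Complex.I))) (by
        intro i _
        simp only [Finite.coe_toFinset]
        exact ⟨hψV (add_mem_strip hw₀ i), by
          rw [hψe _ (add_mem_strip hw₀ i), H.apply_add_int hw₀]⟩)
    rw [Finset.mem_range] at hi hj
    have main : ∀ i j : ℕ, i < j → j < d + 1 → ψ (w₀ + (i : ℤ) * (2 * Real.pi * Complex.I)) =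
        ψ (w₀ + (j : ℤ) * (2 * Real.pi * Complex.I)) →
        ∃ k : ℕ, 0 < k ∧ k ≤ d ∧ ∀ w ∈ strip ℓ, ψ (w + k * (2 * Real.pi * Complex.I)) = ψ w := by
      intro i j hij hj he
      refine ⟨j - i, by omega, by omega, fun w hw => ?_⟩
      have := hshift i j w₀ hw₀ he _ (add_mem_strip hw (-i))
      have e1 : w + ((-i : ℤ) : ℂ) * (2 * Real.pi * Complex.I) + (i : ℤ) * (2 * Real.pi * Complex.I) = w := by
        push_cast; ring
      have e2 : w + ((-i : ℤ) : ℂ) * (2 * Real.pi * Complex.I) + (j : ℤ) * (2 * Real.pi * Complex.I) =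
          w + ((j - i : ℕ) : ℂ) * (2 * Real.pi * Complex.I) := by
        rw [Nat.cast_sub hij.le]; push_cast; ring
      rw [e1, e2] at this
      exact this.symm
    rcases lt_or_gt_of_ne hij with hlt | hlt
    · exact main i j hlt hj he
    · exact main j i hlt hi he.symm
  classical
  -- The smallest period k is taken, so that ψ identifies only points differing by multiples of
  -- 2πik.
  have hex' : ∃ k : ℕ, 0 < k ∧ ∀ w ∈ strip ℓ, ψ (w + k * (2 * Real.pi * Complex.I)) = ψ w := by
    obtain ⟨k, h1, -, h2⟩ := hex; exact ⟨k, h1, h2⟩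
  obtain ⟨hk0, hkper⟩ := Nat.find_spec hex'
  have hkd : Nat.find hex' ≤ d := by
    obtain ⟨k, h1, h2, h3⟩ := hex
    exact (Nat.find_min' hex' ⟨h1, h3⟩).trans h2
  have hmin : ∀ r : ℕ, r < Nat.find hex' → (∀ w ∈ strip ℓ, ψ (w + r * (2 * Real.pi * Complex.I)) = ψ w) →
      r = 0 := by
    intro r hr hper
    by_contra hr0
    exact Nat.find_min hex' hr ⟨Nat.pos_of_ne_zero hr0, hper⟩
  set k := Nat.find hex'
  have hkper' : ∀ (q : ℤ), ∀ w ∈ strip ℓ, ψ (w + (k * q : ℤ) * (2 * Real.pi * Complex.I)) = ψ w := by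
    intro q
    induction q with
    | zero => simp
    | succ q ih =>
      intro w hw
      rw [← ih w hw, ← hkper _ (add_mem_strip hw (k * q))]
      congr 1; push_cast; ring
    | pred q ih =>
      intro w hw
      rw [← ih w hw, ← hkper _ (add_mem_strip hw _)]
      congr 1; push_cast; ring
  have hψd : DifferentiableOn ℂ ψ (strip ℓ) := by
    intro w hw
    refine (differentiableAt_of_lift (hψc.continuousAt ((isOpen_strip ℓ).mem_nhds hw))
      (h.analyticAt (hψV hw)) (h.deriv_ne_zero hd (hψV hw) (hψ0 hw).2)
      (H.analyticAt hw).differentiableAt ?_).differentiableWithinAt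
    filter_upwards [(isOpen_strip ℓ).mem_nhds hw] with y hy using hψe y hy
  have hkR : (0 : ℝ) < k := by exact_mod_cast hk0
  have hkC : (k : ℂ) ≠ 0 := by exact_mod_cast hk0.ne'
  have hsc : ∀ w ∈ strip (ℓ / k), (k : ℂ) * w ∈ strip ℓ := by
    rintro w ⟨h1, h2⟩
    rw [lt_div_iff₀ hkR] at h2
    have hre : ((k : ℂ) * w).re = k * w.re := by simp
    refine ⟨?_, ?_⟩
    · rw [hre]; positivity
    · rw [hre]; linarith
  -- Rescaling by k turns the period 2πik into 2πi and the width ℓ into ℓ/k; this is the loss of a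
  -- factor k ≤ d in the modulus.
  have H' : StripMap (fun w => ψ (k * w)) (ℓ / k) ((fun w => ψ (k * w)) '' strip (ℓ / k)) := by
    refine ⟨div_pos H.pos hkR, hψd.comp (by fun_prop) hsc, fun w hw => ?_, fun w hw w' hw' he => ?_, rfl⟩
    · rw [mul_add, hkper _ (hsc w hw)]
    · have he' : Φ (k * w) = Φ (k * w') := by
        rw [← hψe _ (hsc w hw), ← hψe _ (hsc w' hw'), he]
      obtain ⟨j, hj⟩ := H.inj _ (hsc w hw) _ (hsc w' hw') he'
      have hjper : ∀ v ∈ strip ℓ, ψ (v + j * (2 * Real.pi * Complex.I)) = ψ v := by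
        have := hshift j 0 (k * w') (hsc w' hw') (by rw [← hj, he]; simp)
        simpa using this
      have hr : (j % k).toNat = 0 := by
        have hk0' : (k : ℤ) ≠ 0 := by exact_mod_cast hk0.ne'
        have hnn := Int.emod_nonneg j hk0'
        refine hmin _ ?_ fun v hv => ?_
        · have := Int.emod_lt_of_pos j (b := (k : ℤ)) (by exact_mod_cast hk0)
          omega
        · have h1 : (((j % k).toNat : ℕ) : ℂ) = (j : ℂ) + ((k * (-(j / k)) : ℤ) : ℂ) := by
            have h2 : (((j % k).toNat : ℕ) : ℤ) = j + k * (-(j / k)) := by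
              rw [Int.toNat_of_nonneg hnn, Int.emod_def]; ring
            exact_mod_cast h2
          rw [h1, add_mul, ← add_assoc, hkper' _ _ (add_mem_strip hv j), hjper v hv]
      have hdvd : (k : ℤ) ∣ j := by
        have hnn := Int.emod_nonneg j (b := (k : ℤ)) (by exact_mod_cast hk0.ne')
        exact Int.dvd_of_emod_eq_zero (by omega)
      obtain ⟨q, rfl⟩ := hdvd
      refine ⟨q, mul_left_cancel₀ hkC ?_⟩
      rw [hj]; push_cast; ring
  set A' := (fun w => ψ (k * w)) '' strip (ℓ / k)
  have hA'V : A' ⊆ V \ {z | z ∈ V ∧ g z ∈ V} := by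
    rintro _ ⟨w, hw, rfl⟩
    refine ⟨hψV (hsc w hw), fun hW => ?_⟩
    have hW2 : g (ψ (k * w)) ∈ V := hW.2
    rw [hψe _ (hsc w hw)] at hW2
    exact (hAU (H.mem (hsc w hw))).2 hW2
  have h0W : (0 : ℂ) ∈ {z | z ∈ V ∧ g z ∈ V} := ⟨h.zero_mem, h0⟩
  have h0A' : (0 : ℂ) ∉ A' := fun hA' => (hA'V hA').2 h0W
  have hs : ℓ / k / 2 ∈ Ioo 0 (ℓ / k) := by
    have := H'.pos
    constructor <;> linarith
  -- If the lifted loop had winding number 0 about 0, its image under g would have winding number 0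
  -- about g 0. But that image is a loop of A run k times, and A surrounds g 0.
  have h0s : (0 : ℂ) ∈ surrounded A' := by
    refine H'.mem_surrounded h0A' hs fun hw0 => ?_
    obtain ⟨n, l, hl, hle⟩ := h.exists_eq_pow_mul_exp
    set σ : ℝ → ℂ := fun t => ψ (k * ((ℓ / k / 2 : ℝ) + t * Complex.I)) with hσ
    have hσV : ∀ t, σ t ∈ V := fun t => hψV (hsc _ (StripMap.mk_mem_strip hs t))
    have hσc : Continuous σ := H'.continuous_loop hs
    have hσp : ∀ t, σ (t + 2 * Real.pi) = σ t := H'.loop_periodic hs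
    simp only [sub_zero] at hw0
    have h1 := (Winds.pow hw0 n).mul (winds_exp_comp (l := fun t => l (σ t))
      (hl.comp_continuous hσc hσV) fun t => by rw [hσp])
    have hs2 : (k : ℝ) * (ℓ / k / 2) ∈ Ioo 0 ℓ := by
      rw [show (k : ℝ) * (ℓ / k / 2) = ℓ / 2 by field_simp]
      have := H.pos
      constructor <;> linarith
    obtain ⟨n₀, hn₀⟩ := H.exists_winds hs2 (x := g 0) fun t he =>
      (hΦU (StripMap.mk_mem_strip hs2 t)).2 he
    have h2 := hn₀.comp_mul k
    have h3 : Winds (fun t => Φ ((k * (ℓ / k / 2) : ℝ) + (k * t : ℝ) * Complex.I) - g 0)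
        (n * 0 + 0) := by
      convert h1 using 2 with t
      have : (((k * (ℓ / k / 2) : ℝ) : ℂ) + (k * t : ℝ) * Complex.I) =
          k * ((ℓ / k / 2 : ℝ) + t * Complex.I) := by push_cast; ring
      rw [this, ← hψe _ (hsc _ (StripMap.mk_mem_strip hs t))]
      exact hle _ (hσV t)
    have h4 := h2.unique h3
    have h5 : n₀ = 0 := by
      have hk0' : (k : ℤ) ≠ 0 := by exact_mod_cast hk0.ne'
      have : (k : ℤ) * n₀ = 0 := by simpa using h4
      exact (mul_eq_zero.1 this).resolve_left hk0'
    rw [h5] at hn₀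
    exact H.not_winds_zero (hVA h0) hs2 hn₀
  refine ⟨A', _, H'.isRing, ?_, hA'V, fun w hw => ⟨fun h' => (hA'V h').2 hw, h0s.2.subset ?_⟩⟩
  · have hkd' : (k : ℝ) ≤ d := by exact_mod_cast hkd
    have hm := hA.1
    have : (d : ℝ) * (ℓ / k / (2 * Real.pi)) = d / k * m := by rw [hℓ]; field_simp
    rw [this]
    have h1 : 1 ≤ (d : ℝ) / k := by rwa [le_div_iff₀ hkR, one_mul]
    nlinarith
  · have hsub : {z | z ∈ V ∧ g z ∈ V} ⊆ A'ᶜ := fun y hy h' => (hA'V h').2 hy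
    rw [connectedComponentIn_eq ((h.isPreconnected_preimage h0).subset_connectedComponentIn h0W hsub hw)]

/-- The annulus between the preimage of `V` and `V` covers the annulus between `V` and `U`. -/
theorem annMod_le (hd : d ≠ 0) (h : IsPolyLike d g V U) (h0 : g 0 ∈ V) :
    annMod U V ≤ d * annMod V {z | z ∈ V ∧ g z ∈ V} := by
  refine iSup_le fun A => iSup_le fun m => iSup_le fun ⟨hA, hAU, hVA⟩ => ?_
  obtain ⟨A', m', hA', hm, hA'V, hW⟩ := h.exists_ring_pullback hd h0 hA hAU hVA
  calc ENNReal.ofReal m ≤ ENNReal.ofReal (d * m') := ENNReal.ofReal_le_ofReal hm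
    _ = d * ENNReal.ofReal m' := by
      rw [ENNReal.ofReal_mul (by positivity), ENNReal.ofReal_natCast]
    _ ≤ _ := by
      gcongr
      exact le_iSup_of_le A' (le_iSup_of_le m' (le_iSup_of_le ⟨hA', hA'V, hW⟩ le_rfl))

end IsPolyLike

theorem annMod_anti {U X Y : Set ℂ} (h : X ⊆ Y) : annMod U Y ≤ annMod U X := by
  refine iSup_le fun A => iSup_le fun m => iSup_le fun ⟨hA, hAU, hVA⟩ => ?_
  exact le_iSup_of_le A (le_iSup_of_le m (le_iSup_of_le
    ⟨hA, hAU.trans (sdiff_subset_sdiff_right h), h.trans hVA⟩ le_rfl))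

end GlueSpace

end

section

namespace GlueSpace

/-! ### Unicritical polynomials -/

variable {d : ℕ} {c : ℂ}

theorem P_mem_filledJulia {z : ℂ} : P d c z ∈ filledJulia d c ↔ z ∈ filledJulia d c := by
  have h := tendsto_add_atTop_iff_nat (f := fun n : ℕ => (P d c)^[n] z)
    (l := Bornology.cobounded ℂ) 1
  simp only [Function.iterate_succ_apply] at h
  exact not_congr h

theorem iterate_mem_filledJulia {z : ℂ} (n : ℕ) :
    (P d c)^[n] z ∈ filledJulia d c ↔ z ∈ filledJulia d c := by
  induction n with
  | zero => simp
  | succ n ih => rw [Function.iterate_succ_apply', P_mem_filledJulia, ih]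

theorem mem_filledJulia_of_bounded {z : ℂ} {C : ℝ} (h : ∀ n : ℕ, ‖(P d c)^[n] z‖ ≤ C) :
    z ∈ filledJulia d c := by
  intro ht
  have h1 := tendsto_norm_atTop_iff_cobounded.2 ht
  obtain ⟨n, hn⟩ := (h1.eventually_gt_atTop C).exists
  exact absurd (h n) (not_le.2 hn)

theorem norm_P_ge (hd : 2 ≤ d) {w : ℂ} (h1 : 1 ≤ ‖w‖) (hc : ‖c‖ ≤ ‖w‖) :
    ‖w‖ * (‖w‖ - 1) ≤ ‖P d c w‖ := by
  have h2 : ‖w ^ d‖ - ‖c‖ ≤ ‖P d c w‖ := by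
    have := norm_sub_le (w ^ d + c) c
    simp only [add_sub_cancel_right] at this
    unfold P; linarith
  have h3 : ‖w‖ ^ 2 ≤ ‖w ^ d‖ := by rw [norm_pow]; exact pow_le_pow_right₀ h1 hd
  nlinarith

theorem not_mem_filledJulia (hd : 2 ≤ d) {z : ℂ} (hz : 2 < ‖z‖) (hc : ‖c‖ ≤ ‖z‖) :
    z ∉ filledJulia d c := by
  intro h
  refine h (tendsto_norm_atTop_iff_cobounded.1 ?_)
  have key : ∀ n : ℕ, ‖z‖ * (‖z‖ - 1) ^ n ≤ ‖(P d c)^[n] z‖ := by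
    intro n
    induction n with
    | zero => simp
    | succ n ih =>
      have h1 : 1 ≤ (‖z‖ - 1) ^ n := one_le_pow₀ (by linarith)
      have h2 : ‖z‖ ≤ ‖(P d c)^[n] z‖ := le_trans (by nlinarith) ih
      rw [Function.iterate_succ_apply']
      refine le_trans ?_ (norm_P_ge hd (by linarith) (hc.trans h2))
      rw [pow_succ, ← mul_assoc]
      exact mul_le_mul ih (by linarith) (by linarith) (norm_nonneg _)
  refine tendsto_atTop_mono key ?_
  exact (tendsto_pow_atTop_atTop_of_one_lt (by linarith)).const_mul_atTop (by linarith)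

/-- The critical value c is itself nonescaping, so |c| ≤ 2; then every point of norm greater than 2
escapes. -/
theorem filledJulia_subset_closedBall (hd : 2 ≤ d) (h0 : (0 : ℂ) ∈ filledJulia d c) :
    filledJulia d c ⊆ Metric.closedBall 0 2 := by
  have hcJ : c ∈ filledJulia d c := by
    have := P_mem_filledJulia.2 h0
    simpa [P, show d ≠ 0 by omega] using this
  have hc2 : ‖c‖ ≤ 2 := by
    by_contra! h
    exact not_mem_filledJulia hd h le_rfl hcJ
  intro z hz
  rw [mem_closedBall_zero_iff]
  by_contra! h
  exact not_mem_filledJulia hd h (hc2.trans h.le) hz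

/-! ### The Böttcher coordinate -/

namespace IsBottcher

variable {B : ℂ → ℂ}

theorem openEmb (hB : IsBottcher d c B) (hJ : IsCompact (filledJulia d c)) :
    OpenEmb B (filledJulia d c)ᶜ := by
  refine ⟨hB.holo.continuousOn, hB.bij.injOn, fun O hOs hO => isOpen_iff_mem_nhds.2 ?_⟩
  rintro _ ⟨z, hz, rfl⟩
  exact nhds_le_map_of_injOn hJ.isClosed.isOpen_compl hB.holo hB.bij.injOn (hOs hz)
    (image_mem_map (hO.mem_nhds hz))

theorem eventually_notMem (hJ : IsCompact (filledJulia d c)) :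
    ∀ᶠ z in Bornology.cobounded ℂ, z ∉ filledJulia d c :=
  hJ.isBounded

/-- Points where the Böttcher coordinate is large are large. -/
theorem exists_lt_norm (hB : IsBottcher d c B) (hJ : IsCompact (filledJulia d c)) (R : ℝ) :
    ∃ ρ : ℝ, ∀ z ∉ filledJulia d c, ρ < ‖B z‖ → R < ‖z‖ := by
  classical
  -- In the coordinate at infinity B extends holomorphically over 0 and is open there, so large
  -- values of B are taken at large points, and by injectivity only there.
  set G : ℂ → ℂ := fun ζ => if ζ = 0 then 0 else (B ζ⁻¹)⁻¹ with hG
  have hinv : Tendsto (fun ζ : ℂ => ζ⁻¹) (𝓝[≠] 0) (Bornology.cobounded ℂ) :=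
    tendsto_inv₀_nhdsNE_zero
  have hE : ∀ᶠ ζ in 𝓝[≠] (0 : ℂ), ζ⁻¹ ∉ filledJulia d c := hinv.eventually (eventually_notMem hJ)
  have hB0 : ∀ z ∉ filledJulia d c, B z ≠ 0 := by
    intro z hz h0
    have : 1 < ‖B z‖ := hB.bij.mapsTo hz
    simp [h0] at this; linarith
  have hGne : ∀ᶠ ζ in 𝓝[≠] (0 : ℂ), G ζ ≠ 0 := by
    filter_upwards [hE, self_mem_nhdsWithin] with ζ hζ hζ0
    have : ζ ≠ 0 := hζ0
    simp only [hG, if_neg this]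
    exact inv_ne_zero (hB0 _ hζ)
  have hGd : ∀ᶠ ζ in 𝓝[≠] (0 : ℂ), DifferentiableAt ℂ G ζ := by
    filter_upwards [hE, self_mem_nhdsWithin] with ζ hζ hζ0
    have hζ0' : ζ ≠ 0 := hζ0
    have h1 : DifferentiableAt ℂ (fun ζ => (B ζ⁻¹)⁻¹) ζ := by
      refine DifferentiableAt.fun_inv ?_ (hB0 _ hζ)
      exact DifferentiableAt.fun_comp' ζ
        (hB.holo.differentiableAt (hJ.isClosed.isOpen_compl.mem_nhds hζ)) (differentiableAt_inv hζ0')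
    refine h1.congr_of_eventuallyEq ?_
    filter_upwards [isOpen_ne.mem_nhds hζ0'] with y hy
    simp only [hG, if_neg hy]
  have hGc : ContinuousAt G 0 := by
    rw [continuousAt_iff_punctured_nhds]
    have h1 : Tendsto (fun ζ : ℂ => ζ * (B ζ⁻¹ / ζ⁻¹)⁻¹) (𝓝[≠] 0) (𝓝 (0 * 1⁻¹)) :=
      (tendsto_id.mono_left nhdsWithin_le_nhds).mul ((hB.tangent.comp hinv).inv₀ one_ne_zero)
    rw [zero_mul] at h1
    have h2 : G 0 = 0 := by simp [hG]
    rw [h2]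
    refine h1.congr' ?_
    filter_upwards [self_mem_nhdsWithin] with ζ hζ0
    have hζ0' : ζ ≠ 0 := hζ0
    simp only [hG, if_neg hζ0']
    field_simp
  have hGa := Complex.analyticAt_of_differentiable_on_punctured_nhds_of_continuousAt hGd hGc
  have hopen : 𝓝 (G 0) ≤ map G (𝓝 0) := by
    refine hGa.eventually_constant_or_nhds_le_map_nhds.resolve_left fun hc => ?_
    have h0 : G 0 = 0 := by simp [hG]
    rw [h0] at hc
    obtain ⟨ζ, h1, h2⟩ := ((hc.filter_mono nhdsWithin_le_nhds).and hGne).exists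
    exact h2 h1
  have hN : ∀ᶠ ζ in 𝓝 (0 : ℂ), ζ ≠ 0 → (ζ⁻¹ ∉ filledJulia d c ∧ R < ‖ζ⁻¹‖) := by
    have h1 := hE.and (hinv.eventually (tendsto_norm_cobounded_atTop.eventually_gt_atTop R))
    exact eventually_nhdsWithin_iff.1 h1
  have h3 := hopen (image_mem_map hN)
  rw [show G 0 = 0 by simp [hG]] at h3
  obtain ⟨δ, hδ, hball⟩ := Metric.mem_nhds_iff.1 h3
  refine ⟨δ⁻¹, fun z hz hρ => ?_⟩
  have hm : (B z)⁻¹ ∈ Metric.ball (0 : ℂ) δ := by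
    rw [mem_ball_zero_iff, norm_inv]
    exact inv_lt_of_inv_lt₀ hδ hρ
  obtain ⟨ζ, hζ, he⟩ := hball hm
  have hζ0 : ζ ≠ 0 := by
    rintro rfl
    simp only [hG, if_true] at he
    exact inv_ne_zero (hB0 z hz) he.symm
  obtain ⟨h4, h5⟩ := hζ hζ0
  simp only [hG, if_neg hζ0] at he
  rwa [hB.bij.injOn h4 hz (inv_injective he)] at h5

/-- The modulus of the Böttcher coordinate tends to `1` at the filled Julia set. -/
theorem eventually_norm_lt (hB : IsBottcher d c B) (hJ : IsCompact (filledJulia d c)) {y : ℂ}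
    (hy : y ∈ filledJulia d c) {r : ℝ} (hr : 1 < r) :
    ∀ᶠ z in 𝓝 y, z ∉ filledJulia d c → ‖B z‖ < r := by
  obtain ⟨ρ, hρ⟩ := hB.exists_lt_norm hJ (‖y‖ + 1)
  have hcont := (hB.openEmb hJ).continuousOn_inv hJ.isClosed.isOpen_compl
  rw [hB.bij.image_eq] at hcont
  set k := Function.invFunOn B (filledJulia d c)ᶜ
  -- Values with r ≤ |B| ≤ ρ have a compact preimage that misses y, while values beyond ρ occur only
  -- at points of norm greater than |y| + 1.
  have hC : IsCompact {w : ℂ | r ≤ ‖w‖ ∧ ‖w‖ ≤ ρ} := by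
    refine (isCompact_closedBall (0 : ℂ) ρ).of_isClosed_subset
      ((isClosed_le continuous_const continuous_norm).inter
        (isClosed_le continuous_norm continuous_const)) ?_
    intro w hw; simpa using hw.2
  have hC' := hC.image_of_continuousOn (hcont.mono fun w hw => hr.trans_le hw.1)
  have hyC : y ∉ k '' {w : ℂ | r ≤ ‖w‖ ∧ ‖w‖ ≤ ρ} := by
    rintro ⟨w, hw, rfl⟩
    have : w ∈ B '' (filledJulia d c)ᶜ := by rw [hB.bij.image_eq]; exact hr.trans_le hw.1
    exact Function.invFunOn_mem this hy
  filter_upwards [hC'.isClosed.isOpen_compl.mem_nhds hyC, Metric.ball_mem_nhds y one_pos] with z hz hzb hzJ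
  by_contra! hrz
  refine hz ⟨B z, ⟨hrz, ?_⟩, hB.bij.injOn.leftInvOn_invFunOn hzJ⟩
  by_contra! hρz
  have h1 := hρ z hzJ hρz
  have h2 := norm_sub_norm_le z y
  rw [Metric.mem_ball, dist_eq_norm] at hzb
  linarith

theorem isPreconnected_compl (hB : IsBottcher d c B) (hJ : IsCompact (filledJulia d c)) :
    IsPreconnected (filledJulia d c)ᶜ := by
  have hcont := (hB.openEmb hJ).continuousOn_inv hJ.isClosed.isOpen_compl
  rw [hB.bij.image_eq] at hcont
  have h1 : {w : ℂ | 1 < ‖w‖} = Complex.exp '' {w | 0 < w.re} := by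
    ext w
    constructor
    · intro hw
      have hw' : 1 < ‖w‖ := hw
      have h0 : w ≠ 0 := by rintro rfl; simp at hw'; linarith
      exact ⟨Complex.log w, by simpa [Complex.log_re] using Real.log_pos hw', Complex.exp_log h0⟩
    · rintro ⟨v, hv, rfl⟩
      have hv' : 0 < v.re := hv
      change 1 < ‖Complex.exp v‖
      simpa [Complex.norm_exp] using hv'
  have h2 : IsPreconnected {w : ℂ | 1 < ‖w‖} := by
    rw [h1]
    exact (convex_halfSpace_re_gt 0).isPreconnected.image _ Complex.continuous_exp.continuousOn
  have h3 := h2.image _ hcont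
  convert h3 using 1
  ext z
  constructor
  · intro hz; exact ⟨B z, hB.bij.mapsTo hz, hB.bij.injOn.leftInvOn_invFunOn hz⟩
  · rintro ⟨w, hw, rfl⟩
    refine Function.invFunOn_mem ?_
    rw [← hB.bij.image_eq] at hw
    exact hw

/-- The d-th power map expands at 1: v^d - 1 is v - 1 times a geometric sum close to d ≥ 2, so
distances to 1 grow by 3/2 until they exceed δ. -/
theorem exists_eq_one_of_pow (hd : 2 ≤ d) :
    ∃ δ > 0, ∀ v : ℂ, (∀ j : ℕ, ‖v ^ d ^ j - 1‖ < δ) → v = 1 := by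
  have hcont : Continuous fun v : ℂ => ‖∑ i ∈ Finset.range d, v ^ i‖ := by fun_prop
  have h1 : ∀ᶠ v in 𝓝 (1 : ℂ), (3 / 2 : ℝ) < ‖∑ i ∈ Finset.range d, v ^ i‖ := by
    refine hcont.continuousAt.eventually_const_lt ?_
    have : (2 : ℝ) ≤ d := by exact_mod_cast hd
    simp; linarith
  obtain ⟨δ, hδ, hb⟩ := Metric.eventually_nhds_iff.1 h1
  refine ⟨δ, hδ, fun v hv => ?_⟩
  have key : ∀ j : ℕ, (3 / 2 : ℝ) ^ j * ‖v - 1‖ ≤ ‖v ^ d ^ j - 1‖ := by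
    intro j
    induction j with
    | zero => simp
    | succ j ih =>
      have h2 := hb (y := v ^ d ^ j) (by rw [dist_eq_norm]; exact hv j)
      have h3 : v ^ d ^ (j + 1) - 1 = (∑ i ∈ Finset.range d, (v ^ d ^ j) ^ i) * (v ^ d ^ j - 1) := by
        rw [geom_sum_mul, ← pow_mul, pow_succ]
      rw [h3, norm_mul, pow_succ']
      have h4 := norm_nonneg (v ^ d ^ j - 1)
      nlinarith
  by_contra hne
  have hpos : 0 < ‖v - 1‖ := norm_pos_iff.2 (sub_ne_zero.2 hne)
  obtain ⟨j, hj⟩ := pow_unbounded_of_one_lt (δ / ‖v - 1‖) (by norm_num : (1 : ℝ) < 3 / 2)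
  rw [div_lt_iff₀ hpos] at hj
  linarith [key j, hv j]

/-- The Böttcher coordinate is unique. -/
theorem eqOn (hd : 2 ≤ d) (hB : IsBottcher d c B) {B' : ℂ → ℂ} (hB' : IsBottcher d c B')
    (hJ : IsCompact (filledJulia d c)) : EqOn B' B (filledJulia d c)ᶜ := by
  have hB0 : ∀ z ∉ filledJulia d c, B z ≠ 0 := by
    intro z hz h0
    have : 1 < ‖B z‖ := hB.bij.mapsTo hz
    simp [h0] at this; linarith
  have hopen := hJ.isClosed.isOpen_compl
  obtain ⟨δ, hδ, hpow⟩ := exists_eq_one_of_pow hd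
  -- B'/B tends to 1 at infinity, and its values along an escaping orbit are its d^j-th powers, so
  -- it equals 1 far out; the identity theorem extends this. Uniqueness is needed because rays and
  -- equipotentials each quantify over their own coordinate.
  have hlim : Tendsto (fun z => B' z / B z) (Bornology.cobounded ℂ) (𝓝 1) := by
    have h1 := hB'.tangent.div hB.tangent one_ne_zero
    rw [div_one] at h1
    refine h1.congr' ?_
    filter_upwards [tendsto_norm_cobounded_atTop.eventually_gt_atTop (0 : ℝ)] with z hz
    have : z ≠ 0 := norm_pos_iff.1 hz
    simp only [Pi.div_apply]
    rw [div_div_div_cancel_right₀ this]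
  have hev : ∀ᶠ z in Bornology.cobounded ℂ, ‖B' z / B z - 1‖ < δ ∧ z ∉ filledJulia d c := by
    refine Filter.Eventually.and ?_ (eventually_notMem hJ)
    have := hlim.eventually (Metric.ball_mem_nhds (1 : ℂ) hδ)
    filter_upwards [this] with z hz
    rwa [dist_eq_norm] at hz
  obtain ⟨R₀, -, hR₀⟩ := (Filter.hasBasis_cobounded_norm (E := ℂ)).eventually_iff.1 hev
  set R := max R₀ (max 2 ‖c‖)
  have hinv : ∀ z : ℂ, R ≤ ‖z‖ → ∀ j : ℕ, R ≤ ‖(P d c)^[j] z‖ := by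
    intro z hz j
    induction j with
    | zero => simpa
    | succ j ih =>
      rw [Function.iterate_succ_apply']
      have h2 : 2 ≤ ‖(P d c)^[j] z‖ := ((le_max_left _ _).trans (le_max_right _ _)).trans ih
      have h3 : ‖c‖ ≤ ‖(P d c)^[j] z‖ := ((le_max_right _ _).trans (le_max_right _ _)).trans ih
      have := norm_P_ge hd (by linarith) h3
      nlinarith
  have hone : ∀ z : ℂ, R ≤ ‖z‖ → B' z / B z = 1 := by
    intro z hz
    refine hpow _ fun j => ?_
    have hj : ∀ j : ℕ, B' ((P d c)^[j] z) / B ((P d c)^[j] z) = (B' z / B z) ^ d ^ j := by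
      intro j
      induction j with
      | zero => simp
      | succ j ih =>
        have hE := (hR₀ ((le_max_left _ _).trans (hinv z hz j))).2
        rw [Function.iterate_succ_apply', hB'.conj _ hE, hB.conj _ hE, ← div_pow, ih, ← pow_mul,
          pow_succ]
    rw [← hj]
    exact (hR₀ ((le_max_left _ _).trans (hinv z hz j))).1
  have hz₁ : R < ‖((R + 1 : ℝ) : ℂ)‖ := by
    rw [Complex.norm_real, Real.norm_eq_abs]
    exact (lt_add_one R).trans_le (le_abs_self _)
  have hz₁E := (hR₀ ((le_max_left _ _).trans hz₁.le)).2
  have hanB : AnalyticOnNhd ℂ B (filledJulia d c)ᶜ := hB.holo.analyticOnNhd hopen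
  have hanB' : AnalyticOnNhd ℂ B' (filledJulia d c)ᶜ := hB'.holo.analyticOnNhd hopen
  refine hanB'.eqOn_of_preconnected_of_eventuallyEq hanB (hB.isPreconnected_compl hJ) hz₁E ?_
  have hmem : {z : ℂ | R < ‖z‖} ∈ 𝓝 ((R + 1 : ℝ) : ℂ) :=
    (isOpen_lt continuous_const continuous_norm).mem_nhds hz₁
  filter_upwards [hmem, hopen.mem_nhds hz₁E] with z hz hzE
  exact (div_eq_one_iff_eq (hB0 z hzE)).1 (hone z (le_of_lt hz))

theorem isOpen_insideEquipotential (hB : IsBottcher d c B)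
    (hJ : IsCompact (filledJulia d c)) {r : ℝ} (hr : 1 < r) :
    IsOpen (insideEquipotential d c r) := by
  rw [isOpen_iff_mem_nhds]
  intro z hz
  by_cases hzJ : z ∈ filledJulia d c
  · filter_upwards [hB.eventually_norm_lt hJ hzJ hr] with y hy
    by_cases hyJ : y ∈ filledJulia d c
    · exact Or.inl hyJ
    · exact Or.inr ⟨B, hB, hy hyJ⟩
  · obtain ⟨B', hB', hlt⟩ := hz.resolve_left hzJ
    have hc := (hB'.holo.continuousOn.continuousAt (hJ.isClosed.isOpen_compl.mem_nhds hzJ)).norm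
    filter_upwards [hc.eventually_lt_const hlt] with y hy using Or.inr ⟨B', hB', hy⟩

end IsBottcher

/-! ### The dividing fixed point -/

theorem Lands.congr {θ θ' : ℝ} {x : ℂ} (h : Lands d c θ x)
    (he : Complex.exp (θ * Complex.I) = Complex.exp (θ' * Complex.I)) : Lands d c θ' x := by
  obtain ⟨B, γ, hB, hγ, hl⟩ := h
  exact ⟨B, γ, hB, fun s hs => by rw [← he]; exact hγ s hs, hl⟩

theorem ray_congr {θ θ' : ℝ} (he : Complex.exp (θ * Complex.I) = Complex.exp (θ' * Complex.I)) :
    ray d c θ = ray d c θ' := by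
  unfold ray; rw [he]

theorem Lands.mem_closure_raysAt {θ : ℝ} {x : ℂ} (h : Lands d c θ x) :
    x ∈ closure (raysAt d c x) := by
  have h' := h
  obtain ⟨B, γ, hB, hγ, hl⟩ := h
  refine mem_closure_of_tendsto hl ?_
  filter_upwards [self_mem_nhdsWithin] with s hs
  exact mem_biUnion (show θ ∈ {θ | Lands d c θ x} from h') ⟨(hγ s hs).1, B, hB, s, hs, (hγ s hs).2⟩

theorem Lands.mem_closure_compl {θ : ℝ} {x : ℂ} (h : Lands d c θ x) :
    x ∈ closure (filledJulia d c)ᶜ := by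
  obtain ⟨B, γ, hB, hγ, hl⟩ := h
  refine mem_closure_of_tendsto hl ?_
  filter_upwards [self_mem_nhdsWithin] with s hs using (hγ s hs).1

namespace IsDividing

variable {α : ℂ} {q : ℕ}

theorem exists_lands (h : IsDividing d c α q) : ∃ θ, Lands d c θ α := by
  have : {θ : ℝ | θ ∈ Ico 0 (2 * Real.pi) ∧ Lands d c θ α}.Nonempty := by
    apply nonempty_of_ncard_ne_zero
    rw [h.2.2]; have := h.2.1; omega
  obtain ⟨θ, -, hθ⟩ := this
  exact ⟨θ, hθ⟩

theorem exists_isBottcher (h : IsDividing d c α q) : ∃ B, IsBottcher d c B := by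
  obtain ⟨θ, B, γ, hB, -⟩ := h.exists_lands
  exact ⟨B, hB⟩

theorem mem_closure_raysAt (h : IsDividing d c α q) : α ∈ closure (raysAt d c α) :=
  let ⟨_, hθ⟩ := h.exists_lands
  hθ.mem_closure_raysAt

theorem iterate_eq (h : IsDividing d c α q) (n : ℕ) : (P d c)^[n] α = α :=
  Function.iterate_fixed h.1 n

theorem mem_filledJulia (h : IsDividing d c α q) : α ∈ filledJulia d c :=
  mem_filledJulia_of_bounded (C := ‖α‖) fun n => by rw [h.iterate_eq]

theorem raysAt_subset (_ : IsDividing d c α q) : raysAt d c α ⊆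
    ⋃ θ ∈ {θ : ℝ | θ ∈ Ico 0 (2 * Real.pi) ∧ Lands d c θ α}, ray d c θ := by
  refine iUnion₂_subset fun θ hθ => ?_
  have hp : (0 : ℝ) < 2 * Real.pi := by have := Real.pi_pos; positivity
  have he : Complex.exp (θ * Complex.I) = Complex.exp ((toIcoMod hp 0 θ : ℝ) * Complex.I) := by
    rw [Complex.exp_eq_exp_iff_exists_int]
    refine ⟨toIcoDiv hp 0 θ, ?_⟩
    have h1 : (θ : ℂ) = (toIcoMod hp 0 θ : ℝ) + toIcoDiv hp 0 θ * (2 * Real.pi) := by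
      have := toIcoMod_add_toIcoDiv_zsmul hp 0 θ
      rw [zsmul_eq_mul] at this
      exact_mod_cast this.symm
    rw [h1]; ring
  rw [ray_congr he]
  refine subset_biUnion_of_mem (u := fun θ => ray d c θ) (x := toIcoMod hp 0 θ) ⟨?_, Lands.congr hθ he⟩
  simpa using toIcoMod_mem_Ico hp 0 θ

/-- The closures of the rays that land at `α` meet the filled Julia set at `α` only. -/
theorem eq_of_mem_closure_raysAt (hd : 2 ≤ d) (h : IsDividing d c α q)
    (hJ : IsCompact (filledJulia d c)) {y : ℂ} (hy : y ∈ closure (raysAt d c α))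
    (hyJ : y ∈ filledJulia d c) : y = α := by
  -- `ncard` is 0 on infinite sets, so q ≥ 2 makes the set of angles finite, and closure commutes
  -- with the union of rays.
  have hfin : {θ : ℝ | θ ∈ Ico 0 (2 * Real.pi) ∧ Lands d c θ α}.Finite := by
    apply finite_of_ncard_ne_zero
    rw [h.2.2]; have := h.2.1; omega
  have hy' := closure_mono h.raysAt_subset hy
  rw [hfin.closure_biUnion, mem_iUnion₂] at hy'
  obtain ⟨θ, ⟨-, B, γ, hB, hγ, hl⟩, hyθ⟩ := hy'
  refine eq_of_forall_dist_le fun ε hε => ?_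
  have h1 := hl.eventually (Metric.closedBall_mem_nhds α hε)
  -- The part of the ray with 1 < s < u lies within ε of α, and near a nonescaping y only this part
  -- matters, since |B| < u there.
  obtain ⟨u, hu, hsub⟩ := (mem_nhdsGT_iff_exists_Ioo_subset (a := (1 : ℝ))).1 h1
  have h2 := hB.eventually_norm_lt hJ hyJ (r := u) hu
  have h3 : y ∈ closure (Metric.closedBall α ε) := by
    rw [mem_closure_iff_frequently] at hyθ ⊢
    refine (hyθ.and_eventually h2).mono ?_
    rintro z ⟨⟨hzE, B', hB', s, hs, hBz⟩, hlt⟩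
    have hBz' : B z = s * Complex.exp (θ * Complex.I) := by
      rw [← hBz]; exact (hB.eqOn hd hB' hJ hzE).symm
    have hz : z = γ s := hB.bij.injOn hzE (hγ s hs).1 (by rw [hBz', (hγ s hs).2])
    have hsu : s < u := by
      have := hlt hzE
      rw [hBz', norm_mul, Complex.norm_exp_ofReal_mul_I, mul_one, Complex.norm_real,
        Real.norm_eq_abs, abs_of_pos (by linarith)] at this
      exact this
    rw [hz]
    exact hsub ⟨hs, hsu⟩
  rw [Metric.isClosed_closedBall.closure_eq] at h3
  exact h3

/-- The dividing fixed point is not attracting. -/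
theorem one_le_norm_deriv (h : IsDividing d c α q) : 1 ≤ ‖(d : ℂ) * α ^ (d - 1)‖ := by
  by_contra! hlt
  have hder : HasDerivAt (P d c) (d * α ^ (d - 1)) α := by
    exact (hasDerivAt_pow d α).add_const c
  obtain ⟨l, hl1, hl2⟩ := exists_between hlt
  have h1 : ∀ᶠ z in 𝓝 α, ‖P d c z - α‖ ≤ l * ‖z - α‖ := by
    have := (hasDerivAt_iff_isLittleO.1 hder).def (sub_pos.2 hl1)
    filter_upwards [this] with z hz
    rw [h.1, smul_eq_mul] at hz
    have h2 := norm_add_le (P d c z - α - (z - α) * (d * α ^ (d - 1))) ((z - α) * (d * α ^ (d - 1)))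
    rw [sub_add_cancel, norm_mul] at h2
    nlinarith
  obtain ⟨δ, hδ, hb⟩ := Metric.eventually_nhds_iff.1 h1
  -- An attracting α would have a neighbourhood inside the filled Julia set, although the ray
  -- landing at α consists of escaping points.
  have h2 : ∀ z ∈ Metric.ball α δ, z ∈ filledJulia d c := by
    intro z hz
    have h3 : ∀ n : ℕ, (P d c)^[n] z ∈ Metric.ball α δ := by
      intro n
      induction n with
      | zero => exact hz
      | succ n ih =>
        rw [Function.iterate_succ_apply']
        have := hb ih
        rw [mem_ball_iff_norm] at ih ⊢
        have := norm_nonneg ((P d c)^[n] z - α)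
        nlinarith
    refine mem_filledJulia_of_bounded (C := ‖α‖ + δ) fun n => ?_
    have h4 := h3 n
    rw [mem_ball_iff_norm] at h4
    have := norm_le_norm_add_norm_sub' ((P d c)^[n] z) α
    linarith
  obtain ⟨θ, hθ⟩ := h.exists_lands
  obtain ⟨z, hz, hzJ⟩ := mem_closure_iff_nhds.1 hθ.mem_closure_compl _ (Metric.ball_mem_nhds α hδ)
  exact hzJ (h2 z hz)

/-- If |α| < 1/d ≤ 1, the multiplier would satisfy d|α|^(d-1) ≤ d|α| < 1. The exponent d - 1 ≥ 1 is
where d ≥ 2 enters. -/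
theorem inv_le_norm (hd : 2 ≤ d) (h : IsDividing d c α q) : (d : ℝ)⁻¹ ≤ ‖α‖ := by
  by_contra! hlt
  have h1 := h.one_le_norm_deriv
  rw [norm_mul, norm_pow, Complex.norm_natCast] at h1
  have hdp : (0 : ℝ) < d := by exact_mod_cast (by omega : 0 < d)
  have hd1 : (d : ℝ)⁻¹ ≤ 1 := inv_le_one_of_one_le₀ (by exact_mod_cast (by omega : 1 ≤ d))
  have h2 : ‖α‖ ^ (d - 1) ≤ ‖α‖ := by
    calc ‖α‖ ^ (d - 1) ≤ ‖α‖ ^ 1 := pow_le_pow_of_le_one (norm_nonneg _) (by linarith) (by omega)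
      _ = ‖α‖ := pow_one _
  have h3 : (d : ℝ) * ‖α‖ < 1 := by
    have := mul_lt_mul_of_pos_left hlt hdp
    rwa [mul_inv_cancel₀ hdp.ne'] at this
  nlinarith

theorem isOpen_puzzle (h : IsDividing d c α q) (hJ : IsCompact (filledJulia d c))
    {r : ℝ} (hr : 1 < r) (n : ℕ) : IsOpen (puzzle d c α r n) := by
  obtain ⟨B, hB⟩ := h.exists_isBottcher
  have hc : Continuous (P d c) := by unfold P; fun_prop
  exact ((hB.isOpen_insideEquipotential hJ hr).sdiff isClosed_closure).preimage (hc.iterate n)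

/-- The dividing fixed point lies on the boundary of the critical puzzle piece of depth one. -/
theorem mem_closure_piece (hd : 2 ≤ d) (h : IsDividing d c α q) (hJ : IsCompact (filledJulia d c))
    (hJc : IsPreconnected (filledJulia d c)) (h0J : (0 : ℂ) ∈ filledJulia d c) {r : ℝ} (hr : 1 < r)
    (h0 : (0 : ℂ) ∈ puzzle d c α r 1) : α ∈ closure (piece d c α r 1 0) := by
  set O := puzzle d c α r 1
  set Y := piece d c α r 1 0 with hYdef
  have hO : IsOpen O := h.isOpen_puzzle hJ hr 1
  have hYO : Y ⊆ O := connectedComponentIn_subset _ _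
  have h0Y : (0 : ℂ) ∈ Y := mem_connectedComponentIn h0
  have hYopen : IsOpen Y := hO.connectedComponentIn
  have hαO : α ∉ O := fun hα => hα.2 (by
    rw [Function.iterate_one, h.1]; exact h.mem_closure_raysAt)
  -- The connected filled Julia set contains 0, in the piece, and α, outside the puzzle, so it meets
  -- the boundary of the piece. Such a boundary point must be mapped to α.
  obtain ⟨x, hxJ, hxf⟩ : ∃ x ∈ filledJulia d c, x ∈ closure Y \ Y := by
    by_contra! hno
    have hsub : filledJulia d c ⊆ Y := hJc.subset_of_closure_inter_subset hYopen ⟨0, h0J, h0Y⟩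
      fun x hx => by_contra fun hxY => hno x hx.2 ⟨hx.1, hxY⟩
    exact hαO (hYO (hsub h.mem_filledJulia))
  have hxO : x ∉ O := fun hx => hxf.2 (mem_component_of_mem_closure h0 hxf.1 hx)
  have hPx : P d c x = α := by
    have hPJ : P d c x ∈ filledJulia d c := P_mem_filledJulia.2 hxJ
    refine h.eq_of_mem_closure_raysAt hd hJ ?_ hPJ
    by_contra hn
    exact hxO ⟨Or.inl hPJ, hn⟩
  have hpow : x ^ d = α ^ d := by
    have h1 : x ^ d + c = α := hPx
    have h2 : α ^ d + c = α := h.1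
    exact add_right_cancel (h1.trans h2.symm)
  have hd0 : d ≠ 0 := by omega
  by_cases hx0 : x = 0
  · have : α = 0 := by
      rw [hx0, zero_pow hd0] at hpow
      exact pow_eq_zero_iff hd0 |>.1 hpow.symm
    rw [this]; exact subset_closure h0Y
  · set ω := α / x
    have hω : ω ^ d = 1 := by rw [div_pow, hpow, div_self (hpow ▸ pow_ne_zero d hx0)]
    -- P depends only on z^d, so rotation by the root of unity ω preserves the depth-one puzzle. It
    -- fixes 0, hence preserves the critical piece and carries x to α.
    have hrot : (fun z => ω * z) '' Y ⊆ Y := by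
      refine (isPreconnected_connectedComponentIn.image _
        (by fun_prop)).subset_connectedComponentIn ⟨0, h0Y, by simp⟩ ?_
      rintro _ ⟨z, hz, rfl⟩
      have hPz : P d c (ω * z) = P d c z := by simp [P, mul_pow, hω]
      have hzO := hYO hz
      simp only [O, puzzle, mem_preimage, Function.iterate_one] at hzO ⊢
      rwa [hPz]
    have hαx : α = ω * x := by simp only [ω]; field_simp
    rw [hαx]
    exact closure_mono hrot (image_closure_subset_closure_image (by fun_prop) ⟨x, hxf.1, rfl⟩)

end IsDividing

/-! ### Satellite against primitive renormalization -/

/-- A satellite renormalizable polynomial has no favorite nest. -/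
theorem not_inNest {α : ℂ} {r : ℝ} {p q : ℕ} {Kl : Set ℂ} (hs : IsSatellite d c α r p Kl)
    (hq : IsDividing d c α q) {Q : Set ℂ} (hQ : InNest d c α r q Q) : False := by
  have hpq : p = q := by rw [← hs.1.2.2, ← hq.2.2]
  subst hpq
  induction hQ with
  | base k hk =>
    obtain ⟨-, hw, h0, -⟩ := hk.1
    -- The nest starts when the critical orbit is in a noncritical piece at a multiple of q. At
    -- these times a satellite orbit lies in the closure of the critical piece, and a puzzle point
    -- there belongs to the piece itself.
    have h1 := hs.2.1 k
    have h00 : (0 : ℂ) ∈ puzzle d c α r 1 := by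
      by_contra hn
      unfold piece at h1
      rw [connectedComponentIn_eq_empty hn] at h1
      simp at h1
    have h2 := mem_component_of_mem_closure h00 h1 hw
    apply h0
    unfold piece
    rw [← connectedComponentIn_eq h2]
    exact mem_connectedComponentIn h00
  | step Q Q' _ _ ih => exact ih

theorem IsSatellite.zero_mem_puzzle {α : ℂ} {r : ℝ} {p : ℕ} {Kl : Set ℂ}
    (hs : IsSatellite d c α r p Kl) : (0 : ℂ) ∈ puzzle d c α r 1 := by
  by_contra hn
  have h1 := hs.2.1 0
  unfold piece at h1
  rw [connectedComponentIn_eq_empty hn] at h1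
  simp at h1

/-- This exclusivity decides which alternative of `renorm` holds at a satellite level. -/
theorem IsSatellite.not_isPrimitive {α : ℂ} {r : ℝ} {p p' : ℕ} {Kl Kl' : Set ℂ}
    (hs : IsSatellite d c α r p Kl) : ¬ IsPrimitive d c α r p' Kl' := by
  rintro ⟨q, Q, hq, hQ, -⟩
  exact not_inNest hs hq hQ

theorem IsSatellite.dividing_mem (hd : 2 ≤ d) {α : ℂ} {r : ℝ} {p : ℕ} {Kl : Set ℂ}
    (hs : IsSatellite d c α r p Kl) (hJ : IsCompact (filledJulia d c))
    (hJc : IsPreconnected (filledJulia d c)) (h0J : (0 : ℂ) ∈ filledJulia d c) (hr : 1 < r) :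
    α ∈ Kl := by
  rw [hs.2.2]
  intro l
  rw [hs.1.iterate_eq]
  exact hs.1.mem_closure_piece hd hJ hJc h0J hr hs.zero_mem_puzzle

end GlueSpace

end

/-! ### Connectedness from the boundary and the thin ring dichotomy -/

section

namespace GlueSpace

/-- The part of K in v avoids the frontier, so it is clopen in the plane; being compact, it is
empty. -/
theorem subset_of_frontier_subset {K u v : Set ℂ} (hK : IsCompact K) (hu : IsClosed u)
    (hv : IsClosed v) (huv : Disjoint u v) (hKuv : K ⊆ u ∪ v) (hf : frontier K ⊆ u) : K ⊆ u := by
  have heq : K ∩ v = interior K ∩ uᶜ := by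
    ext z
    constructor
    · rintro ⟨hz, hzv⟩
      have hzu : z ∉ u := fun h => disjoint_left.1 huv h hzv
      refine ⟨by_contra fun hi => hzu (hf ⟨subset_closure hz, hi⟩), hzu⟩
    · rintro ⟨hz, hzu⟩
      exact ⟨interior_subset hz, (hKuv (interior_subset hz)).resolve_left hzu⟩
  have hclopen : IsClopen (K ∩ v) :=
    ⟨hK.isClosed.inter hv, heq ▸ isOpen_interior.inter hu.isOpen_compl⟩
  rcases isClopen_iff.1 hclopen with h | h
  · intro z hz
    exact (hKuv hz).resolve_right fun hzv => (h ▸ (⟨hz, hzv⟩ : z ∈ K ∩ v) : z ∈ (∅ : Set ℂ))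
  · exact absurd (isCompact_univ_iff.1 (h ▸ hK.inter_right hv)) (not_compactSpace_iff.2 inferInstance)

/-- A compact set with connected boundary is connected. -/
theorem isPreconnected_of_frontier {K : Set ℂ} (hK : IsCompact K)
    (hf : IsPreconnected (frontier K)) : IsPreconnected K := by
  rw [isPreconnected_iff_subset_of_fully_disjoint_closed hK.isClosed]
  intro u v hu hv hKuv huv
  rcases (isPreconnected_iff_subset_of_fully_disjoint_closed isClosed_frontier).1 hf u v hu hv
    (hK.isClosed.frontier_subset.trans hKuv) huv with h | h
  · exact Or.inl (subset_of_frontier_subset hK hu hv huv hKuv h)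
  · exact Or.inr (subset_of_frontier_subset hK hv hu huv.symm (union_comm u v ▸ hKuv) h)

theorem StripMap.image_subset_box {Φ : ℂ → ℂ} {ℓ : ℝ} {A : Set ℂ} (H : StripMap Φ ℓ A) {a b : ℝ}
    (ha : 0 < a) (hb : b < ℓ) : Φ '' {w | a < w.re ∧ w.re < b} ⊆
      Φ '' (Icc a b ×ℂ Icc 0 (2 * Real.pi)) := by
  rintro _ ⟨w, ⟨h1, h2⟩, rfl⟩
  have hpi : (0 : ℝ) < 2 * Real.pi := by have := Real.pi_pos; positivity
  have hw : w ∈ strip ℓ := ⟨ha.trans h1, h2.trans hb⟩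
  refine ⟨w + (-⌊w.im / (2 * Real.pi)⌋ : ℤ) * (2 * Real.pi * Complex.I), ?_, H.apply_add_int hw _⟩
  have h3 := Int.floor_le (w.im / (2 * Real.pi))
  have h4 := (Int.lt_floor_add_one (w.im / (2 * Real.pi))).le
  rw [le_div_iff₀ hpi] at h3
  rw [div_le_iff₀ hpi] at h4
  rw [Complex.mem_reProdIm]
  constructor
  · simpa using ⟨h1.le, h2.le⟩
  · simp only [Int.cast_neg, Complex.add_im, Complex.mul_im, Complex.neg_re, Complex.intCast_re,
      Complex.mul_re, Complex.re_ofNat, Complex.ofReal_re, Complex.im_ofNat, Complex.ofReal_im,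
      Complex.I_re, Complex.I_im, Complex.neg_im, Complex.intCast_im, mem_Icc]
    constructor <;> linarith

/-- A ring in `H \ D` around `D` is thin when `D` and the complement of `H` both meet a connected
set `K` that is surrounded by a thick ring of `V`, and `D` is large in a quasiconformal chart
of `V`. -/
theorem IsRing.le_or_le {A H D V K A' : Set ℂ} {m m' κ δ : ℝ} {S : ℂ → ℂ} {a b : ℂ}
    (hA : IsRing A m) (hAH : A ⊆ H \ D) (hDA : D ⊆ surrounded A) (hH : IsFull H) (hV : IsDisk V)
    (hS : IsQC κ V S) (hS0 : S 0 = 0) (hK : IsPreconnected K) (hKV : K ⊆ V) (h0K : (0 : ℂ) ∈ K)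
    (hbK : b ∈ K) (hbH : b ∉ H) (h0D : (0 : ℂ) ∈ D) (haD : a ∈ D) (haV : a ∈ V)
    (hSb : ‖S b‖ ≤ 2) (hδ : 0 < δ) (hδ1 : δ ≤ 1) (hSa : δ ≤ ‖S a‖)
    (hA' : IsRing A' m') (hA'V : A' ⊆ V \ K) (hKA' : K ⊆ surrounded A') :
    m * m' ≤ 3 ∨ δ ^ 2 * m ≤ 48 * Real.pi * κ := by
  have hpi := Real.pi_pos
  obtain ⟨Φ, hΦ⟩ := hA.exists_stripMap
  obtain ⟨X, hX⟩ := hA'.exists_stripMap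
  have hℓ := hΦ.pos
  set ℓ := 2 * Real.pi * m with hℓm
  have h0A := hDA h0D
  have hbA : b ∉ A := fun h => hbH (hAH h).1
  have hbA' : b ∉ surrounded A := fun h => hbH (surrounded_subset hH (hAH.trans sdiff_subset) h)
  have hcross : ∀ s ∈ Ioo 0 ℓ, ∃ t : ℝ, Φ (s + t * Complex.I) ∈ surrounded A' := fun s hs =>
    let ⟨t, ht⟩ := hΦ.exists_loop_mem hK h0K hbK h0A hbA hbA' hs
    ⟨t, hKA' ht⟩
  have hout : ∀ z ∉ V, z ∉ A' ∧ z ∉ surrounded A' := fun z hz =>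
    ⟨fun h => hz (hA'V h).1, fun h => hz (surrounded_subset hV.isFull (hA'V.trans sdiff_subset) h)⟩
  have harith : 2 * Real.pi * m' * (ℓ / 3) ≤ 4 * Real.pi ^ 2 → m * m' ≤ 3 := by
    intro h
    have h1 : Real.pi ^ 2 * (m * m') ≤ Real.pi ^ 2 * 3 := by rw [hℓm] at h; nlinarith
    exact le_of_mul_le_mul_left h1 (by positivity)
  -- The closed middle third is tested, so that the closure of the open middle third lies in V, as
  -- quasiconformal distortion requires.
  by_cases hT : ∀ w : ℂ, ℓ / 3 ≤ w.re → w.re ≤ 2 * ℓ / 3 → Φ w ∈ V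
  · right
    have hA2 := hΦ.restrict (a := ℓ / 3) (b := 2 * ℓ / 3) (by linarith) (by linarith) (by linarith)
    set A2 := Φ '' {w | ℓ / 3 < w.re ∧ w.re < 2 * ℓ / 3} with hA2def
    have hA2A : A2 ⊆ A := by
      rintro _ ⟨w, ⟨h1, h2⟩, rfl⟩
      exact hΦ.mem ⟨by linarith, by linarith⟩
    -- By periodicity the subring is covered by the image of a compact rectangle.
    have hbox : IsCompact (Φ '' (Icc (ℓ / 3) (2 * ℓ / 3) ×ℂ Icc 0 (2 * Real.pi))) := by
      refine (isCompact_Icc.reProdIm isCompact_Icc).image_of_continuousOn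
        (hΦ.holo.continuousOn.mono ?_)
      rintro w ⟨⟨h1, h2⟩, -⟩
      exact ⟨by linarith, by linarith⟩
    have hcl := closure_minimal (hΦ.image_subset_box (a := ℓ / 3) (b := 2 * ℓ / 3) (by linarith)
      (by linarith)) hbox.isClosed
    have hclV : closure A2 ⊆ V := by
      refine hcl.trans ?_
      rintro _ ⟨w, ⟨⟨h1, h2⟩, -⟩, rfl⟩
      exact hT w h1 h2
    have hclc : IsCompact (closure A2) := hbox.of_isClosed_subset isClosed_closure hcl
    obtain ⟨m₁, hm₁⟩ := (hS.ring_iff A2 hclc hclV).1 ⟨_, hA2.isRing⟩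
    have hle := (hS.ring_le A2 hclc hclV _ _ hA2.isRing hm₁).1
    have hA2V : A2 ⊆ V := subset_closure.trans hclV
    have hsurr : ∀ {x}, x ∈ V → (S x ∈ surrounded (S '' A2) ↔ x ∈ surrounded A2) :=
      hS.openEmb.mem_surrounded_iff hV hA2.isOpen hA2V
    have hDA2 : D ⊆ surrounded A2 := hDA.trans
      (hΦ.surrounded_subset_restrict (by linarith) (by linarith) (by linarith))
    obtain ⟨Ψ, hΨ⟩ := hm₁.exists_stripMap
    have hsep := hΨ.le_of_separates (a := S a) (b := S b)
      (by have := (hsurr (hKV h0K)).2 (hDA2 h0D); rwa [hS0] at this) ((hsurr haV).2 (hDA2 haD))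
      (by
        rintro ⟨y, hy, he⟩
        exact hbA (hA2A (hS.injOn (hA2V hy) (hKV hbK) he ▸ hy)))
      (fun h => hΦ.not_mem_surrounded_restrict (by linarith) (by linarith) (by linarith) hbA hbA'
        ((hsurr (hKV hbK)).1 h)) hSb hδ hSa hδ1
    have hκ : 0 < κ := by linarith [hS.one_le]
    have h1 : m / 3 ≤ m₁ * κ := by
      rw [div_le_iff₀ hκ] at hle
      refine le_trans (le_of_eq ?_) hle
      rw [hℓm]; field_simp; ring
    have h2 : δ ^ 2 * m₁ ≤ 16 * Real.pi := by
      refine le_of_mul_le_mul_left (a := 2 * Real.pi) ?_ (by positivity)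
      nlinarith
    calc δ ^ 2 * m = 3 * (δ ^ 2 * (m / 3)) := by ring
      _ ≤ 3 * (δ ^ 2 * (m₁ * κ)) := by gcongr
      _ = 3 * κ * (δ ^ 2 * m₁) := by ring
      _ ≤ 3 * κ * (16 * Real.pi) := by gcongr
      _ = 48 * Real.pi * κ := by ring
  -- The complement of V through the bad point is unbounded and crosses one side of it, hence all
  -- loops of an outer third. The constant 3 in the bound is the price of passing to a third.
  · left
    push Not at hT
    obtain ⟨w₀, h1, h2, hw₀⟩ := hT
    have hw₀s : w₀ ∈ strip ℓ := ⟨by linarith, by linarith⟩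
    have hZ : connectedComponentIn Vᶜ (Φ w₀) ⊆ Vᶜ := connectedComponentIn_subset _ _
    refine harith ?_
    rcases hΦ.crosses_of_unbounded hw₀s isPreconnected_connectedComponentIn
      (mem_connectedComponentIn hw₀) (hV.isFull _ hw₀) with hc | hc
    · have := hΦ.le_of_crosses hX (a := 0) (b := ℓ / 3) le_rfl (by linarith)
        (fun s hs => hcross s ⟨hs.1, by linarith [hs.2]⟩)
        (fun s hs => let ⟨t, ht⟩ := hc s ⟨hs.1, by linarith [hs.2]⟩
          ⟨t, hout _ (hZ ht)⟩)
      simpa using this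
    · have := hΦ.le_of_crosses hX (a := 2 * ℓ / 3) (b := ℓ) (by linarith) le_rfl
        (fun s hs => hcross s ⟨by linarith [hs.1], hs.2⟩)
        (fun s hs => let ⟨t, ht⟩ := hc s ⟨by linarith [hs.1], hs.2⟩
          ⟨t, hout _ (hZ ht)⟩)
      convert this using 2
      ring

end GlueSpace

end

/-! ### Moduli bounds for admissible choices -/

namespace GlueSpace

namespace Admissible

variable {d : ℕ} {ε η κ C : ℝ} {F : Choices}

theorem t_pos (h : Admissible d ε η κ C F) (n : ℕ) : 0 < F.t n := by
  induction n with
  | zero => rw [h.t_zero]; exact one_pos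
  | succ n ih =>
    obtain ⟨p, Kl, ht, hs | hp, -⟩ := h.renorm n
    · rw [ht]; exact Nat.mul_pos ih (by have := hs.1.2.1; omega)
    · obtain ⟨q, Q, -, -, hr, -⟩ := hp
      rw [ht]; exact Nat.mul_pos ih hr.1.1

theorem zero_mem_succ (h : Admissible d ε η κ C F) (n : ℕ) : (0 : ℂ) ∈ F.K (n + 1) := by
  obtain ⟨p, Kl, -, hs, hK⟩ := h.renorm n
  rw [hK]
  refine ⟨(h.polyLike n).zero_mem, ?_⟩
  rw [(h.straight n).zero]
  rcases hs with hs | ⟨q, Q, -, -, -, h0, rfl⟩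
  · rw [hs.2.2]; exact hs.2.1
  · exact h0

theorem zero_mem (h : Admissible d ε η κ C F) (n : ℕ) : (0 : ℂ) ∈ F.K n := by
  cases n with
  | succ n => exact h.zero_mem_succ n
  | zero =>
    -- Level 0 has no level before it; the bound on the critical orbit comes from level 1, by
    -- dividing j by the period `F.t 1` and filling in the remainder with `orbit`.
    intro j
    have h1 : (F.R 1)^[j / F.t 1] 0 ∈ F.V 1 := h.zero_mem_succ 0 _
    have h2 := h.orbit 1 _ h1 (j % F.t 1) (Nat.mod_lt _ (h.t_pos 1))
    rw [Choices.R, ← Function.iterate_mul, ← Function.iterate_add_apply, Nat.mod_add_div] at h2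
    rwa [Choices.R, h.t_zero, Function.iterate_one]

theorem isCompact_K (h : Admissible d ε η κ C F) (n : ℕ) : IsCompact (F.K n) :=
  (h.polyLike n).isCompact_filled

theorem isPreconnected_K (h : Admissible d ε η κ C F) (n : ℕ) : IsPreconnected (F.K n) :=
  isPreconnected_of_frontier (h.isCompact_K n) (h.connected n).isPreconnected

theorem K_subset (n : ℕ) : F.K n ⊆ F.V n := fun _ hz => hz 0

theorem K_subset_W (n : ℕ) : F.K n ⊆ F.W n := fun _ hz => ⟨hz 0, hz 1⟩

theorem iterate_mem_K {n : ℕ} {z : ℂ} (hz : z ∈ F.K n) (j : ℕ) : (F.R n)^[j] z ∈ F.K n :=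
  IsPolyLike.mapsTo_filled.iterate j hz

theorem S_iterate (h : Admissible d ε η κ C F) {n : ℕ} {z : ℂ} (hz : z ∈ F.K n) (j : ℕ) :
    F.S n ((F.R n)^[j] z) = (P d (F.c n))^[j] (F.S n z) := by
  induction j with
  | zero => rfl
  | succ j ih =>
    have h1 := iterate_mem_K hz j
    rw [Function.iterate_succ_apply', Function.iterate_succ_apply', ← ih]
    exact (h.straight n).conj _ (h1 0) (h1 1)

theorem isCompact_image_K (h : Admissible d ε η κ C F) (n : ℕ) : IsCompact (F.S n '' F.K n) :=
  (h.isCompact_K n).image_of_continuousOn ((h.straight n).qc.continuousOn.mono (K_subset n))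

/-- The filled Julia set lies in S(W) and is forward invariant, so by injectivity of S its orbits
lift to orbits that never leave V. Conversely orbits in the image of the compact K_n are bounded. -/
theorem filledJulia_eq (h : Admissible d ε η κ C F) (n : ℕ) :
    filledJulia d (F.c n) = F.S n '' F.K n := by
  apply Subset.antisymm
  · intro w hw
    have hFJ : filledJulia d (F.c n) ⊆ F.S n '' F.W n := fun w hw => h.equip n (Or.inl hw)
    obtain ⟨z, hz, rfl⟩ := hFJ hw
    have key : ∀ j : ℕ, (F.R n)^[j] z ∈ F.W n ∧
        F.S n ((F.R n)^[j] z) = (P d (F.c n))^[j] (F.S n z) := by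
      intro j
      induction j with
      | zero => exact ⟨hz, rfl⟩
      | succ j ih =>
        have h1 : F.S n ((F.R n)^[j + 1] z) = (P d (F.c n))^[j + 1] (F.S n z) := by
          rw [Function.iterate_succ_apply', Function.iterate_succ_apply', ← ih.2,
            (h.straight n).conj _ ih.1.1 ih.1.2]
        obtain ⟨y, hy, he⟩ := hFJ ((iterate_mem_filledJulia (j + 1)).2 hw)
        rw [← h1] at he
        refine ⟨?_, h1⟩
        rw [← (h.straight n).qc.injOn hy.1
          (by rw [Function.iterate_succ_apply']; exact ih.1.2) he]
        exact hy
    exact ⟨z, fun j => (key j).1.1, rfl⟩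
  · rintro _ ⟨z, hz, rfl⟩
    obtain ⟨R, hR⟩ := (h.isCompact_image_K n).isBounded.exists_norm_le
    refine mem_filledJulia_of_bounded (C := R) fun j => ?_
    rw [← h.S_iterate hz]
    exact hR _ ⟨_, iterate_mem_K hz j, rfl⟩

theorem isCompact_filledJulia (h : Admissible d ε η κ C F) (n : ℕ) :
    IsCompact (filledJulia d (F.c n)) := h.filledJulia_eq n ▸ h.isCompact_image_K n

theorem isPreconnected_filledJulia (h : Admissible d ε η κ C F) (n : ℕ) :
    IsPreconnected (filledJulia d (F.c n)) :=
  h.filledJulia_eq n ▸ (h.isPreconnected_K n).image _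
    ((h.straight n).qc.continuousOn.mono (K_subset n))

theorem zero_mem_filledJulia (h : Admissible d ε η κ C F) (n : ℕ) :
    (0 : ℂ) ∈ filledJulia d (F.c n) := by
  rw [h.filledJulia_eq n]
  exact ⟨0, h.zero_mem n, (h.straight n).zero⟩

theorem isCompact_closure_W (h : Admissible d ε η κ C F) (n : ℕ) :
    IsCompact (closure (F.W n)) ∧ closure (F.W n) ⊆ F.V n := by
  have hc := (h.polyLike n).isCompact_inter_preimage_closure
  have hsub : closure (F.W n) ⊆ F.V n ∩ F.R n ⁻¹' closure (F.V n) :=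
    closure_minimal (fun z hz => ⟨hz.1, subset_closure hz.2⟩) hc.isClosed
  exact ⟨hc.of_isClosed_subset isClosed_closure hsub, hsub.trans inter_subset_left⟩

theorem image_pull (h : Admissible d ε η κ C F) {n : ℕ} {X : Set ℂ}
    (hX : X ⊆ insideEquipotential d (F.c n) F.r) : F.S n '' F.pull n X = X := by
  apply Subset.antisymm
  · rintro _ ⟨z, hz, rfl⟩; exact hz.2
  · intro w hw
    obtain ⟨z, hz, rfl⟩ := h.equip n (hX hw)
    exact ⟨z, ⟨hz.1, hw⟩, rfl⟩

theorem pull_subset_W (h : Admissible d ε η κ C F) {n : ℕ} {X : Set ℂ}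
    (hX : X ⊆ insideEquipotential d (F.c n) F.r) : F.pull n X ⊆ F.W n := by
  intro z hz
  obtain ⟨y, hy, he⟩ := h.equip n (hX hz.2)
  rwa [← (h.straight n).qc.injOn hy.1 hz.1 he]

theorem isDisk_pull (h : Admissible d ε η κ C F) {n : ℕ} {X : Set ℂ} (hXd : IsDisk X)
    (hX : X ⊆ insideEquipotential d (F.c n) F.r) : IsDisk (F.pull n X) := by
  have hopen : IsOpen (F.pull n X) :=
    (h.straight n).qc.continuousOn.isOpen_inter_preimage (h.polyLike n).disk_dom.1 hXd.1
  refine ⟨hopen, ?_⟩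
  have H : OpenEmb (F.S n) (F.pull n X) := (h.straight n).qc.openEmb.mono fun z hz => hz.1
  rw [← H.isSimplyConnected_image hopen, h.image_pull hX]
  exact hXd.2

/-- The annulus V \ W covers U \ V with degree at most d around the critical value, which lies in V
because the critical orbit does. -/
theorem le_annMod_W (h : Admissible d ε η κ C F) (hd : 2 ≤ d) {n : ℕ} (hn : 1 ≤ n) :
    ENNReal.ofReal (ε / d) ≤ annMod (F.V n) (F.W n) := by
  have h1 := (h.bounds n hn).1.trans
    ((h.polyLike n).annMod_le (by omega) (h.zero_mem n 1))
  rw [ENNReal.ofReal_div_of_pos (by positivity), ENNReal.ofReal_natCast]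
  exact ENNReal.div_le_of_le_mul' h1

theorem annMod_equip (h : Admissible d ε η κ C F) (hd : 2 ≤ d) {n : ℕ} (hn : 1 ≤ n) :
    ENNReal.ofReal (ε / d) ≤
        annMod (F.V n) (F.pull n (insideEquipotential d (F.c n) F.r)) ∧
      annMod (F.V n) (F.pull n (insideEquipotential d (F.c n) F.r)) ≤ ENNReal.ofReal (2 * η) := by
  have hK : F.K n ⊆ F.pull n (insideEquipotential d (F.c n) F.r) := fun z hz =>
    ⟨hz 0, Or.inl (h.filledJulia_eq n ▸ mem_image_of_mem _ hz)⟩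
  exact ⟨(h.le_annMod_W hd hn).trans (annMod_anti (h.pull_subset_W Subset.rfl)),
    (annMod_anti hK).trans (h.bounds n hn).2.2⟩

/-- At a satellite level the dividing fixed point belongs to the renormalized filled Julia set. -/
theorem exists_dividing (h : Admissible d ε η κ C F) (hd : 2 ≤ d) {n : ℕ} (hs : F.Sat d n) :
    ∃ b ∈ F.K n, b ∈ F.K (n + 1) ∧ F.S n b = F.α n := by
  obtain ⟨p', Kl', hs'⟩ := hs
  obtain ⟨p, Kl, -, hs, hK⟩ := h.renorm n
  have hs := hs.resolve_right hs'.not_isPrimitive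
  have hα : F.α n ∈ filledJulia d (F.c n) := hs.1.mem_filledJulia
  rw [h.filledJulia_eq] at hα
  obtain ⟨b, hb, hbα⟩ := hα
  refine ⟨b, hb, ?_, hbα⟩
  rw [hK]
  refine ⟨hb 0, ?_⟩
  rw [hbα]
  exact hs.dividing_mem hd (h.isCompact_filledJulia n) (h.isPreconnected_filledJulia n)
    (h.zero_mem_filledJulia n) h.one_lt

theorem L_subset (h : Admissible d ε η κ C F) {n : ℕ} (hc : F.CaseC d n) :
    F.L (n + 1) ⊆ insideEquipotential d (F.c n) F.r \ closure (raysAt d (F.c n) (F.α n)) :=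
  (h.disks n hc).2.2.1.trans (connectedComponentIn_subset _ _)

theorem isDisk_pull_L (h : Admissible d ε η κ C F) {n : ℕ} (hc : F.CaseC d n) :
    IsDisk (F.pull n (F.L (n + 1))) :=
  h.isDisk_pull (h.disks n hc).1 ((h.L_subset hc).trans sdiff_subset)

theorem pull_E_subset (h : Admissible d ε η κ C F) {n : ℕ} (hc : F.CaseC d n) :
    F.pull (n + 1) (F.E (n + 1)) ⊆ F.pull n (F.L' (n + 1)) := by
  intro z hz
  obtain ⟨y, hy, he⟩ := ((h.disksE n hc).2.1 hz.2).1
  rw [← (h.straight (n + 1)).qc.injOn hy.2 hz.1 he]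
  exact hy.1

/-- The image of K_{n+2} is the i = 0 term of the bouquet; being connected and containing 0, it lies
in the component that E surrounds. -/
theorem K_subset_pull_E (h : Admissible d ε η κ C F) {n : ℕ} (hc : F.CaseC d n) :
    F.K (n + 2) ⊆ F.pull (n + 1) (F.E (n + 1)) := by
  obtain ⟨p, Kl, ht, -, hK⟩ := h.renorm (n + 1)
  have hV : F.K (n + 2) ⊆ F.V (n + 1) := fun z hz => by
    rw [hK] at hz; exact hz.1
  have hdiv : 0 < F.t (n + 2) / F.t (n + 1) :=
    Nat.div_pos (Nat.le_of_dvd (h.t_pos _) ⟨p, ht⟩) (h.t_pos _)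
  have hb : F.S (n + 1) '' F.K (n + 2) ⊆ F.bouquet d (n + 1) (n + 2) := by
    refine ((h.isPreconnected_K (n + 2)).image _
      ((h.straight (n + 1)).qc.continuousOn.mono hV)).subset_connectedComponentIn
      ⟨0, h.zero_mem _, (h.straight (n + 1)).zero⟩ ?_
    refine Subset.trans ?_ (subset_biUnion_of_mem (Finset.mem_coe.2 (Finset.mem_range.2 hdiv)))
    simp
  exact fun z hz => ⟨hV hz, (h.disksE n hc).2.2.1 (hb ⟨z, hz, rfl⟩)⟩

/-- Rings of L \ L' pull back through the straightening of level n with modulus divided by at most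
κ, and the cut out disk lies within the preimage of L'. -/
theorem le_annMod_pull (h : Admissible d ε η κ C F) {n : ℕ} (hc : F.CaseC d n) :
    ENNReal.ofReal (1 / C) ≤ ENNReal.ofReal κ *
      annMod (F.pull n (F.L (n + 1))) (F.pull (n + 1) (F.E (n + 1))) := by
  refine (h.disks n hc).2.2.2.2.2.2.1.1.trans ?_
  refine iSup_le fun A => iSup_le fun m => iSup_le fun ⟨hA, hAL, hLA⟩ => ?_
  have hqc := (h.straight n).qc
  have hκ : 0 < κ := by linarith [hqc.one_le]
  have hLi := (h.L_subset hc).trans sdiff_subset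
  have hAi := (hAL.trans sdiff_subset).trans hLi
  have himg := h.image_pull hAi
  have hclW := closure_mono (h.pull_subset_W hAi)
  have hcl := hclW.trans (h.isCompact_closure_W n).2
  have hcc := (h.isCompact_closure_W n).1.of_isClosed_subset isClosed_closure hclW
  obtain ⟨m', hA'⟩ := (hqc.ring_iff _ hcc hcl).2 ⟨m, himg.symm ▸ hA⟩
  have hle := (hqc.ring_le _ hcc hcl _ _ hA' (himg.symm ▸ hA)).2
  have hE := h.pull_E_subset hc
  have hpA : F.pull n A ⊆ F.pull n (F.L (n + 1)) := fun z hz => ⟨hz.1, (hAL hz.2).1⟩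
  obtain ⟨Φ, hΦ⟩ := hA'.exists_stripMap
  calc ENNReal.ofReal m ≤ ENNReal.ofReal (κ * m') := ENNReal.ofReal_le_ofReal hle
    _ = ENNReal.ofReal κ * ENNReal.ofReal m' := ENNReal.ofReal_mul hκ.le
    _ ≤ _ := by
      gcongr
      refine le_iSup_of_le (F.pull n A) (le_iSup_of_le m' (le_iSup_of_le ⟨hA', ?_, ?_⟩ le_rfl))
      · exact fun z hz => ⟨hpA hz, fun hzE => (hAL hz.2).2 (hE hzE).2⟩
      · intro z hz
        have hzL : z ∈ F.pull n (F.L (n + 1)) :=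
          ⟨(hE hz).1, (h.disks n hc).2.2.2.1 (hE hz).2⟩
        rw [← (hqc.openEmb.mono fun z hz => hz.1).mem_surrounded_iff (h.isDisk_pull_L hc)
          hΦ.isOpen hpA hzL, himg]
        exact hLA (hE hz).2

/-- The two constants are the alternatives of `IsRing.le_or_le`: 6d/ε from a crossing ring of
modulus at least ε/(2d), and 48πκd² from δ = 1/d. -/
theorem annMod_pull_le (h : Admissible d ε η κ C F) (hd : 2 ≤ d) (hε : 0 < ε) {n : ℕ}
    (hc : F.CaseC d n) :
    annMod (F.pull n (F.L (n + 1))) (F.pull (n + 1) (F.E (n + 1))) ≤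
      ENNReal.ofReal (max (6 * d / ε) (48 * Real.pi * κ * d ^ 2)) := by
  refine iSup_le fun A => iSup_le fun m => iSup_le fun ⟨hA, hAL, hLA⟩ => ?_
  refine ENNReal.ofReal_le_ofReal ?_
  have hdp : (0 : ℝ) < d := by exact_mod_cast (by omega : 0 < d)
  -- Halving ε/d makes the inequality strict, so that an actual ring can be extracted from the
  -- supremum.
  have hlt : ENNReal.ofReal (ε / (2 * d)) < annMod (F.V (n + 1)) (F.K (n + 1)) := by
    refine lt_of_lt_of_le ?_ ((h.le_annMod_W hd (by omega)).trans (annMod_anti (K_subset_W _)))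
    rw [ENNReal.ofReal_lt_ofReal_iff (by positivity)]
    gcongr
    linarith
  simp only [annMod, lt_iSup_iff] at hlt
  obtain ⟨A', m', ⟨hA', hA'V, hKA'⟩, hm'⟩ := hlt
  have hm' := (ENNReal.ofReal_lt_ofReal_iff hA'.1).1 hm'
  -- Both levels of case 𝒞 are used: the first puts b into K_{n+1} but outside L, the second puts a
  -- into K_{n+2}, inside the cut out disk.
  obtain ⟨b, -, hbK, hb⟩ := h.exists_dividing hd hc.1
  obtain ⟨a, haK, haK', ha⟩ := h.exists_dividing hd hc.2
  obtain ⟨p, Kl, hdiv, -⟩ := hc.1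
  obtain ⟨p', Kl', hdiv', -⟩ := hc.2
  have hbL : b ∉ F.pull n (F.L (n + 1)) := fun hbL => (h.L_subset hc hbL.2).2
    (hb.symm ▸ hdiv.mem_closure_raysAt)
  have hSb : ‖F.S (n + 1) b‖ ≤ 2 := by
    rw [← mem_closedBall_zero_iff]
    refine filledJulia_subset_closedBall hd (h.zero_mem_filledJulia (n + 1)) ?_
    rw [h.filledJulia_eq]
    exact ⟨b, hbK, rfl⟩
  have hδ1 : (d : ℝ)⁻¹ ≤ 1 := inv_le_one_of_one_le₀ (by exact_mod_cast (by omega : 1 ≤ d))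
  rcases hA.le_or_le hAL hLA (h.isDisk_pull_L hc).isFull (h.polyLike (n + 1)).disk_dom
    (h.straight (n + 1)).qc (h.straight (n + 1)).zero (h.isPreconnected_K _) (K_subset _)
    (h.zero_mem _) hbK hbL (h.K_subset_pull_E hc (h.zero_mem _)) (h.K_subset_pull_E hc haK')
    (haK 0) hSb (inv_pos.2 hdp) hδ1 (ha ▸ hdiv'.inv_le_norm hd) hA' hA'V hKA' with h1 | h1
  · refine le_max_of_le_left ?_
    have h2 : m * (ε / (2 * d)) ≤ 3 := (mul_le_mul_of_nonneg_left hm'.le hA.1.le).trans h1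
    rw [le_div_iff₀ hε]
    rw [← mul_div_assoc, div_le_iff₀ (by positivity)] at h2
    linarith
  · refine le_max_of_le_right ?_
    rw [inv_pow, inv_mul_le_iff₀ (by positivity)] at h1
    linarith

/-- Two-sided bounds for the annuli between the holes and the cut out disks. -/
theorem annMod_mem_Icc (h : Admissible d ε η κ C F) (hd : 2 ≤ d) (hε : 0 < ε) {n : ℕ}
    (hn : 1 ≤ n) : annMod (F.hole d n) (F.Del d n) ∈
      Icc (ENNReal.ofReal (min (ε / d) (1 / C / max κ 1)))
        (ENNReal.ofReal (max (2 * η) (max (6 * d / ε) (48 * Real.pi * max κ 1 * d ^ 2)))) := by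
  obtain ⟨n, rfl⟩ : ∃ k, n = k + 1 := ⟨n - 1, by omega⟩
  have hκ := (h.straight 0).qc.one_le
  rw [max_eq_left hκ]
  by_cases hc : F.CaseC d n
  · simp only [Choices.hole, Choices.Del, if_pos hc]
    refine ⟨(ENNReal.ofReal_le_ofReal (min_le_right _ _)).trans ?_,
      (h.annMod_pull_le hd hε hc).trans (ENNReal.ofReal_le_ofReal (le_max_right _ _))⟩
    rw [ENNReal.ofReal_div_of_pos (by linarith)]
    exact ENNReal.div_le_of_le_mul' (h.le_annMod_pull hc)
  · simp only [Choices.hole, Choices.Del, if_neg hc]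
    obtain ⟨h1, h2⟩ := h.annMod_equip hd hn
    exact ⟨(ENNReal.ofReal_le_ofReal (min_le_left _ _)).trans h1,
      h2.trans (ENNReal.ofReal_le_ofReal (le_max_left _ _))⟩

end Admissible

end GlueSpace

/-! ### Comparison of two maps -/

theorem mainTheorem10 (d : ℕ) (hd : 2 ≤ d) (ε η κ C : ℝ) (hε : 0 < ε) (hC : 0 < C) :
    ∃ M' : ℝ, 1 ≤ M' ∧ ∀ F G : GlueSpace.Choices,
      GlueSpace.Admissible d ε η κ C F → GlueSpace.Admissible d ε η κ C G →
      ∀ n : ℕ, 1 ≤ n →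
        0 < GlueSpace.annMod (F.hole d n) (F.Del d n) ∧
        GlueSpace.annMod (F.hole d n) (F.Del d n) < ⊤ ∧
        0 < GlueSpace.annMod (G.hole d n) (G.Del d n) ∧
        GlueSpace.annMod (G.hole d n) (G.Del d n) < ⊤ ∧
        1 / M' ≤ (GlueSpace.annMod (G.hole d n) (G.Del d n)).toReal /
          (GlueSpace.annMod (F.hole d n) (F.Del d n)).toReal ∧
        (GlueSpace.annMod (G.hole d n) (G.Del d n)).toReal /
          (GlueSpace.annMod (F.hole d n) (F.Del d n)).toReal ≤ M' := by
  -- κ ≥ 1 follows only from an admissible choice, but the constants are fixed before any is given;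
  -- `max κ 1` keeps `lo` positive and agrees with κ whenever it matters.
  set lo := min (ε / d) (1 / C / max κ 1)
  set hi := max (2 * η) (max (6 * d / ε) (48 * Real.pi * max κ 1 * d ^ 2))
  have hdp : (0 : ℝ) < d := by exact_mod_cast (by omega : 0 < d)
  have hlo : 0 < lo := lt_min (by positivity) (by positivity)
  have hhi : 0 < hi := lt_max_of_lt_right (lt_max_of_lt_left (by positivity))
  have key : ∀ F, GlueSpace.Admissible d ε η κ C F → ∀ n, 1 ≤ n →
      0 < GlueSpace.annMod (F.hole d n) (F.Del d n) ∧
      GlueSpace.annMod (F.hole d n) (F.Del d n) < ⊤ ∧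
      lo ≤ (GlueSpace.annMod (F.hole d n) (F.Del d n)).toReal ∧
      (GlueSpace.annMod (F.hole d n) (F.Del d n)).toReal ≤ hi := by
    intro F hF n hn
    obtain ⟨h1, h2⟩ := hF.annMod_mem_Icc hd hε hn
    have htop := h2.trans_lt ENNReal.ofReal_lt_top
    exact ⟨(ENNReal.ofReal_pos.2 hlo).trans_le h1, htop,
      (ENNReal.ofReal_le_iff_le_toReal htop.ne).1 h1, ENNReal.toReal_le_of_le_ofReal hhi.le h2⟩
  refine ⟨max 1 (hi / lo), le_max_left _ _, fun F G hF hG n hn => ?_⟩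
  obtain ⟨f1, f2, f3, f4⟩ := key F hF n hn
  obtain ⟨g1, g2, g3, g4⟩ := key G hG n hn
  refine ⟨f1, f2, g1, g2, ?_, ?_⟩
  · have h1 : 1 / max 1 (hi / lo) ≤ lo / hi := by
      rw [← one_div_div hi lo]
      exact one_div_le_one_div_of_le (by positivity) (le_max_right _ _)
    exact h1.trans (div_le_div₀ (hlo.le.trans g3) g3 (hlo.trans_le f3) f4)
  · exact (div_le_div₀ hhi.le g4 hlo f3).trans (le_max_right _ _)

end
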